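/- Let $\theta\in\mathbb R$ and let $\mathbb T^2\subset SU(3)$ be the maximal torus of the matrices $t(x)=\mathrm{diag}(e^{2\pi i x_1},e^{2\pi i x_2},e^{-2\pi i(x_1+x_2)})$, $x\in\mathbb R^2$. For $v=(x,s)\in\mathbb R^2\times\mathbb R^2$ put $(\alpha_v f)(g)=f(t(x)^{-1}\,g\,t(s))$, and for $n\in\mathbb Z^4$ let $A_n=\{f\in C(SU(3)):\alpha_v f=e^{2\pi i\,n\cdot v}f\ \text{for all }v\}$. Let $J=\theta_0\oplus(-\theta_0)$ with $\theta_0=\begin{pmatrix}0&-\theta\\ \theta&0\end{pmatrix}$, and $\chi(n,m)=e^{\pi i\,n\cdot Jm}=e^{\pi i\theta(-n_1m_2+n_2m_1+n_3m_4-n_4m_3)}$. For $f\in A_n$ let $L_f$ be the bounded operator on $L^2(SU(3))$ (Haar measure) with $L_f\xi=\chi(n,m)f\xi$ for $\xi$ of degree $m$ under $\alpha$, and let $C(SU(3)_\theta)$ be the C*-algebra of operators generated by all $L_f$, $f\in A_n$, $n\in\mathbb Z^4$. Then: (1) $L_fL_g=\chi(n,m)L_{fg}$ and $L_f^*=L_{\bar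 f}$ for $f\in A_n$, $g\in A_m$, and $f\mapsto L_f$ extends to an injective linear map on $\bigoplus_n A_n$ (so that $C(SU(3)_\theta)$ is a C*-completion of $\bigoplus_n A_n$ with the deformed product $f\times_\theta g=\chi(n,m)fg$ and complex conjugation as involution). (2) The coordinate functions $u_{ij}$ $(1\le i,j\le3)$ lie in isotypic components, and as elements of $C(SU(3)_\theta)$ they satisfy, with $q=e^{2\pi i\theta}$ (so $q^2=e^{4\pi i\theta}$), \begin{align*} &u_{11}u_{12}=q\,u_{12}u_{11},&& u_{13}u_{11}=q\,u_{11}u_{13},&& u_{21}u_{11}=q\,u_{11}u_{21},\\ &u_{11}u_{22}=u_{22}u_{11},&& u_{23}u_{11}=q^2u_{11}u_{23},&& u_{11}u_{31}=q\,u_{31}u_{11},\\ &u_{11}u_{32}=q^2u_{32}u_{11},&& u_{11}u_{33}=u_{33}u_{11},&& u_{12}u_{13}=q\,u_{13}u_{12},\\ &u_{21}u_{12}=q^2u_{12}u_{21},&& u_{22}u_{12}=q\,u_{12}u_{22},&& u_{12}u_{23}=u_{23}u_{12},\\ &u_{12}u_{31}=u_{31}u_{12},&& u_{12}u_{32}=q\,u_{32}u_{12},&&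 u_{12}u_{33}=q^2u_{33}u_{12},\\ &u_{13}u_{21}=u_{21}u_{13},&& u_{22}u_{13}=q^2u_{13}u_{22},&& u_{23}u_{13}=q\,u_{13}u_{23},\\ &u_{13}u_{31}=q^2u_{31}u_{13},&& u_{13}u_{32}=u_{32}u_{13},&& u_{13}u_{33}=q\,u_{33}u_{13},\\ &u_{21}u_{22}=q\,u_{22}u_{21},&& u_{23}u_{21}=q\,u_{21}u_{23},&& u_{31}u_{21}=q\,u_{21}u_{31},\\ &u_{21}u_{32}=u_{32}u_{21},&& u_{33}u_{21}=q^2u_{21}u_{33},&& u_{22}u_{23}=q\,u_{23}u_{22},\\ &u_{31}u_{22}=q^2u_{22}u_{31},&& u_{32}u_{22}=q\,u_{22}u_{32},&& u_{22}u_{33}=u_{33}u_{22},\\ &u_{23}u_{31}=u_{31}u_{23},&& u_{32}u_{23}=q^2u_{23}u_{32},&& u_{33}u_{23}=q\,u_{23}u_{33},\\ &u_{31}u_{32}=q\,u_{32}u_{31},&& u_{33}u_{31}=q\,u_{31}u_{33},&& u_{32}u_{33}=q\,u_{33}u_{32}. \end{align*} (3) $A=C(SU(3)_\theta)$ is a compact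 quantum group with the unaltered coproduct, counit and antipode. That is, there are a unital $*$-homomorphism $\Delta:A\to A\otimes A$ (minimal C*-tensor product), a unital $*$-homomorphism $\varepsilon:A\to\mathbb C$ and a bounded unital antimultiplicative linear map $S:A\to A$ with $S(S(a^*)^*)=a$, such that: $(\Delta\otimes\mathrm{id})\Delta=(\mathrm{id}\otimes\Delta)\Delta$; $\Delta(A)(1\otimes A)$ and $\Delta(A)(A\otimes1)$ span dense subspaces of $A\otimes A$; $(\varepsilon\otimes\mathrm{id})\Delta=\mathrm{id}=(\mathrm{id}\otimes\varepsilon)\Delta$; the $*$-subalgebra $\mathcal O$ generated by the $u_{ij}$ is dense in $A$, $\Delta(\mathcal O)\subset\mathcal O\odot\mathcal O$, $S(\mathcal O)\subset\mathcal O$, and $m(S\otimes\mathrm{id})\Delta(a)=\varepsilon(a)1=m(\mathrm{id}\otimes S)\Delta(a)$ for $a\in\mathcal O$. On functions they are the classical maps: for every $f$ in an isotypic component, $\varepsilon(f)=f(e)$, $S(f)=f\circ(\,\cdot\,)^{-1}$, and $\Delta(f)=\sum_i a_i\otimes b_i$ whenever $f(xy)=\sum_i a_i(x)b_i(y)$ is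 a finite sum with all $a_i,b_i$ in isotypic components. In particular $\Delta(u_{ij})=\sum_k u_{ik}\otimes u_{kj}$, $\varepsilon(u_{ij})=\delta_{ij}$, $S(u_{ij})=u_{ji}^*$. -/

import Mathlib

open MeasureTheory TensorProduct

namespace QSU3

noncomputable section

/-! ### Spatial tensor products and compact quantum groups

A C*-algebra is given concretely, as a norm-closed unital *-subalgebra of `B(H)`. -/

section CompactQuantumGroups

variable {H K : Type*}
  [NormedAddCommGroup H] [InnerProductSpace ℂ H] [CompleteSpace H]
  [NormedAddCommGroup K] [InnerProductSpace ℂ K] [CompleteSpace K]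

/-- The Hilbert space tensor product: the completion of the algebraic tensor product. -/
def HilbertTensor (H K : Type*)
    [NormedAddCommGroup H] [InnerProductSpace ℂ H]
    [NormedAddCommGroup K] [InnerProductSpace ℂ K] : Type _ :=
  UniformSpace.Completion (H ⊗[ℂ] K)

instance : NormedAddCommGroup (HilbertTensor H K) :=
  inferInstanceAs (NormedAddCommGroup (UniformSpace.Completion (H ⊗[ℂ] K)))

instance : InnerProductSpace ℂ (HilbertTensor H K) :=
  inferInstanceAs (InnerProductSpace ℂ (UniformSpace.Completion (H ⊗[ℂ] K)))

instance : CompleteSpace (HilbertTensor H K) :=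
  inferInstanceAs (CompleteSpace (UniformSpace.Completion (H ⊗[ℂ] K)))

/-- The operator `S ⊗ T` on the Hilbert space tensor product. -/
def opTensor (S : H →L[ℂ] H) (T : K →L[ℂ] K) :
    HilbertTensor H K →L[ℂ] HilbertTensor H K :=
  (TensorProduct.mapL S T).completion

set_option linter.unusedSectionVars false in
lemma opTensor_coe (S : H →L[ℂ] H) (T : K →L[ℂ] K) (x : H ⊗[ℂ] K) :
    opTensor S T (x : UniformSpace.Completion (H ⊗[ℂ] K)) =
      (TensorProduct.mapL S T x : UniformSpace.Completion (H ⊗[ℂ] K)) :=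
  ContinuousLinearMap.completion_apply_coe (TensorProduct.mapL S T) x

/-- The spatial (minimal) C*-tensor product of `A ⊆ B(H)` and `B ⊆ B(K)`: the norm closure in
`B(H ⊗ K)` of the *-algebra generated by the operators `a ⊗ b`. -/
def spatialTensor (A : StarSubalgebra ℂ (H →L[ℂ] H)) (B : StarSubalgebra ℂ (K →L[ℂ] K)) :
    StarSubalgebra ℂ (HilbertTensor H K →L[ℂ] HilbertTensor H K) :=
  (StarAlgebra.adjoin ℂ {T | ∃ a ∈ A, ∃ b ∈ B, T = opTensor a b}).topologicalClosure

/-- The elementary tensor `a ⊗ b` as an element of the spatial tensor product. -/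
def tmulSpatial {A : StarSubalgebra ℂ (H →L[ℂ] H)} {B : StarSubalgebra ℂ (K →L[ℂ] K)}
    (a : A) (b : B) : spatialTensor A B :=
  ⟨opTensor (a : H →L[ℂ] H) (b : K →L[ℂ] K),
    StarSubalgebra.le_topologicalClosure _
      (StarAlgebra.subset_adjoin ℂ _ ⟨a, a.2, b, b.2, rfl⟩)⟩

/-- Coassociativity `(Δ ⊗ id) Δ = (id ⊗ Δ) Δ`. The *-homomorphisms `D₁ = Δ ⊗ id`, `D₂ = id ⊗ Δ`
and the rebracketing `R : (A ⊗ A) ⊗ A → A ⊗ (A ⊗ A)` are determined by their values on elementary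
tensors. -/
def IsCoassociative {A : StarSubalgebra ℂ (H →L[ℂ] H)}
    (Δ : A →⋆ₐ[ℂ] spatialTensor A A) : Prop :=
  ∃ (D₁ : spatialTensor A A →⋆ₐ[ℂ] spatialTensor (spatialTensor A A) A)
    (D₂ : spatialTensor A A →⋆ₐ[ℂ] spatialTensor A (spatialTensor A A))
    (R : spatialTensor (spatialTensor A A) A →⋆ₐ[ℂ] spatialTensor A (spatialTensor A A)),
    (∀ a b : A, D₁ (tmulSpatial a b) = tmulSpatial (Δ a) b) ∧
    (∀ a b : A, D₂ (tmulSpatial a b) = tmulSpatial a (Δ b)) ∧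
    (∀ a b c : A, R (tmulSpatial (tmulSpatial a b) c) = tmulSpatial a (tmulSpatial b c)) ∧
    ∀ a : A, R (D₁ (Δ a)) = D₂ (Δ a)

/-- Compact quantum groups in the sense of Woronowicz: a unital C*-algebra `A` with a
coassociative unital *-homomorphism `Δ : A → A ⊗ A` such that the linear spans of
`Δ(A)(1 ⊗ A)` and of `Δ(A)(A ⊗ 1)` are dense in `A ⊗ A`. -/
structure IsCompactQuantumGroup (A : StarSubalgebra ℂ (H →L[ℂ] H))
    (Δ : A →⋆ₐ[ℂ] spatialTensor A A) : Prop where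
  isClosed : IsClosed (A : Set (H →L[ℂ] H))
  coassoc : IsCoassociative Δ
  dense_right : Dense
    (Submodule.span ℂ {T | ∃ a b : A, T = Δ a * tmulSpatial 1 b} : Set (spatialTensor A A))
  dense_left : Dense
    (Submodule.span ℂ {T | ∃ a b : A, T = Δ a * tmulSpatial b 1} : Set (spatialTensor A A))

/-- The counit law `(ε ⊗ id) Δ = id = (id ⊗ ε) Δ`. The *-homomorphisms `E₁ = ε ⊗ id` and
`E₂ = id ⊗ ε` are determined by their values on elementary tensors. -/
def IsCounit {A : StarSubalgebra ℂ (H →L[ℂ] H)}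
    (Δ : A →⋆ₐ[ℂ] spatialTensor A A) (ε : A →⋆ₐ[ℂ] ℂ) : Prop :=
  ∃ E₁ E₂ : spatialTensor A A →⋆ₐ[ℂ] A,
    (∀ a b : A, E₁ (tmulSpatial a b) = ε a • b) ∧
    (∀ a b : A, E₂ (tmulSpatial a b) = ε b • a) ∧
    ∀ a : A, E₁ (Δ a) = a ∧ E₂ (Δ a) = a

/-- `S` is a continuous coinverse (antipode) for `(A, Δ, ε)`: a bounded unital linear
antihomomorphism with `S (S (a*)*) = a`, restricting to the dense *-subalgebra `O`, such that on
`O` the coproduct takes values in the algebraic tensor product `O ⊗ O` and the antipode law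
`m (S ⊗ id) Δ = ε(·) 1 = m (id ⊗ S) Δ` holds. -/
structure IsCoinverse {A : StarSubalgebra ℂ (H →L[ℂ] H)}
    (Δ : A →⋆ₐ[ℂ] spatialTensor A A) (ε : A →⋆ₐ[ℂ] ℂ)
    (O : StarSubalgebra ℂ A) (S : A →L[ℂ] A) : Prop where
  dense : Dense (O : Set A)
  map_one : S 1 = 1
  map_mul : ∀ a b : A, S (a * b) = S b * S a
  map_star : ∀ a : A, S (star (S (star a))) = a
  map_mem : ∀ a ∈ O, S a ∈ O
  antipode : ∀ a ∈ O, ∃ (k : ℕ) (b c : Fin k → A),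
    (∀ i, b i ∈ O ∧ c i ∈ O) ∧
    Δ a = ∑ i, tmulSpatial (b i) (c i) ∧
    ∑ i, S (b i) * c i = ε a • (1 : A) ∧
    ∑ i, b i * S (c i) = ε a • (1 : A)

end CompactQuantumGroups

/-! ### The compact group `SU(3)` -/

/-- The group `SU(3)`. -/
abbrev SU3 : Type := Matrix.specialUnitaryGroup (Fin 3) ℂ

instance : MeasurableSpace SU3 := borel SU3

instance : BorelSpace SU3 := ⟨rfl⟩

instance : IsTopologicalGroup SU3 where
  continuous_inv := by
    refine Continuous.subtype_mk ?_ _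
    exact continuous_star.comp continuous_subtype_val

instance : CompactSpace SU3 := by
  refine isCompact_iff_compactSpace.mp ?_
  have hK : IsCompact {A : Matrix (Fin 3) (Fin 3) ℂ | ∀ i j, A i j ∈ Metric.closedBall (0 : ℂ) 1} := by
    have h := isCompact_univ_pi (fun _ : Fin 3 =>
      isCompact_univ_pi (fun _ : Fin 3 => isCompact_closedBall (0 : ℂ) 1))
    have he : {A : Matrix (Fin 3) (Fin 3) ℂ | ∀ i j, A i j ∈ Metric.closedBall (0 : ℂ) 1} =
        Set.univ.pi (fun _ : Fin 3 => Set.univ.pi (fun _ : Fin 3 => Metric.closedBall (0 : ℂ) 1)) :=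
      Set.ext fun A => ⟨fun hA i _ j _ => hA i j,
        fun hA i j => hA i trivial j trivial⟩
    rw [he]
    exact h
  have hclosed : IsClosed (Matrix.specialUnitaryGroup (Fin 3) ℂ :
      Set (Matrix (Fin 3) (Fin 3) ℂ)) := by
    have : (Matrix.specialUnitaryGroup (Fin 3) ℂ : Set (Matrix (Fin 3) (Fin 3) ℂ)) =
        {A | A * star A = 1} ∩ {A | A.det = 1} := by
      ext A
      simp [Matrix.mem_specialUnitaryGroup_iff, Matrix.mem_unitaryGroup_iff]
    rw [this]
    exact (isClosed_eq (by fun_prop) (by fun_prop)).inter (isClosed_eq (by fun_prop) (by fun_prop))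
  refine hK.of_isClosed_subset hclosed ?_
  intro A hA i j
  simpa using entry_norm_bound_of_unitary hA.1 i j

/-- The normalized Haar measure of `SU(3)`. -/
def haar : Measure SU3 := Measure.haarMeasure ⊤

instance : haar.IsHaarMeasure := by unfold haar; infer_instance

instance : IsProbabilityMeasure haar := ⟨by
  have h := Measure.haarMeasure_self (K₀ := (⊤ : TopologicalSpace.PositiveCompacts SU3))
  simpa [haar] using h⟩

/-- The Hilbert space `L²(SU(3))`. -/
abbrev L2SU3 : Type := Lp ℂ 2 haar

/-- The element `diag(e^{2πi x}, e^{2πi y}, e^{-2πi(x+y)})` of the maximal torus. -/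
def torusElt (x y : ℝ) : SU3 :=
  ⟨Matrix.diagonal ![Complex.exp (2 * Real.pi * Complex.I * x),
      Complex.exp (2 * Real.pi * Complex.I * y),
      Complex.exp (-(2 * Real.pi * Complex.I * (x + y)))], by
    rw [Matrix.mem_specialUnitaryGroup_iff, Matrix.mem_unitaryGroup_iff]
    constructor
    · rw [Matrix.star_eq_conjTranspose, Matrix.diagonal_conjTranspose,
        Matrix.diagonal_mul_diagonal, ← Matrix.diagonal_one]
      congr 1
      funext i
      have h2 : (starRingEnd ℂ) 2 = 2 := map_ofNat _ 2
      fin_cases i <;>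
      simp [← Complex.exp_conj, ← Complex.exp_add, h2]
    · rw [Matrix.det_diagonal, Fin.prod_univ_three]
      simp only [Matrix.cons_val, ← Complex.exp_add]
      rw [← Complex.exp_zero]
      congr 1
      ring⟩

/-- The point transformation `g ↦ exp(-x) g exp(s)` for `v = (x, s) ∈ ℝ² × ℝ²`. -/
def act (v : Fin 4 → ℝ) (g : SU3) : SU3 :=
  (torusElt (v 0) (v 1))⁻¹ * g * torusElt (v 2) (v 3)

lemma measurePreserving_act (v : Fin 4 → ℝ) : MeasurePreserving (act v) haar haar := by
  have hr : ∀ t : SU3, MeasurePreserving (fun g => g * t) haar haar := fun t =>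
    ⟨(continuous_mul_const t).measurable, by
      have : IsProbabilityMeasure (Measure.map (fun g => g * t) haar) :=
        Measure.isProbabilityMeasure_map (continuous_mul_const t).measurable.aemeasurable
      exact Measure.isHaarMeasure_eq_of_isProbabilityMeasure _ _⟩
  exact (hr _).comp (measurePreserving_mul_left haar _)

/-- The unitary operator `(α_v ξ)(g) = ξ(exp(-x) g exp(s))` on `L²(SU(3))`. -/
def translation (v : Fin 4 → ℝ) : L2SU3 →L[ℂ] L2SU3 :=
  (Lp.compMeasurePreservingₗᵢ ℂ (act v) (measurePreserving_act v)).toContinuousLinearMap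

/-- The operator of multiplication by a continuous function on `L²(SU(3))`. -/
def mulOp (f : C(SU3, ℂ)) : L2SU3 →L[ℂ] L2SU3 :=
  (ContinuousLinearMap.mul ℂ ℂ).holderL haar ⊤ 2 2 (ContinuousMap.toLp ⊤ haar ℂ f)

/-- The isotypic component of degree `n ∈ ℤ⁴` of `C(SU(3))` under the action `α` of `𝕋² × 𝕋²`:
the `f` with `α_v f = e^{2πi n·v} f` for all `v`. -/
def isotypic (n : Fin 4 → ℤ) : Submodule ℂ C(SU3, ℂ) where
  carrier := {f | ∀ (v : Fin 4 → ℝ) (g : SU3),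
    f (act v g) = Complex.exp (2 * Real.pi * Complex.I * ∑ k, (n k : ℂ) * (v k : ℂ)) * f g}
  add_mem' := fun {f g} hf hg v x => by
    simp only [ContinuousMap.add_apply, hf v x, hg v x]; ring
  zero_mem' := fun v x => by simp
  smul_mem' := fun c f hf v x => by
    simp only [ContinuousMap.smul_apply, smul_eq_mul, hf v x]; ring

/-- The skew-symmetric matrix `J = θ ⊕ (-θ)`, where `θ` also denotes the matrix
`(0, -θ; θ, 0)`. -/
def J (θ : ℝ) : Matrix (Fin 4) (Fin 4) ℝ :=
  !![0, -θ, 0, 0; θ, 0, 0, 0; 0, 0, 0, θ; 0, 0, -θ, 0]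

/-- The bicharacter `χ(n, m) = exp(πi n · J m)` on `ℤ⁴`. -/
def chi (θ : ℝ) (n m : Fin 4 → ℤ) : ℂ :=
  Complex.exp (Real.pi * Complex.I *
    (((fun k => (n k : ℝ)) ⬝ᵥ (J θ).mulVec (fun k => (m k : ℝ)) : ℝ) : ℂ))

/-! ### The deformed algebra -/

/-- The deformed left multiplication operator `L_f` on `L²(SU(3))` of a function `f` of degree `n`,
that is, `L_f ξ = χ(n, m) f ξ` for `ξ` of degree `m`. Since `α_v ξ = e^{2πi m·v} ξ`, this is
`f` times the translation by `v = -½ J n`. -/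
def quantize (θ : ℝ) (n : Fin 4 → ℤ) (f : C(SU3, ℂ)) : L2SU3 →L[ℂ] L2SU3 :=
  mulOp f ∘L translation (-(1 / 2 : ℝ) • (J θ).mulVec (fun k => (n k : ℝ)))

/-- The C*-algebra `C(SU(3)_θ)`: the norm closure in `B(L²(SU(3)))` of the *-algebra generated by
the deformed left multiplications by functions in the isotypic components. -/
def CSU3 (θ : ℝ) : StarSubalgebra ℂ (L2SU3 →L[ℂ] L2SU3) :=
  (StarAlgebra.adjoin ℂ {T | ∃ n, ∃ f ∈ isotypic n, T = quantize θ n f}).topologicalClosure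

/-- A function `f` in the isotypic component of degree `n`, as an element of `C(SU(3)_θ)`. -/
def elt (θ : ℝ) {n : Fin 4 → ℤ} (f : isotypic n) : CSU3 θ :=
  ⟨quantize θ n f, StarSubalgebra.le_topologicalClosure _
    (StarAlgebra.subset_adjoin ℂ _ ⟨n, f, f.2, rfl⟩)⟩

/-- The coordinate function `u_{ij} : SU(3) → ℂ`; the indices run over `0, 1, 2`. -/
def coord (i j : Fin 3) : C(SU3, ℂ) where
  toFun g := (g : Matrix (Fin 3) (Fin 3) ℂ) i j
  continuous_toFun :=
    (continuous_subtype_val (p := fun A => A ∈ Matrix.specialUnitaryGroup (Fin 3) ℂ)).matrix_elem i j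

/-- The degree of the coordinate function `u_{ij}`. -/
def deg (i j : Fin 3) : Fin 4 → ℤ :=
  ![![-1, 0, 1] i, ![0, -1, 1] i, ![1, 0, -1] j, ![0, 1, -1] j]

lemma coord_mem (i j : Fin 3) : coord i j ∈ isotypic (deg i j) := by
  intro v g
  have h2 : (starRingEnd ℂ) 2 = 2 := map_ofNat _ 2
  have hact : ((act v g : SU3) : Matrix (Fin 3) (Fin 3) ℂ) =
      star ((torusElt (v 0) (v 1) : SU3) : Matrix (Fin 3) (Fin 3) ℂ) *
        (g : Matrix (Fin 3) (Fin 3) ℂ) *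
        ((torusElt (v 2) (v 3) : SU3) : Matrix (Fin 3) (Fin 3) ℂ) := rfl
  change ((act v g : SU3) : Matrix (Fin 3) (Fin 3) ℂ) i j =
    _ * (g : Matrix (Fin 3) (Fin 3) ℂ) i j
  rw [hact]
  simp only [torusElt, Matrix.star_eq_conjTranspose, Matrix.diagonal_conjTranspose,
    Matrix.mul_diagonal, Matrix.diagonal_mul, Fin.sum_univ_four, deg]
  rw [mul_right_comm]
  congr 1
  fin_cases i <;> fin_cases j <;>
  · simp [← Complex.exp_conj, ← Complex.exp_add, h2]
    try ring_nf

/-- The coordinate function `u_{ij}` as an element of `C(SU(3)_θ)`. -/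
def u (θ : ℝ) (i j : Fin 3) : CSU3 θ := elt θ ⟨coord i j, coord_mem i j⟩

/-- The phase `e^{2πiθ}`. -/
def q (θ : ℝ) : ℂ := Complex.exp (2 * Real.pi * Complex.I * θ)

/-- The phase `e^{4πiθ}`. -/
def q₂ (θ : ℝ) : ℂ := Complex.exp (4 * Real.pi * Complex.I * θ)

/-- The *-subalgebra of `C(SU(3)_θ)` generated by the coordinate functions. -/
def coordAlgebra (θ : ℝ) : StarSubalgebra ℂ (CSU3 θ) :=
  StarAlgebra.adjoin ℂ {a | ∃ i j, a = u θ i j}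

end

end QSU3

open QSU3

/-! A function `f` of degree n acts as multiplication by `f` composed with translation by -½Jn.
Since J is skew-symmetric, this translation multiplies a function of degree m by χ(n,m) and fixes
`f` itself. Hence the product rule (`quantize_mul`), the adjoint rule (`star_quantize`) and, as
χ(n,m)/χ(m,n) = χ(n,m)², every commutation relation (`u_comm`). Applied to the constant function 1
an operator returns its symbol, and Fourier averaging over the torus separates the degrees; this
gives injectivity (`elt_sum_eq_zero`).

The structure maps are the classical ones. What needs proof is that they respect the twist and are
bounded for the operator norm.

Coproduct: in f(xy) = ∑ aᵢ(x) bᵢ(y) the inner degrees of the two legs are opposite, and they meet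
blocks of J of opposite sign, so the inner phases cancel and Δ is multiplicative
(`Matched.chi_mul_chi`). Boundedness comes from the multiplicative unitary W(ξ ⊗ f) = Δ(f)(ξ ⊗ 1).
It is isometric by invariance of the Haar integral (`IsCoproduct.inner_apply`) and onto because 1 ⊗
O ⊆ Δ(O)(O ⊗ 1), a consequence of the unitarity of (u_ij) (`ampRight_mem`). Then Δ(T) = W(1 ⊗ T)W*
extends the coproduct to all bounded operators.

Counit: normalized indicators of conjugation-invariant neighbourhoods shrinking to the identity are
approximate eigenvectors of L_f with eigenvalue f(e) (`tendsto_quantize_bump`). A pair of operators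
asymptotically intertwined by isometries has its second norm dominated by its first, so such pairs
form graphs of *-homomorphisms; this yields ε, ε ⊗ id and id ⊗ ε.

Antipode: S(T) = ĴT*Ĵ with Ĵξ(g) equal to the conjugate of ξ(g⁻¹) (`antipodeOp_quantize`).

The coordinate functions generate, by Stone–Weierstrass and contractivity of the isotypic
projections (`CSU3_eq`), so coassociativity and the counit law need checking only on the u_ij, and
the antipode law spreads from them to O. -/

namespace QSU3

noncomputable section

set_option linter.unusedSectionVars false

/-! ### Hilbert space tensor products and their operators -/

section HilbertTensorBasics

variable {H K L : Type*}
  [NormedAddCommGroup H] [InnerProductSpace ℂ H] [CompleteSpace H]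
  [NormedAddCommGroup K] [InnerProductSpace ℂ K] [CompleteSpace K]
  [NormedAddCommGroup L] [InnerProductSpace ℂ L] [CompleteSpace L]

/-- Two total families with the same Gram matrix are related by a unitary. -/
theorem exists_unitary_of_gram {J : Type*} (x : J → H) (y : J → K)
    (hx : Dense (Submodule.span ℂ (Set.range x) : Set H))
    (hy : Dense (Submodule.span ℂ (Set.range y) : Set K))
    (h : ∀ i j, inner ℂ (x i) (x j) = inner ℂ (y i) (y j)) :
    ∃ U : H ≃ₗᵢ[ℂ] K, ∀ j, U (x j) = y j := by
  -- Equal Gram matrices give corresponding combinations equal norms, so x_j ↦ y_j extends linearly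
  -- and isometrically even if the families are linearly dependent.
  have hin : ∀ c : J →₀ ℂ, ‖Finsupp.linearCombination ℂ x c‖ =
      ‖Finsupp.linearCombination ℂ y c‖ := by
    intro c
    have : inner ℂ (Finsupp.linearCombination ℂ x c) (Finsupp.linearCombination ℂ x c) =
      inner ℂ (Finsupp.linearCombination ℂ y c) (Finsupp.linearCombination ℂ y c) := by
      simp only [Finsupp.linearCombination_apply, Finsupp.sum, sum_inner, inner_sum,
        inner_smul_left, inner_smul_right, h]
    rw [inner_self_eq_norm_sq_to_K, inner_self_eq_norm_sq_to_K] at this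
    have h2 : ‖Finsupp.linearCombination ℂ x c‖ ^ 2 = ‖Finsupp.linearCombination ℂ y c‖ ^ 2 := by
      exact_mod_cast this
    exact (sq_eq_sq₀ (norm_nonneg _) (norm_nonneg _)).mp h2
  have dx : DenseRange (Finsupp.linearCombination ℂ x) := by
    rw [DenseRange, ← LinearMap.coe_range, Finsupp.range_linearCombination]; exact hx
  have dy : DenseRange (Finsupp.linearCombination ℂ y) := by
    rw [DenseRange, ← LinearMap.coe_range, Finsupp.range_linearCombination]; exact hy
  let U := (LinearEquiv.refl ℂ (J →₀ ℂ)).extendOfIsometry (Finsupp.linearCombination ℂ x)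
    (Finsupp.linearCombination ℂ y) dx dy (fun c => (hin c).symm)
  refine ⟨U, fun j => ?_⟩
  have := LinearEquiv.extendOfIsometry_eq (LinearEquiv.refl ℂ (J →₀ ℂ)) _ _ dx dy
    (fun c => (hin c).symm) (Finsupp.single j 1)
  simpa using this

/-- The elementary tensor `x ⊗ y` in the Hilbert space tensor product. -/
def pt : H →L[ℂ] K →L[ℂ] HilbertTensor H K :=
  (ContinuousLinearMap.compL ℂ K (H ⊗[ℂ] K) (UniformSpace.Completion (H ⊗[ℂ] K))
    UniformSpace.Completion.toComplL) ∘L TensorProduct.mkL ℂ H K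

lemma pt_eq (x : H) (y : K) :
    pt x y = ((x ⊗ₜ[ℂ] y : H ⊗[ℂ] K) : UniformSpace.Completion (H ⊗[ℂ] K)) := rfl

@[simp] lemma inner_pt (x x' : H) (y y' : K) :
    inner ℂ (pt x y) (pt x' y') = inner ℂ x x' * inner ℂ y y' := by
  rw [pt_eq, pt_eq]
  exact (UniformSpace.Completion.inner_coe _ _).trans (TensorProduct.inner_tmul (𝕜 := ℂ) x x' y y')

@[simp] lemma norm_pt (x : H) (y : K) : ‖pt x y‖ = ‖x‖ * ‖y‖ := by
  rw [pt_eq]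
  exact (UniformSpace.Completion.norm_coe _).trans (TensorProduct.norm_tmul _ _)

@[simp] lemma opTensor_pt (S : H →L[ℂ] H) (T : K →L[ℂ] K) (x : H) (y : K) :
    opTensor S T (pt x y) = pt (S x) (T y) := opTensor_coe S T _

/-- Elementary tensors of vectors from total sets are total. -/
lemma dense_span_pt {X : Set H} {Y : Set K} (hX : Dense (Submodule.span ℂ X : Set H))
    (hY : Dense (Submodule.span ℂ Y : Set K)) :
    Dense (Submodule.span ℂ (Set.image2 (fun x y => pt x y) X Y) : Set (HilbertTensor H K)) := by
  set M := (Submodule.span ℂ (Set.image2 (fun x y => pt x y) X Y)).topologicalClosure with hM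
  have hMc : IsClosed (M : Set (HilbertTensor H K)) := Submodule.isClosed_topologicalClosure _
  have h1 : ∀ x ∈ X, ∀ y : K, pt x y ∈ M := by
    intro x hx y
    have hc : IsClosed {y : K | pt x y ∈ M} := hMc.preimage (pt x).continuous
    have hs : (Submodule.span ℂ Y : Set K) ⊆ {y : K | pt x y ∈ M} := by
      change Submodule.span ℂ Y ≤ M.comap (pt x : K →L[ℂ] HilbertTensor H K).toLinearMap
      rw [Submodule.span_le]
      intro y hy
      exact Submodule.le_topologicalClosure _ (Submodule.subset_span ⟨x, hx, y, hy, rfl⟩)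
    exact (hc.closure_subset_iff.mpr hs) (hY y)
  have h2 : ∀ (x : H) (y : K), pt x y ∈ M := by
    intro x y
    have hc : IsClosed {x : H | pt x y ∈ M} := hMc.preimage (by fun_prop)
    have hs : (Submodule.span ℂ X : Set H) ⊆ {x : H | pt x y ∈ M} := by
      change Submodule.span ℂ X ≤ M.comap (pt.flip y : H →L[ℂ] HilbertTensor H K).toLinearMap
      rw [Submodule.span_le]
      exact fun x hx => h1 x hx y
    exact (hc.closure_subset_iff.mpr hs) (hX x)
  have h3 : ∀ t : H ⊗[ℂ] K, (show HilbertTensor H K from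
      (t : UniformSpace.Completion (H ⊗[ℂ] K))) ∈ M := by
    intro t
    induction t using TensorProduct.induction_on with
    | zero => rw [UniformSpace.Completion.coe_zero]; exact M.zero_mem
    | tmul x y => exact h2 x y
    | add a b ha hb =>
      rw [UniformSpace.Completion.coe_add]
      exact M.add_mem ha hb
  intro z
  have : z ∈ M := UniformSpace.Completion.induction_on z hMc h3
  exact this

lemma dense_span_univ : Dense (Submodule.span ℂ (Set.univ : Set H) : Set H) := by
  simp

/-- Bounded operators that agree on elementary tensors from total sets are equal. -/
lemma ext_pt {X : Set H} {Y : Set K} (hX : Dense (Submodule.span ℂ X : Set H))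
    (hY : Dense (Submodule.span ℂ Y : Set K)) {S T : HilbertTensor H K →L[ℂ] L}
    (h : ∀ x ∈ X, ∀ y ∈ Y, S (pt x y) = T (pt x y)) : S = T := by
  refine ContinuousLinearMap.ext_on (dense_span_pt hX hY) ?_
  rintro _ ⟨x, hx, y, hy, rfl⟩
  exact h x hx y hy

lemma ext_pt' {S T : HilbertTensor H K →L[ℂ] L} (h : ∀ x y, S (pt x y) = T (pt x y)) : S = T :=
  ext_pt dense_span_univ dense_span_univ fun x _ y _ => h x y

lemma opTensor_mul (S S' : H →L[ℂ] H) (T T' : K →L[ℂ] K) :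
    opTensor (S * S') (T * T') = opTensor S T * opTensor S' T' :=
  ext_pt' fun x y => by simp

@[simp] lemma opTensor_one : opTensor (1 : H →L[ℂ] H) (1 : K →L[ℂ] K) = 1 :=
  ext_pt' fun x y => by simp

lemma opTensor_add_left (S S' : H →L[ℂ] H) (T : K →L[ℂ] K) :
    opTensor (S + S') T = opTensor S T + opTensor S' T :=
  ext_pt' fun x y => by simp

lemma opTensor_add_right (S : H →L[ℂ] H) (T T' : K →L[ℂ] K) :
    opTensor S (T + T') = opTensor S T + opTensor S T' :=
  ext_pt' fun x y => by simp

lemma opTensor_smul_left (c : ℂ) (S : H →L[ℂ] H) (T : K →L[ℂ] K) :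
    opTensor (c • S) T = c • opTensor S T :=
  ext_pt' fun x y => by simp

lemma opTensor_smul_right (c : ℂ) (S : H →L[ℂ] H) (T : K →L[ℂ] K) :
    opTensor S (c • T) = c • opTensor S T :=
  ext_pt' fun x y => by simp

lemma star_opTensor (S : H →L[ℂ] H) (T : K →L[ℂ] K) :
    star (opTensor S T) = opTensor (star S) (star T) := by
  refine ext_pt' fun x y => ?_
  refine (dense_span_pt (dense_span_univ (H := H)) (dense_span_univ (H := K))).eq_of_inner_left ℂ ?_
  intro z hz
  induction hz using Submodule.span_induction with
  | mem z hz =>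
    obtain ⟨x', -, y', -, rfl⟩ := hz
    simp [ContinuousLinearMap.star_eq_adjoint, ContinuousLinearMap.adjoint_inner_left]
  | zero => simp
  | add a b _ _ ha hb => rw [inner_add_right, inner_add_right, ha, hb]
  | smul c a _ ha => rw [inner_smul_right, inner_smul_right, ha]

/-- `S ↦ S ⊗ 1`. -/
def ampLeft : (H →L[ℂ] H) →⋆ₐ[ℂ] (HilbertTensor H K →L[ℂ] HilbertTensor H K) where
  toFun S := opTensor S 1
  map_one' := opTensor_one
  map_mul' S T := by rw [← opTensor_mul, one_mul]
  map_zero' := ext_pt' fun x y => by simp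
  map_add' S T := opTensor_add_left S T 1
  commutes' c := ext_pt' fun x y => by simp [Algebra.algebraMap_eq_smul_one]
  map_star' S := by rw [star_opTensor, star_one]

/-- `T ↦ 1 ⊗ T`. -/
def ampRight : (K →L[ℂ] K) →⋆ₐ[ℂ] (HilbertTensor H K →L[ℂ] HilbertTensor H K) where
  toFun T := opTensor 1 T
  map_one' := opTensor_one
  map_mul' S T := by rw [← opTensor_mul, one_mul]
  map_zero' := ext_pt' fun x y => by simp
  map_add' S T := opTensor_add_right 1 S T
  commutes' c := ext_pt' fun x y => by simp [Algebra.algebraMap_eq_smul_one]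
  map_star' S := by rw [star_opTensor, star_one]

lemma ampLeft_apply (S : H →L[ℂ] H) : (ampLeft S : HilbertTensor H K →L[ℂ] _) = opTensor S 1 := rfl

lemma ampRight_apply (S : K →L[ℂ] K) : (ampRight S : HilbertTensor H K →L[ℂ] _) = opTensor 1 S := rfl

/-- The flip `H ⊗ K ≅ K ⊗ H`. -/
theorem exists_flip : ∃ U : HilbertTensor H K ≃ₗᵢ[ℂ] HilbertTensor K H,
    ∀ x y, U (pt x y) = pt y x := by
  have h1 : Dense (Submodule.span ℂ (Set.range fun p : H × K => pt p.1 p.2) :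
      Set (HilbertTensor H K)) := by
    refine (dense_span_pt (dense_span_univ (H := H)) (dense_span_univ (H := K))).mono
      (Submodule.span_mono ?_)
    rintro _ ⟨x, -, y, -, rfl⟩
    exact ⟨(x, y), rfl⟩
  have h2 : Dense (Submodule.span ℂ (Set.range fun p : H × K => pt p.2 p.1) :
      Set (HilbertTensor K H)) := by
    refine (dense_span_pt (dense_span_univ (H := K)) (dense_span_univ (H := H))).mono
      (Submodule.span_mono ?_)
    rintro _ ⟨x, -, y, -, rfl⟩
    exact ⟨(y, x), rfl⟩
  obtain ⟨U, hU⟩ := exists_unitary_of_gram _ _ h1 h2 (fun i j => by simp [mul_comm])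
  exact ⟨U, fun x y => hU (x, y)⟩

/-- The rebracketing `(H ⊗ K) ⊗ L ≅ H ⊗ (K ⊗ L)`. -/
theorem exists_assoc : ∃ U : HilbertTensor (HilbertTensor H K) L ≃ₗᵢ[ℂ]
    HilbertTensor H (HilbertTensor K L), ∀ x y z, U (pt (pt x y) z) = pt x (pt y z) := by
  have h1 : Dense (Submodule.span ℂ (Set.range fun p : H × K × L => pt (pt p.1 p.2.1) p.2.2) :
      Set (HilbertTensor (HilbertTensor H K) L)) := by
    refine (dense_span_pt (dense_span_pt (dense_span_univ (H := H)) (dense_span_univ (H := K)))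
      (dense_span_univ (H := L))).mono (Submodule.span_mono ?_)
    rintro _ ⟨_, ⟨x, -, y, -, rfl⟩, z, -, rfl⟩
    exact ⟨(x, y, z), rfl⟩
  have h2 : Dense (Submodule.span ℂ (Set.range fun p : H × K × L => pt p.1 (pt p.2.1 p.2.2)) :
      Set (HilbertTensor H (HilbertTensor K L))) := by
    refine (dense_span_pt (dense_span_univ (H := H))
      (dense_span_pt (dense_span_univ (H := K)) (dense_span_univ (H := L)))).mono
      (Submodule.span_mono ?_)
    rintro _ ⟨x, -, _, ⟨y, -, z, -, rfl⟩, rfl⟩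
    exact ⟨(x, y, z), rfl⟩
  obtain ⟨U, hU⟩ := exists_unitary_of_gram _ _ h1 h2 (fun i j => by simp [mul_assoc])
  exact ⟨U, fun x y z => hU (x, y, z)⟩

lemma ext_pt_left {X T : HilbertTensor (HilbertTensor H K) L →L[ℂ] HilbertTensor (HilbertTensor H K) L}
    (h : ∀ x y z, X (pt (pt x y) z) = T (pt (pt x y) z)) : X = T := by
  refine ext_pt (dense_span_pt (dense_span_univ (H := H)) (dense_span_univ (H := K)))
    (dense_span_univ (H := L)) ?_
  rintro _ ⟨x, -, y, -, rfl⟩ z -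
  exact h x y z

lemma ext_pt_right {X T : HilbertTensor H (HilbertTensor K L) →L[ℂ] HilbertTensor H (HilbertTensor K L)}
    (h : ∀ x y z, X (pt x (pt y z)) = T (pt x (pt y z))) : X = T := by
  refine ext_pt (dense_span_univ (H := H))
    (dense_span_pt (dense_span_univ (H := K)) (dense_span_univ (H := L))) ?_
  rintro x - _ ⟨y, -, z, -, rfl⟩
  exact h x y z

end HilbertTensorBasics

/-! ### *-homomorphisms obtained from closed graphs -/

section StarAlgebras

open Filter Topology

variable {E F : Type*} [CStarAlgebra E] [CStarAlgebra F]

/-- A closed *-subalgebra containing a set contains the C*-algebra generated by it. -/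
lemma closure_adjoin_le {s : Set E} {B : StarSubalgebra ℂ E} (hB : IsClosed (B : Set E))
    (hs : s ⊆ B) : (StarAlgebra.adjoin ℂ s).topologicalClosure ≤ B :=
  StarSubalgebra.topologicalClosure_minimal (StarAlgebra.adjoin_le hs) hB

lemma continuous_starHom (Φ : E →⋆ₐ[ℂ] F) : Continuous Φ :=
  AddMonoidHomClass.continuous_of_bound Φ 1 fun x => by
    rw [one_mul]; exact NonUnitalStarAlgHom.norm_apply_le Φ x

/-- The largest *-subalgebra contained in a subalgebra. -/
def starCore {R : Type*} [Ring R] [StarRing R] [Algebra ℂ R] [StarModule ℂ R]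
    (S : Subalgebra ℂ R) : StarSubalgebra ℂ R where
  carrier := {p | p ∈ S ∧ star p ∈ S}
  mul_mem' {p p'} h h' := ⟨mul_mem h.1 h'.1, by rw [star_mul]; exact mul_mem h'.2 h.2⟩
  add_mem' {p p'} h h' := ⟨add_mem h.1 h'.1, by rw [star_add]; exact add_mem h.2 h'.2⟩
  algebraMap_mem' c := ⟨algebraMap_mem S c, by
    rw [← algebraMap_star_comm]; exact algebraMap_mem S _⟩
  star_mem' {p} h := ⟨h.2, by rw [star_star]; exact h.1⟩

lemma isClosed_comap (Φ : E →⋆ₐ[ℂ] F) {B : StarSubalgebra ℂ F} (hB : IsClosed (B : Set F)) :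
    IsClosed (B.comap Φ : Set E) :=
  hB.preimage (continuous_starHom Φ)

/-- The restriction of a *-homomorphism to *-subalgebras. -/
def restrictHom (Φ : E →⋆ₐ[ℂ] F) (A : StarSubalgebra ℂ E) (B : StarSubalgebra ℂ F)
    (h : ∀ x ∈ A, Φ x ∈ B) : A →⋆ₐ[ℂ] B :=
  (Φ.comp A.subtype).codRestrict B fun x => h x x.2

/-- A closed *-subalgebra of `E × F` in which the second coordinate is dominated by the first one
is the graph of a *-homomorphism. -/
theorem exists_starHom_of_graph (G : StarSubalgebra ℂ (E × F)) (hGc : IsClosed (G : Set (E × F)))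
    (hG : ∀ p ∈ G, ‖p.2‖ ≤ ‖p.1‖) (A : StarSubalgebra ℂ E) {s : Set E}
    (hA : A = (StarAlgebra.adjoin ℂ s).topologicalClosure)
    (hs : ∀ x ∈ s, ∃ y, (x, y) ∈ G) :
    ∃ φ : A →⋆ₐ[ℂ] F, ∀ x : A, ((x : E), φ x) ∈ G := by
  -- In the max norm of `E × F`, domination makes the first projection isometric on `G`. Its image
  -- is therefore closed and contains `A` as soon as it contains the generators.
  have hiso : Isometry (fun p : G => (p : E × F).1) := by
    refine AddMonoidHomClass.isometry_of_norm
      ((AddMonoidHom.fst E F).comp G.toSubalgebra.toSubmodule.toAddSubgroup.subtype :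
        G.toSubalgebra.toSubmodule.toAddSubgroup →+ E) fun p => ?_
    change ‖(p : E × F).1‖ = ‖(p : E × F)‖
    rw [Prod.norm_def]
    exact (max_eq_left (hG p p.2)).symm
  have : CompleteSpace G := hGc.completeSpace_coe
  let fstHom : (E × F) →⋆ₐ[ℂ] E := StarAlgHom.fst ℂ E F
  have hcl : IsClosed ((G.map fstHom : StarSubalgebra ℂ E) : Set E) := by
    have h1 := hiso.isClosedEmbedding.isClosed_range
    convert h1 using 1
    ext x
    constructor
    · rintro ⟨p, hp, rfl⟩
      exact ⟨⟨p, hp⟩, rfl⟩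
    · rintro ⟨p, rfl⟩
      exact ⟨p, p.2, rfl⟩
  have hle : A ≤ G.map fstHom := by
    rw [hA]
    refine closure_adjoin_le hcl fun x hx => ?_
    obtain ⟨y, hy⟩ := hs x hx
    exact ⟨(x, y), hy, rfl⟩
  have hex : ∀ x : A, ∃ y, ((x : E), y) ∈ G := by
    intro x
    obtain ⟨⟨a, b⟩, hp, hx⟩ := hle x.2
    change a = x at hx
    exact ⟨b, hx ▸ hp⟩
  have huniq : ∀ {x : E} {y y' : F}, (x, y) ∈ G → (x, y') ∈ G → y = y' := by
    intro x y y' h h'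
    have h1 := hG _ (sub_mem h h')
    simp only [Prod.mk_sub_mk, sub_self, norm_zero] at h1
    exact sub_eq_zero.mp (norm_le_zero_iff.mp h1)
  choose φ hφ using hex
  exact ⟨{ toFun := φ
           map_one' := huniq (hφ 1) (one_mem G)
           map_mul' := fun x y => huniq (hφ (x * y)) (mul_mem (hφ x) (hφ y))
           map_zero' := huniq (hφ 0) (zero_mem G)
           map_add' := fun x y => huniq (hφ (x + y)) (add_mem (hφ x) (hφ y))
           commutes' := fun c => huniq (hφ (algebraMap ℂ A c)) (algebraMap_mem G c)
           map_star' := fun x => huniq (hφ (star x)) (star_mem (hφ x)) }, hφ⟩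

end StarAlgebras

/-! ### Algebras generated inside a product of commuting factors -/

section Mul

/-- If `s` lies in `D X` and commutes with `X`, then so does the algebra generated by `s`. -/
theorem adjoin_le_mul {E : Type*} [Ring E] [Algebra ℂ E] (D X : Subalgebra ℂ E) {s : Set E}
    (hcomm : ∀ x ∈ X, ∀ y ∈ s, x * y = y * x)
    (hs : s ⊆ (Subalgebra.toSubmodule D * Subalgebra.toSubmodule X : Submodule ℂ E)) :
    Subalgebra.toSubmodule (Algebra.adjoin ℂ s) ≤
      Subalgebra.toSubmodule D * Subalgebra.toSubmodule X := by
  have hone : (1 : E) ∈ Subalgebra.toSubmodule D * Subalgebra.toSubmodule X := by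
    simpa using Submodule.mul_mem_mul (show (1 : E) ∈ Subalgebra.toSubmodule D from one_mem D)
      (show (1 : E) ∈ Subalgebra.toSubmodule X from one_mem X)
  have hcomm' : ∀ x ∈ X, ∀ y ∈ Algebra.adjoin ℂ s, x * y = y * x := by
    intro x hx y hy
    induction hy using Algebra.adjoin_induction with
    | mem y hy => exact hcomm x hx y hy
    | algebraMap r => exact (Algebra.commutes r x).symm
    | add a b _ _ ha hb => rw [mul_add, add_mul, ha, hb]
    | mul a b _ _ ha hb => rw [← mul_assoc, ha, mul_assoc, hb, mul_assoc]
  intro y hy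
  change y ∈ Algebra.adjoin ℂ s at hy
  induction hy using Algebra.adjoin_induction with
  | mem y hy => exact hs hy
  | algebraMap r =>
    rw [Algebra.algebraMap_eq_smul_one]
    exact Submodule.smul_mem _ _ hone
  | add a b _ _ ha hb => exact add_mem ha hb
  | mul a b _ hb ha hb' =>
    refine Submodule.mul_induction_on ha (fun d hd x hx => ?_) (fun p q hp hq => ?_)
    -- In `d * x * b` the factor `x` moves to the right of `b`; expanding `b` in D X then collects
    -- the `D`-factors on the left and the `X`-factors on the right.
    · rw [mul_assoc, hcomm' x hx b hb, ← mul_assoc]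
      refine Submodule.mul_induction_on hb' (fun d' hd' x' hx' => ?_) (fun p q hp hq => ?_)
      · have : d * (d' * x') * x = (d * d') * (x' * x) := by simp only [mul_assoc]
        rw [this]
        exact Submodule.mul_mem_mul (D.mul_mem hd hd') (X.mul_mem hx' hx)
      · rw [mul_add, add_mul]
        exact add_mem hp hq
    · rw [add_mul]
      exact add_mem hp hq

end Mul

/-! ### Asymptotic intertwining by a sequence of isometries -/

section Asymptotic

open Filter Topology

variable {H K : Type*}
  [NormedAddCommGroup H] [InnerProductSpace ℂ H] [CompleteSpace H]
  [NormedAddCommGroup K] [InnerProductSpace ℂ K] [CompleteSpace K]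

/-- The pairs of operators that are asymptotically intertwined by a sequence of operators. -/
def asympSet (V : ℕ → H →L[ℂ] K) : Set ((K →L[ℂ] K) × (H →L[ℂ] H)) :=
  {p | Tendsto (fun i => p.1 ∘L V i - V i ∘L p.2) atTop (𝓝 0)}

variable {V : ℕ → H →L[ℂ] K}

lemma asympSet_add {p p' : (K →L[ℂ] K) × (H →L[ℂ] H)} (h : p ∈ asympSet V)
    (h' : p' ∈ asympSet V) : p + p' ∈ asympSet V := by
  have := Tendsto.add h h'
  rw [add_zero] at this
  refine this.congr fun i => ?_
  simp only [Prod.fst_add, Prod.snd_add, ContinuousLinearMap.add_comp,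
    ContinuousLinearMap.comp_add]
  abel

/-- The defect telescopes: SS'V - VTT' = S(S'V - VT') + (SV - VT)T', with fixed bounded factors
around vanishing terms. -/
lemma asympSet_mul {p p' : (K →L[ℂ] K) × (H →L[ℂ] H)} (h : p ∈ asympSet V)
    (h' : p' ∈ asympSet V) : p * p' ∈ asympSet V := by
  have h1 : Tendsto (fun i => p.1 ∘L (p'.1 ∘L V i - V i ∘L p'.2)) atTop (𝓝 (p.1 ∘L 0)) :=
    ((ContinuousLinearMap.compL ℂ H K K p.1).continuous.tendsto _).comp h'
  have h2 : Tendsto (fun i => (p.1 ∘L V i - V i ∘L p.2) ∘L p'.2) atTop (𝓝 (0 ∘L p'.2)) :=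
    (((ContinuousLinearMap.compL ℂ H H K).flip p'.2).continuous.tendsto _).comp h
  have := h1.add h2
  rw [ContinuousLinearMap.comp_zero, ContinuousLinearMap.zero_comp, add_zero] at this
  refine this.congr fun i => ?_
  ext x
  simp

lemma asympSet_algebraMap (c : ℂ) : algebraMap ℂ ((K →L[ℂ] K) × (H →L[ℂ] H)) c ∈ asympSet V := by
  refine tendsto_const_nhds.congr fun i => ?_
  ext x
  simp [Algebra.algebraMap_eq_smul_one]

/-- Since the `V i` have norm at most 1, replacing a pair by a nearby one changes the defect by a
small amount uniformly in `i`. -/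
lemma isClosed_asympSet (hV : ∀ i x, ‖V i x‖ = ‖x‖) : IsClosed (asympSet V) := by
  have hV1 : ∀ i, ‖V i‖ ≤ 1 := fun i =>
    ContinuousLinearMap.opNorm_le_bound _ zero_le_one fun x => by rw [hV, one_mul]
  rw [← isSeqClosed_iff_isClosed]
  intro u p hu hup
  change Tendsto _ _ _
  rw [Metric.tendsto_atTop]
  intro δ hδ
  obtain ⟨k, hk⟩ := (Metric.tendsto_atTop.mp hup (δ / 4) (by positivity))
  have hk := hk k le_rfl
  obtain ⟨N, hN⟩ := Metric.tendsto_atTop.mp (hu k) (δ / 4) (by positivity)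
  refine ⟨N, fun i hi => ?_⟩
  have hi := hN i hi
  rw [dist_zero_right] at hi ⊢
  rw [dist_comm, dist_eq_norm] at hk
  have h1 : ‖p.1 - (u k).1‖ < δ / 4 := (norm_fst_le (p - u k)).trans_lt hk
  have h2 : ‖p.2 - (u k).2‖ < δ / 4 := (norm_snd_le (p - u k)).trans_lt hk
  have heq : p.1 ∘L V i - V i ∘L p.2 = ((u k).1 ∘L V i - V i ∘L (u k).2) +
      (p.1 - (u k).1) ∘L V i - V i ∘L (p.2 - (u k).2) := by
    ext x
    simp
  have h3 : ‖(p.1 - (u k).1) ∘L V i‖ < δ / 4 := by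
    refine (ContinuousLinearMap.opNorm_comp_le _ _).trans_lt ?_
    nlinarith [hV1 i, norm_nonneg (p.1 - (u k).1)]
  have h4 : ‖V i ∘L (p.2 - (u k).2)‖ < δ / 4 := by
    refine (ContinuousLinearMap.opNorm_comp_le _ _).trans_lt ?_
    nlinarith [hV1 i, norm_nonneg (p.2 - (u k).2)]
  rw [heq]
  have h5 := norm_sub_le (((u k).1 ∘L V i - V i ∘L (u k).2) + (p.1 - (u k).1) ∘L V i)
    (V i ∘L (p.2 - (u k).2))
  have h6 := norm_add_le ((u k).1 ∘L V i - V i ∘L (u k).2) ((p.1 - (u k).1) ∘L V i)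
  linarith

/-- ‖V(p.2 x)‖ differs from ‖p.1(V x)‖ by a vanishing defect, and `V` is isometric. This is the
domination that turns a closed *-algebra of pairs into a graph. -/
lemma norm_le_of_mem_asympSet (hV : ∀ i x, ‖V i x‖ = ‖x‖) {p : (K →L[ℂ] K) × (H →L[ℂ] H)}
    (h : p ∈ asympSet V) : ‖p.2‖ ≤ ‖p.1‖ := by
  refine ContinuousLinearMap.opNorm_le_bound _ (norm_nonneg _) fun x => ?_
  have h1 : Tendsto (fun i => ‖p.1‖ * ‖x‖ + ‖p.1 ∘L V i - V i ∘L p.2‖ * ‖x‖) atTop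
      (𝓝 (‖p.1‖ * ‖x‖ + 0 * ‖x‖)) :=
    tendsto_const_nhds.add ((tendsto_zero_iff_norm_tendsto_zero.mp h).mul_const _)
  rw [zero_mul, add_zero] at h1
  refine ge_of_tendsto' h1 fun i => ?_
  rw [← hV i (p.2 x)]
  have h2 : V i (p.2 x) = p.1 (V i x) - (p.1 ∘L V i - V i ∘L p.2) x := by simp
  rw [h2]
  refine (norm_sub_le _ _).trans (add_le_add ?_ (ContinuousLinearMap.le_opNorm _ _))
  exact (p.1.le_opNorm _).trans_eq (by rw [hV])

variable (V) in
/-- The algebra of pairs of operators that are asymptotically intertwined by a sequence. -/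
def asympAlgebra : Subalgebra ℂ ((K →L[ℂ] K) × (H →L[ℂ] H)) where
  carrier := asympSet V
  mul_mem' := asympSet_mul
  add_mem' := asympSet_add
  algebraMap_mem' := asympSet_algebraMap

variable (V) in
/-- The *-algebra of pairs of operators asymptotically intertwined by a sequence, together with
their adjoints. -/
def asympGraph : StarSubalgebra ℂ ((K →L[ℂ] K) × (H →L[ℂ] H)) := starCore (asympAlgebra V)

lemma mem_asympGraph {p : (K →L[ℂ] K) × (H →L[ℂ] H)} :
    p ∈ asympGraph V ↔ p ∈ asympSet V ∧ star p ∈ asympSet V := Iff.rfl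

lemma isClosed_asympGraph (hV : ∀ i x, ‖V i x‖ = ‖x‖) :
    IsClosed (asympGraph V : Set ((K →L[ℂ] K) × (H →L[ℂ] H))) :=
  (isClosed_asympSet hV).inter ((isClosed_asympSet hV).preimage continuous_star)

end Asymptotic

/-! ### Density in the spatial tensor product -/

section Spatial

variable {H K : Type*}
  [NormedAddCommGroup H] [InnerProductSpace ℂ H] [CompleteSpace H]
  [NormedAddCommGroup K] [InnerProductSpace ℂ K] [CompleteSpace K]

lemma opTensor_mem_spatialTensor {A : StarSubalgebra ℂ (H →L[ℂ] H)}
    {B : StarSubalgebra ℂ (K →L[ℂ] K)} {a : H →L[ℂ] H} {b : K →L[ℂ] K} (ha : a ∈ A) (hb : b ∈ B) :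
    opTensor a b ∈ spatialTensor A B :=
  (tmulSpatial (⟨a, ha⟩ : A) (⟨b, hb⟩ : B)).2

lemma spatialTensor_le {A : StarSubalgebra ℂ (H →L[ℂ] H)} {B : StarSubalgebra ℂ (K →L[ℂ] K)}
    {C : StarSubalgebra ℂ (HilbertTensor H K →L[ℂ] HilbertTensor H K)}
    (hC : IsClosed (C : Set (HilbertTensor H K →L[ℂ] HilbertTensor H K)))
    (h : ∀ a ∈ A, ∀ b ∈ B, opTensor a b ∈ C) : spatialTensor A B ≤ C := by
  refine closure_adjoin_le hC ?_
  rintro _ ⟨a, ha, b, hb, rfl⟩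
  exact h a ha b hb

lemma isClosed_spatialTensor (A : StarSubalgebra ℂ (H →L[ℂ] H))
    (B : StarSubalgebra ℂ (K →L[ℂ] K)) :
    IsClosed (spatialTensor A B : Set (HilbertTensor H K →L[ℂ] HilbertTensor H K)) :=
  StarSubalgebra.isClosed_topologicalClosure _

/-- A subspace of the spatial tensor product whose closure contains the elementary tensors is
dense. -/
lemma dense_of_tmulSpatial_mem {A : StarSubalgebra ℂ (H →L[ℂ] H)}
    {B : StarSubalgebra ℂ (K →L[ℂ] K)} (P : Submodule ℂ (spatialTensor A B))
    (h : ∀ (a : A) (b : B), tmulSpatial a b ∈ closure (P : Set (spatialTensor A B))) :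
    Dense (P : Set (spatialTensor A B)) := by
  set s := {T : HilbertTensor H K →L[ℂ] HilbertTensor H K | ∃ a ∈ A, ∃ b ∈ B, T = opTensor a b}
    with hs
  have hstar : star s ⊆ s := by
    rintro T ⟨a, ha, b, hb, hT⟩
    exact ⟨star a, star_mem ha, star b, star_mem hb, by rw [← star_opTensor, ← hT, star_star]⟩
  -- Elementary tensors are stable under products and adjoints, so the *-algebra they generate is
  -- just their linear span.
  have hmon : (Submonoid.closure (s ∪ star s) : Set _) ⊆ s := by
    rw [Set.union_eq_self_of_subset_right hstar]
    intro T hT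
    induction hT using Submonoid.closure_induction with
    | mem T hT => exact hT
    | one => exact ⟨1, one_mem A, 1, one_mem B, opTensor_one.symm⟩
    | mul T T' _ _ h h' =>
      obtain ⟨a, ha, b, hb, rfl⟩ := h
      obtain ⟨a', ha', b', hb', rfl⟩ := h'
      exact ⟨a * a', mul_mem ha ha', b * b', mul_mem hb hb', (opTensor_mul _ _ _ _).symm⟩
  set N := (P.map (spatialTensor A B).subtype.toAlgHom.toLinearMap).topologicalClosure with hN
  have hsN : s ⊆ (N : Set (HilbertTensor H K →L[ℂ] HilbertTensor H K)) := by
    rintro T ⟨a, ha, b, hb, rfl⟩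
    have := closure_subtype.mp (h ⟨a, ha⟩ ⟨b, hb⟩)
    exact this
  have hspan : (StarAlgebra.adjoin ℂ s : Set (HilbertTensor H K →L[ℂ] HilbertTensor H K)) ⊆ (N : Set (HilbertTensor H K →L[ℂ] HilbertTensor H K)) := by
    intro T hT
    have hT' : T ∈ Submodule.span ℂ (Submonoid.closure (s ∪ star s) : Set _) := by
      rw [← StarAlgebra.adjoin_eq_span]
      exact hT
    exact Submodule.span_le.mpr (hmon.trans hsN) hT'
  intro x
  refine closure_subtype.mpr ?_
  have hx : (x : HilbertTensor H K →L[ℂ] HilbertTensor H K) ∈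
    closure (StarAlgebra.adjoin ℂ s : Set (HilbertTensor H K →L[ℂ] HilbertTensor H K)) := x.2
  exact closure_minimal hspan (Submodule.isClosed_topologicalClosure _) hx

end Spatial

/-! ### Deformed multiplication operators and their commutation relations -/

section Operators

open Filter Topology

/-! ### The action of the torus -/

lemma torusElt_add (x y x' y' : ℝ) :
    torusElt (x + x') (y + y') = torusElt x y * torusElt x' y' := by
  apply Subtype.ext
  change Matrix.diagonal _ = Matrix.diagonal _ * Matrix.diagonal _
  rw [Matrix.diagonal_mul_diagonal]
  congr 1
  funext i
  fin_cases i <;> simp [← Complex.exp_add] <;> ring_nf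

lemma torusElt_zero : torusElt 0 0 = 1 := by
  have h := torusElt_add 0 0 0 0
  simp only [add_zero] at h
  exact (left_eq_mul.mp h)

lemma conj_assoc {G : Type*} [Group G] (a b c d g : G) :
    a * b * g * (c * d) = a * (b * g * c) * d := by
  simp only [mul_assoc]

lemma act_add (v w : Fin 4 → ℝ) (g : SU3) : act (v + w) g = act v (act w g) := by
  -- Commutativity of the torus supplies the order in which the factors appear when two actions are
  -- composed.
  have h : ∀ x y x' y' : ℝ, torusElt (x + x') (y + y') = torusElt x' y' * torusElt x y :=
    fun x y x' y' => by rw [add_comm x, add_comm y, torusElt_add]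
  have e1 : act (v + w) g = (torusElt (v 0 + w 0) (v 1 + w 1))⁻¹ * g *
      torusElt (v 2 + w 2) (v 3 + w 3) := rfl
  have e2 : act v (act w g) = (torusElt (v 0) (v 1))⁻¹ *
      ((torusElt (w 0) (w 1))⁻¹ * g * torusElt (w 2) (w 3)) * torusElt (v 2) (v 3) := rfl
  rw [e1, e2, h, h]
  generalize torusElt (v 0) (v 1) = a
  generalize torusElt (v 2) (v 3) = b
  generalize torusElt (w 0) (w 1) = c
  generalize torusElt (w 2) (w 3) = d
  rw [mul_inv_rev]
  exact conj_assoc _ _ _ _ _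

lemma act_zero (g : SU3) : act 0 g = g := by
  simp [act, torusElt_zero]

lemma continuous_act (v : Fin 4 → ℝ) : Continuous (act v) := by
  exact (continuous_const_mul _).mul continuous_const

/-- The character `v ↦ e^{2πi n·v}`. -/
def char (n : Fin 4 → ℤ) (v : Fin 4 → ℝ) : ℂ :=
  Complex.exp (2 * Real.pi * Complex.I * ∑ k, (n k : ℂ) * (v k : ℂ))

lemma mem_isotypic {n : Fin 4 → ℤ} {f : C(SU3, ℂ)} :
    f ∈ isotypic n ↔ ∀ v g, f (act v g) = char n v * f g := Iff.rfl

lemma char_add_left (n m : Fin 4 → ℤ) (v : Fin 4 → ℝ) :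
    char (n + m) v = char n v * char m v := by
  rw [char, char, char, ← Complex.exp_add, ← mul_add, ← Finset.sum_add_distrib]
  simp [add_mul]

lemma char_add_right (n : Fin 4 → ℤ) (v w : Fin 4 → ℝ) :
    char n (v + w) = char n v * char n w := by
  rw [char, char, char, ← Complex.exp_add, ← mul_add, ← Finset.sum_add_distrib]
  simp [mul_add]

@[simp] lemma char_zero_left (v : Fin 4 → ℝ) : char 0 v = 1 := by simp [char]

lemma conj_char (n : Fin 4 → ℤ) (v : Fin 4 → ℝ) : star (char n v) = char (-n) v := by
  have h2 : (starRingEnd ℂ) 2 = 2 := map_ofNat _ 2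
  rw [char, char, Complex.star_def, ← Complex.exp_conj]
  simp [h2]

lemma norm_char (n : Fin 4 → ℤ) (v : Fin 4 → ℝ) : ‖char n v‖ = 1 := by
  have : char n v = Complex.exp (((2 * Real.pi * ∑ k, (n k : ℝ) * v k : ℝ) : ℂ) * Complex.I) := by
    rw [char]
    congr 1
    push_cast
    ring
  rw [this, Complex.norm_exp_ofReal_mul_I]

lemma mul_mem_isotypic {n m : Fin 4 → ℤ} {f g : C(SU3, ℂ)} (hf : f ∈ isotypic n)
    (hg : g ∈ isotypic m) : f * g ∈ isotypic (n + m) := by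
  intro v x
  have h1 := mem_isotypic.mp hf v x
  have h2 := mem_isotypic.mp hg v x
  change (f * g) (act v x) = char (n + m) v * _
  rw [ContinuousMap.mul_apply, ContinuousMap.mul_apply, h1, h2, char_add_left]
  ring

lemma star_mem_isotypic {n : Fin 4 → ℤ} {f : C(SU3, ℂ)} (hf : f ∈ isotypic n) :
    star f ∈ isotypic (-n) := by
  intro v x
  have h1 := mem_isotypic.mp hf v x
  change star f (act v x) = char (-n) v * star f x
  rw [ContinuousMap.star_apply, ContinuousMap.star_apply, h1, star_mul, conj_char]
  ring

lemma one_mem_isotypic : (1 : C(SU3, ℂ)) ∈ isotypic 0 := by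
  intro v x
  simp

/-! ### Vectors and operators given by continuous functions -/

/-- A continuous function as a vector of `L²(SU(3))`. -/
def vec : C(SU3, ℂ) →L[ℂ] L2SU3 := ContinuousMap.toLp 2 haar ℂ

lemma coeFn_vec (f : C(SU3, ℂ)) : vec f =ᵐ[haar] f := ContinuousMap.coeFn_toLp haar f

lemma denseRange_vec : DenseRange vec := by
  exact ContinuousMap.toLp_denseRange ℂ haar ℂ (by simp)

lemma ext_vec {F : Type*} [NormedAddCommGroup F] [NormedSpace ℂ F] {S T : L2SU3 →L[ℂ] F}
    (h : ∀ f, S (vec f) = T (vec f)) : S = T := by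
  have := denseRange_vec.equalizer S.continuous T.continuous (funext h)
  exact DFunLike.coe_injective this

lemma ext_inner_vec {ξ η : L2SU3} (h : ∀ f, inner ℂ ξ (vec f) = inner ℂ η (vec f)) : ξ = η := by
  have := denseRange_vec.equalizer (innerSL ℂ ξ).continuous (innerSL ℂ η).continuous (funext h)
  exact innerSL_inj.mp (DFunLike.coe_injective this)

lemma vec_injective : Function.Injective vec := ContinuousMap.toLp_injective haar

lemma inner_vec (f g : C(SU3, ℂ)) : inner ℂ (vec f) (vec g) = ∫ x, star (f x) * g x ∂haar := by
  rw [vec, ContinuousMap.inner_toLp]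
  simp [mul_comm]

lemma mulOp_vec (f g : C(SU3, ℂ)) : mulOp f (vec g) = vec (f * g) := by
  apply Lp.ext
  have h1 := ContinuousLinearMap.coeFn_holder (μ := haar) (ContinuousLinearMap.mul ℂ ℂ)
    (r := 2) (ContinuousMap.toLp ⊤ haar ℂ f) (vec g)
  have h2 : ContinuousMap.toLp ⊤ haar ℂ f =ᵐ[haar] f := ContinuousMap.coeFn_toLp haar f
  refine h1.trans ?_
  filter_upwards [h2, coeFn_vec g, coeFn_vec (f * g)] with x h2 h3 h4
  rw [h4, h2, h3]
  rfl

lemma coeFn_mulOp (f : C(SU3, ℂ)) (ξ : L2SU3) : mulOp f ξ =ᵐ[haar] fun x => f x * ξ x := by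
  have h1 := ContinuousLinearMap.coeFn_holder (μ := haar) (ContinuousLinearMap.mul ℂ ℂ)
    (r := 2) (ContinuousMap.toLp ⊤ haar ℂ f) ξ
  have h2 : ContinuousMap.toLp ⊤ haar ℂ f =ᵐ[haar] f := ContinuousMap.coeFn_toLp haar f
  refine h1.trans ?_
  filter_upwards [h2] with x h2
  rw [h2]
  rfl

lemma coeFn_translation (v : Fin 4 → ℝ) (ξ : L2SU3) : translation v ξ =ᵐ[haar] ξ ∘ act v :=
  Lp.coeFn_compMeasurePreserving ξ (measurePreserving_act v)

lemma translation_vec (v : Fin 4 → ℝ) (f : C(SU3, ℂ)) :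
    translation v (vec f) = vec (f.comp ⟨act v, continuous_act v⟩) := by
  apply Lp.ext
  refine (coeFn_translation v _).trans ?_
  filter_upwards [(measurePreserving_act v).quasiMeasurePreserving.ae_eq_comp (coeFn_vec f),
    coeFn_vec (f.comp ⟨act v, continuous_act v⟩)] with x h1 h2
  rw [h1, h2]
  rfl

lemma mulOp_add (f g : C(SU3, ℂ)) : mulOp (f + g) = mulOp f + mulOp g :=
  ext_vec fun h => by simp [mulOp_vec, add_mul]

lemma mulOp_smul (c : ℂ) (f : C(SU3, ℂ)) : mulOp (c • f) = c • mulOp f :=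
  ext_vec fun h => by simp [mulOp_vec]

lemma norm_mulOp_apply_le (f : C(SU3, ℂ)) (ξ : L2SU3) {c : ℝ}
    (h : ∀ᵐ x ∂haar, ‖f x * ξ x‖ ≤ c * ‖ξ x‖) : ‖mulOp f ξ‖ ≤ c * ‖ξ‖ := by
  refine Lp.norm_le_mul_norm_of_ae_le_mul ?_
  filter_upwards [coeFn_mulOp f ξ, h] with x h1 h2
  rw [h1]
  exact h2

lemma norm_mulOp_le (f : C(SU3, ℂ)) : ‖mulOp f‖ ≤ ‖f‖ := by
  refine ContinuousLinearMap.opNorm_le_bound _ (norm_nonneg _) fun ξ => ?_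
  refine norm_mulOp_apply_le f ξ (Eventually.of_forall fun x => ?_)
  rw [norm_mul]
  exact mul_le_mul_of_nonneg_right (f.norm_coe_le_norm x) (norm_nonneg _)

/-! ### The deformed multiplication operators -/

/-- The shift `-½ J n`. -/
def shift (θ : ℝ) (n : Fin 4 → ℤ) : Fin 4 → ℝ :=
  -(1 / 2 : ℝ) • (J θ).mulVec (fun k => (n k : ℝ))

lemma shift_eq (θ : ℝ) (n : Fin 4 → ℤ) : shift θ n =
    ![θ / 2 * n 1, -(θ / 2) * n 0, -(θ / 2) * n 3, θ / 2 * n 2] := by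
  funext i
  fin_cases i <;>
    simp [shift, J, dotProduct, Fin.sum_univ_four] <;> ring

lemma shift_add (θ : ℝ) (n m : Fin 4 → ℤ) : shift θ (n + m) = shift θ n + shift θ m := by
  rw [shift_eq, shift_eq, shift_eq]
  funext i
  fin_cases i <;> simp <;> ring

@[simp] lemma shift_zero (θ : ℝ) : shift θ 0 = 0 := by
  rw [shift_eq]
  funext i
  fin_cases i <;> simp

lemma shift_neg (θ : ℝ) (n : Fin 4 → ℤ) : shift θ (-n) = -shift θ n := by
  rw [shift_eq, shift_eq]
  funext i
  fin_cases i <;> simp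

lemma chi_eq (θ : ℝ) (n m : Fin 4 → ℤ) : chi θ n m = Complex.exp (Real.pi * Complex.I * θ *
    ((-n 0 * m 1 + n 1 * m 0 + n 2 * m 3 - n 3 * m 2 : ℤ) : ℂ)) := by
  rw [chi, mul_assoc _ (θ : ℂ)]
  congr 2
  simp [J, Matrix.mulVec, dotProduct, Fin.sum_univ_four]
  ring

/-- Skew-symmetry turns m·(-½Jn) into ½ n·Jm: translating a function of degree m by the shift of n
multiplies it by χ(n,m). -/
lemma char_shift (θ : ℝ) (n m : Fin 4 → ℤ) : char m (shift θ n) = chi θ n m := by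
  rw [chi_eq, char, shift_eq]
  congr 1
  simp [Fin.sum_univ_four]
  ring

lemma quantize_vec (θ : ℝ) (n : Fin 4 → ℤ) (f g : C(SU3, ℂ)) :
    quantize θ n f (vec g) = vec (f * g.comp ⟨act (shift θ n), continuous_act _⟩) := by
  change mulOp f (translation (shift θ n) (vec g)) = _
  rw [translation_vec, mulOp_vec]

/-- Moving the translation of the first operator past `g` costs χ(n,m); the two translations then
merge because the shift is additive in the degree. -/
lemma quantize_mul (θ : ℝ) {n m : Fin 4 → ℤ} (f : C(SU3, ℂ)) {g : C(SU3, ℂ)}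
    (hg : g ∈ isotypic m) :
    quantize θ n f * quantize θ m g = chi θ n m • quantize θ (n + m) (f * g) := by
  refine ext_vec fun h => ?_
  rw [mul_apply_eq_comp, _root_.smul_apply, quantize_vec, quantize_vec,
    quantize_vec, ← map_smul]
  congr 1
  ext x
  have h1 := mem_isotypic.mp hg (shift θ n) x
  simp only [ContinuousMap.mul_apply, ContinuousMap.comp_apply, ContinuousMap.smul_apply,
    ContinuousMap.coe_mk, h1, shift_add, smul_eq_mul, char_shift]
  rw [add_comm (shift θ n), act_add]
  ring

/-- By skew-symmetry n·Jn = 0, so a function of degree n is invariant under its own shift, and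
multiplication by it commutes with that translation. -/
lemma char_shift_self (θ : ℝ) (n : Fin 4 → ℤ) : char n (shift θ n) = 1 := by
  rw [char_shift, chi_eq, show (-n 0 * n 1 + n 1 * n 0 + n 2 * n 3 - n 3 * n 2 : ℤ) = 0 by ring]
  simp

lemma integral_comp_act (v : Fin 4 → ℝ) (f : C(SU3, ℂ)) :
    ∫ x, f (act v x) ∂haar = ∫ x, f x ∂haar := by
  conv_rhs => rw [← (measurePreserving_act v).map_eq]
  rw [integral_map (measurePreserving_act v).measurable.aemeasurable
    f.continuous.aestronglyMeasurable]

/-- Substitute x ↦ `act (shift θ n) x` in the integral: Haar measure is invariant, `f` is unaffected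
by its own shift, and the translation passes to the other vector with opposite sign. -/
lemma star_quantize (θ : ℝ) {n : Fin 4 → ℤ} {f : C(SU3, ℂ)} (hf : f ∈ isotypic n) :
    star (quantize θ n f) = quantize θ (-n) (star f) := by
  rw [ContinuousLinearMap.star_eq_adjoint]
  refine ext_vec fun g => ?_
  refine ext_inner_vec fun h => ?_
  rw [ContinuousLinearMap.adjoint_inner_left, quantize_vec, quantize_vec, inner_vec, inner_vec]
  let F : C(SU3, ℂ) := star (star f * g.comp ⟨act (shift θ (-n)), continuous_act _⟩) * h
  have h1 := integral_comp_act (shift θ n) F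
  refine Eq.trans (integral_congr_ae (Eventually.of_forall fun x => ?_)) h1
  have h2 := mem_isotypic.mp hf (shift θ n) x
  rw [char_shift_self, one_mul] at h2
  have h3 : act (-shift θ n) (act (shift θ n) x) = x := by
    rw [← act_add, neg_add_cancel, act_zero]
  simp only [F, ContinuousMap.mul_apply, ContinuousMap.comp_apply, ContinuousMap.star_apply,
    ContinuousMap.coe_mk, shift_neg, h2, h3, star_mul, star_star]
  ring

lemma quantize_add (θ : ℝ) (n : Fin 4 → ℤ) (f g : C(SU3, ℂ)) :
    quantize θ n (f + g) = quantize θ n f + quantize θ n g := by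
  rw [quantize, mulOp_add, ContinuousLinearMap.add_comp]; rfl

lemma quantize_smul (θ : ℝ) (n : Fin 4 → ℤ) (c : ℂ) (f : C(SU3, ℂ)) :
    quantize θ n (c • f) = c • quantize θ n f := by
  rw [quantize, mulOp_smul, ContinuousLinearMap.smul_comp]; rfl

lemma quantize_zero_one (θ : ℝ) : quantize θ 0 1 = 1 :=
  ext_vec fun g => by
    rw [quantize_vec, one_mul, one_apply_eq_self]
    congr 1
    ext x
    simp [act_zero]

/-- The constant function is fixed by every translation, so it recovers the symbol from the
operator. This drives both injectivity and the definition of the multiplicative unitary. -/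
lemma quantize_vec_one (θ : ℝ) (n : Fin 4 → ℤ) (f : C(SU3, ℂ)) :
    quantize θ n f (vec 1) = vec f := by
  rw [quantize_vec]
  congr 1
  ext x
  simp

lemma norm_quantize_le (θ : ℝ) (n : Fin 4 → ℤ) (f : C(SU3, ℂ)) : ‖quantize θ n f‖ ≤ ‖f‖ := by
  refine (ContinuousLinearMap.opNorm_comp_le _ _).trans ?_
  have h1 : ‖translation (shift θ n)‖ ≤ 1 := LinearIsometry.norm_toContinuousLinearMap_le _
  calc ‖mulOp f‖ * ‖translation (shift θ n)‖ ≤ ‖f‖ * 1 :=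
        mul_le_mul (norm_mulOp_le f) h1 (norm_nonneg _) (norm_nonneg _)
    _ = ‖f‖ := mul_one _

lemma chi_ne_zero (θ : ℝ) (n m : Fin 4 → ℤ) : chi θ n m ≠ 0 := Complex.exp_ne_zero _

lemma chi_swap (θ : ℝ) (n m : Fin 4 → ℤ) : chi θ n m * chi θ m n = 1 := by
  rw [chi_eq, chi_eq, ← Complex.exp_add, ← mul_add, ← Int.cast_add,
    show (-n 0 * m 1 + n 1 * m 0 + n 2 * m 3 - n 3 * m 2 +
      (-m 0 * n 1 + m 1 * n 0 + m 2 * n 3 - m 3 * n 2) : ℤ) = 0 by ring]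
  simp

/-- The commutation relations between functions in isotypic components. -/
lemma quantize_comm (θ : ℝ) {n m : Fin 4 → ℤ} {f g : C(SU3, ℂ)} (hf : f ∈ isotypic n)
    (hg : g ∈ isotypic m) {c : ℂ} (hc : c = chi θ n m * chi θ n m) :
    quantize θ n f * quantize θ m g = c • (quantize θ m g * quantize θ n f) := by
  rw [quantize_mul θ f hg, quantize_mul θ g hf, smul_smul, hc, mul_assoc, chi_swap, mul_one,
    add_comm n m, mul_comm f g]

lemma u_comm (θ : ℝ) (i j k l : Fin 3) {c : ℂ}
    (hc : c = chi θ (deg i j) (deg k l) * chi θ (deg i j) (deg k l)) :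
    u θ i j * u θ k l = c • (u θ k l * u θ i j) :=
  Subtype.ext (quantize_comm θ (coord_mem i j) (coord_mem k l) hc)

/-- The commutation phase is the square of χ, so the integer pairing `z` of two degrees gives
e^{2πiθz}: the values 0, 1, 2 give 1, `q` and `q₂`. -/
lemma chi_sq (θ : ℝ) (n m : Fin 4 → ℤ) {z : ℤ}
    (hz : -n 0 * m 1 + n 1 * m 0 + n 2 * m 3 - n 3 * m 2 = z) :
    chi θ n m * chi θ n m = Complex.exp (2 * Real.pi * Complex.I * θ * z) := by
  rw [chi_eq, hz, ← Complex.exp_add]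
  congr 1
  ring

lemma u_comm_zero (θ : ℝ) (i j k l : Fin 3)
    (h : -deg i j 0 * deg k l 1 + deg i j 1 * deg k l 0 + deg i j 2 * deg k l 3 -
      deg i j 3 * deg k l 2 = 0) : u θ i j * u θ k l = u θ k l * u θ i j := by
  rw [u_comm θ i j k l (c := 1) (by rw [chi_sq θ _ _ h]; simp), one_smul]

lemma u_comm_one (θ : ℝ) (i j k l : Fin 3)
    (h : -deg i j 0 * deg k l 1 + deg i j 1 * deg k l 0 + deg i j 2 * deg k l 3 -
      deg i j 3 * deg k l 2 = 1) : u θ i j * u θ k l = q θ • (u θ k l * u θ i j) :=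
  u_comm θ i j k l (by rw [chi_sq θ _ _ h, q]; simp)

lemma u_comm_two (θ : ℝ) (i j k l : Fin 3)
    (h : -deg i j 0 * deg k l 1 + deg i j 1 * deg k l 0 + deg i j 2 * deg k l 3 -
      deg i j 3 * deg k l 2 = 2) : u θ i j * u θ k l = q₂ θ • (u θ k l * u θ i j) :=
  u_comm θ i j k l (by rw [chi_sq θ _ _ h, q₂]; congr 1; push_cast; ring)

end Operators

/-! ### Fourier analysis on the four-dimensional torus -/

section Fourier

open Filter Topology UnitAddTorus

/-- The normalized Haar measure of the torus `(ℝ/ℤ)⁴`. -/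
def torusHaar : Measure (UnitAddTorus (Fin 4)) :=
  Measure.pi fun _ => (AddCircle.haarAddCircle : Measure UnitAddCircle)

instance : IsProbabilityMeasure torusHaar := by unfold torusHaar; infer_instance

instance : torusHaar.IsAddRightInvariant := by unfold torusHaar; infer_instance

lemma mFourier_coe (k : Fin 4 → ℤ) (v : Fin 4 → ℝ) :
    mFourier k (fun i => (v i : UnitAddCircle)) = char k v := by
  simp only [mFourier, ContinuousMap.coe_mk, fourier_coe_apply, char, ← Complex.exp_sum,
    Finset.mul_sum]
  congr 1
  refine Finset.sum_congr rfl fun i _ => ?_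
  simp
  ring

lemma exists_coe_eq (t : UnitAddTorus (Fin 4)) :
    ∃ v : Fin 4 → ℝ, t = fun i => (v i : UnitAddCircle) := by
  choose v hv using fun i => QuotientAddGroup.mk_surjective (t i)
  exact ⟨v, funext fun i => (hv i).symm⟩

lemma integral_mFourier (k : Fin 4 → ℤ) :
    ∫ t, mFourier k t ∂torusHaar = if k = 0 then 1 else 0 := by
  split_ifs with hk
  · simp [hk, mFourier_zero]
  · obtain ⟨j, hj⟩ := Function.ne_iff.mp hk
    simp only [Pi.zero_apply] at hj
    -- Half a period in a direction where the character is nontrivial: the character changes sign,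
    -- and invariance of the measure makes the integral equal to its own negative.
    let v : Fin 4 → ℝ := Pi.single j (1 / (2 * k j))
    have hv : mFourier k (fun i => (v i : UnitAddCircle)) = -1 := by
      rw [mFourier_coe, char, Finset.sum_eq_single j (fun i _ hi => by simp [v, hi])
        (fun h => absurd (Finset.mem_univ j) h)]
      have hj' : (k j : ℂ) ≠ 0 := by exact_mod_cast hj
      rw [← Complex.exp_pi_mul_I]
      congr 1
      simp [v]
      field_simp
    have h1 := integral_add_right_eq_self (μ := torusHaar) (fun t => mFourier k t)
      (fun i => (v i : UnitAddCircle))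
    have h2 : ∀ t : UnitAddTorus (Fin 4), mFourier k (t + fun i => (v i : UnitAddCircle)) =
        -mFourier k t := by
      intro t
      obtain ⟨w, rfl⟩ := exists_coe_eq t
      rw [mFourier_coe] at hv ⊢
      have h3 := mFourier_coe k (w + v)
      rw [char_add_right, hv, mul_neg_one] at h3
      exact h3
    simp only [h2, integral_neg] at h1
    exact CharZero.eq_neg_self_iff.mp h1.symm

/-- The exponents `d i` may repeat, so the Fourier coefficient at `n` is a sum over a whole fibre of
`d`. -/
lemma integral_sum_mFourier {ι : Type*} (s : Finset ι) (d : ι → Fin 4 → ℤ) (c : ι → ℂ)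
    (n : Fin 4 → ℤ) :
    ∫ t, ∑ i ∈ s, c i * mFourier (d i - n) t ∂torusHaar = ∑ i ∈ s with d i = n, c i := by
  rw [integral_finsetSum]
  · simp only [integral_const_mul, integral_mFourier, sub_eq_zero, Finset.sum_filter, mul_ite,
      mul_one, mul_zero]
  · intro i _
    refine Integrable.const_mul ?_ _
    exact (ContinuousMap.continuous _).integrable_of_hasCompactSupport
      (HasCompactSupport.of_compactSpace _)

/-- A Fourier coefficient of a trigonometric polynomial is bounded by its supremum. -/
lemma norm_coeff_le {ι : Type*} (s : Finset ι) (d : ι → Fin 4 → ℤ) (c : ι → ℂ) {M : ℝ}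
    (h : ∀ v, ‖∑ i ∈ s, c i * char (d i) v‖ ≤ M) (n : Fin 4 → ℤ) :
    ‖∑ i ∈ s with d i = n, c i‖ ≤ M := by
  rw [← integral_sum_mFourier]
  refine (norm_integral_le_of_norm_le_const (C := M) (Eventually.of_forall fun t => ?_)).trans ?_
  · obtain ⟨v, rfl⟩ := exists_coe_eq t
    have h1 : ∑ i ∈ s, c i * mFourier (d i - n) (fun i => (v i : UnitAddCircle)) =
        (∑ i ∈ s, c i * char (d i) v) * char (-n) v := by
      rw [Finset.sum_mul]
      refine Finset.sum_congr rfl fun i _ => ?_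
      rw [mFourier_coe, sub_eq_add_neg, char_add_left, mul_assoc]
    rw [h1, norm_mul, norm_char, mul_one]
    exact h v
  · simp

/-- Linear independence of characters. -/
lemma coeff_eq {ι : Type*} (s : Finset ι) (d : ι → Fin 4 → ℤ) (c : ι → ℂ) {n : Fin 4 → ℤ} {C : ℂ}
    (h : ∀ v, ∑ i ∈ s, c i * char (d i) v = C * char n v) : ∑ i ∈ s with d i = n, c i = C := by
  rw [← integral_sum_mFourier]
  have h1 : ∀ t : UnitAddTorus (Fin 4), ∑ i ∈ s, c i * mFourier (d i - n) t = C := by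
    intro t
    obtain ⟨v, rfl⟩ := exists_coe_eq t
    have h1 : ∑ i ∈ s, c i * mFourier (d i - n) (fun i => (v i : UnitAddCircle)) =
        (∑ i ∈ s, c i * char (d i) v) * char (-n) v := by
      rw [Finset.sum_mul]
      refine Finset.sum_congr rfl fun i _ => ?_
      rw [mFourier_coe, sub_eq_add_neg, char_add_left, mul_assoc]
    rw [h1, h, mul_assoc, ← char_add_left, add_neg_cancel, char_zero_left, mul_one]
  simp [h1]

/-- The projections onto isotypic components are contractive. -/
lemma norm_isotypic_le (s : Finset (Fin 4 → ℤ)) (f : (Fin 4 → ℤ) → C(SU3, ℂ))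
    (hf : ∀ n, f n ∈ isotypic n) {n : Fin 4 → ℤ} (hn : n ∈ s) : ‖f n‖ ≤ ‖∑ m ∈ s, f m‖ := by
  refine (ContinuousMap.norm_le _ (norm_nonneg _)).mpr fun x => ?_
  -- At a fixed point x, the value of the sum along the orbit of x is a trigonometric polynomial in
  -- v with coefficients `f m x`.
  have h1 := norm_coeff_le s id (fun m => f m x) (M := ‖∑ m ∈ s, f m‖) (fun v => ?_) n
  · simpa [Finset.sum_filter, hn] using h1
  · refine le_trans (le_of_eq ?_) ((∑ m ∈ s, f m).norm_coe_le_norm (act v x))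
    rw [ContinuousMap.sum_apply]
    congr 1
    refine Finset.sum_congr rfl fun m _ => ?_
    rw [mem_isotypic.mp (hf m) v x, mul_comm]
    rfl

/-- Applied to the constant function 1 the relation becomes ∑ f_n = 0 in L², hence as continuous
functions; contractivity of the isotypic projections then kills each component. -/
lemma elt_sum_eq_zero (θ : ℝ) (s : Finset (Fin 4 → ℤ)) (f : ∀ n, isotypic n)
    (h : ∑ n ∈ s, elt θ (f n) = 0) : ∀ n ∈ s, f n = 0 := by
  intro n hn
  have h1 : ∑ n ∈ s, quantize θ n (f n) = 0 := by
    have := congrArg (CSU3 θ).subtype h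
    rwa [map_sum, map_zero] at this
  have h2 : vec (∑ n ∈ s, (f n : C(SU3, ℂ))) = 0 := by
    rw [map_sum]
    have := congrArg (fun T : L2SU3 →L[ℂ] L2SU3 => T (vec 1)) h1
    simpa [_root_.sum_apply, quantize_vec_one] using this
  have h3 := vec_injective (h2.trans (map_zero vec).symm)
  have h4 := norm_isotypic_le s (fun n => (f n : C(SU3, ℂ))) (fun n => (f n).2) hn
  rw [h3, norm_zero] at h4
  exact Subtype.ext (norm_le_zero_iff.mp h4)

end Fourier

/-! ### Graded subalgebras and generation by the coordinate functions -/

section Density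

open Filter Topology

/-- A graded *-subalgebra of `C(SU(3))` which contains the coordinate functions. -/
structure IsGradedAlgebra (Q : (Fin 4 → ℤ) → Submodule ℂ C(SU3, ℂ)) : Prop where
  le_isotypic : ∀ n, Q n ≤ isotypic n
  one_mem : 1 ∈ Q 0
  mul_mem : ∀ {n m f g}, f ∈ Q n → g ∈ Q m → f * g ∈ Q (n + m)
  star_mem : ∀ {n f}, f ∈ Q n → star f ∈ Q (-n)
  coord_mem : ∀ i j, coord i j ∈ Q (deg i j)

namespace IsGradedAlgebra

variable {Q : (Fin 4 → ℤ) → Submodule ℂ C(SU3, ℂ)}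

/-- The *-subalgebra of `C(SU(3))` spanned by the components of a graded algebra. -/
def total (hQ : IsGradedAlgebra Q) : StarSubalgebra ℂ C(SU3, ℂ) where
  carrier := (⨆ n, Q n : Submodule ℂ C(SU3, ℂ))
  add_mem' := add_mem
  algebraMap_mem' c := by
    rw [Algebra.algebraMap_eq_smul_one]
    exact Submodule.smul_mem _ _ (Submodule.mem_iSup_of_mem 0 hQ.one_mem)
  mul_mem' {f g} hf hg := by
    have h : (⨆ n, Q n) * (⨆ n, Q n) ≤ ⨆ n, Q n := by
      simp only [Submodule.iSup_mul, Submodule.mul_iSup, iSup_le_iff]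
      intro n m
      rw [Submodule.mul_le]
      exact fun f hf g hg => Submodule.mem_iSup_of_mem _ (hQ.mul_mem hf hg)
    exact h (Submodule.mul_mem_mul hf hg)
  star_mem' {f} hf := by
    refine Submodule.iSup_induction Q (motive := fun f => star f ∈ (⨆ n, Q n : Submodule ℂ _)) hf
      (fun n f hf => Submodule.mem_iSup_of_mem _ (hQ.star_mem hf)) ?_ fun f g hf hg => ?_
    · rw [star_zero]; exact zero_mem _
    · rw [star_add]; exact add_mem hf hg

lemma mem_total (hQ : IsGradedAlgebra Q) {f : C(SU3, ℂ)} :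
    f ∈ hQ.total ↔ f ∈ (⨆ n, Q n : Submodule ℂ C(SU3, ℂ)) := Iff.rfl

/-- Stone–Weierstrass: the matrix entries separate the points of the group. -/
lemma dense_total (hQ : IsGradedAlgebra Q) : Dense (hQ.total : Set C(SU3, ℂ)) := by
  have h : hQ.total.topologicalClosure = ⊤ := by
    refine ContinuousMap.starSubalgebra_topologicalClosure_eq_top_of_separatesPoints _ ?_
    intro x y hxy
    have h1 : (x : Matrix (Fin 3) (Fin 3) ℂ) ≠ y := fun h => hxy (Subtype.ext h)
    have h2 : ∃ i j, (x : Matrix (Fin 3) (Fin 3) ℂ) i j ≠ (y : Matrix (Fin 3) (Fin 3) ℂ) i j := by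
      by_contra! h
      exact h1 (Matrix.ext h)
    obtain ⟨i, j, hij⟩ := h2
    exact ⟨_, ⟨coord i j, Submodule.mem_iSup_of_mem _ (hQ.coord_mem i j), rfl⟩, hij⟩
  intro f
  have : f ∈ hQ.total.topologicalClosure := h ▸ StarSubalgebra.mem_top
  exact this

/-- Approximate `f` by an element of the whole algebra and keep only its component of degree `n`;
projecting onto that degree does not increase the error. -/
lemma exists_approx (hQ : IsGradedAlgebra Q) {n : Fin 4 → ℤ} {f : C(SU3, ℂ)} (hf : f ∈ isotypic n)
    {δ : ℝ} (hδ : 0 < δ) : ∃ g ∈ Q n, ‖f - g‖ < δ := by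
  obtain ⟨g, hg, hfg⟩ := Metric.mem_closure_iff.mp (hQ.dense_total f) δ hδ
  obtain ⟨G, hG, rfl⟩ := (Submodule.mem_iSup_iff_exists_finsupp _ _).mp (hQ.mem_total.mp hg)
  refine ⟨G n, hG n, lt_of_le_of_lt ?_ (by rwa [dist_eq_norm] at hfg)⟩
  classical
  -- The homogeneous components of f - ∑ G m. The degree `n` is inserted because `G` may have no
  -- component there.
  have h1 := norm_isotypic_le (insert n G.support) (fun m => (if m = n then f else 0) - G m)
    (fun m => ?_) (Finset.mem_insert_self n _)
  · simp only [if_true, Finset.sum_sub_distrib, Finset.sum_ite_eq', Finset.mem_insert_self] at h1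
    refine h1.trans_eq ?_
    rw [Finsupp.sum_of_support_subset G (Finset.subset_insert n _) _ (fun _ _ => rfl)]
  · refine sub_mem ?_ (hQ.le_isotypic m (hG m))
    split_ifs with h
    · exact h ▸ hf
    · exact zero_mem _

lemma dense_span_vec (hQ : IsGradedAlgebra Q) :
    Dense (Submodule.span ℂ {ξ : L2SU3 | ∃ n, ∃ f ∈ Q n, ξ = vec f} : Set L2SU3) := by
  have h1 : Dense (vec '' (hQ.total : Set C(SU3, ℂ))) :=
    denseRange_vec.dense_image vec.continuous hQ.dense_total
  refine h1.mono ?_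
  rintro _ ⟨f, hf, rfl⟩
  have h2 : (⨆ n, Q n : Submodule ℂ C(SU3, ℂ)) ≤
      (Submodule.span ℂ {ξ : L2SU3 | ∃ n, ∃ f ∈ Q n, ξ = vec f}).comap vec.toLinearMap :=
    iSup_le fun n f hf => Submodule.subset_span ⟨n, f, hf, rfl⟩
  exact h2 hf

end IsGradedAlgebra

/-- The *-algebra of operators generated by the deformed coordinate functions. -/
def coordOps (θ : ℝ) : StarSubalgebra ℂ (L2SU3 →L[ℂ] L2SU3) :=
  StarAlgebra.adjoin ℂ {T | ∃ i j, T = quantize θ (deg i j) (coord i j)}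

/-- The functions of degree `n` whose deformed multiplication operators lie in a given
*-algebra. -/
def componentsIn (θ : ℝ) (B : StarSubalgebra ℂ (L2SU3 →L[ℂ] L2SU3)) (n : Fin 4 → ℤ) :
    Submodule ℂ C(SU3, ℂ) where
  carrier := {f | f ∈ isotypic n ∧ quantize θ n f ∈ B}
  add_mem' hf hg := ⟨add_mem hf.1 hg.1, by rw [quantize_add]; exact add_mem hf.2 hg.2⟩
  zero_mem' := ⟨zero_mem _, by
    rw [← zero_smul ℂ (0 : C(SU3, ℂ)), quantize_smul, zero_smul]; exact zero_mem _⟩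
  smul_mem' c f hf := ⟨Submodule.smul_mem _ c hf.1, by
    rw [quantize_smul]; exact B.smul_mem hf.2 c⟩

/-- The phases χ(n,m) are invertible, so closure under the deformed product is closure under the
ordinary one. This carries Stone–Weierstrass for functions over to operators. -/
lemma isGradedAlgebra_componentsIn (θ : ℝ) {B : StarSubalgebra ℂ (L2SU3 →L[ℂ] L2SU3)}
    (hB : coordOps θ ≤ B) : IsGradedAlgebra (componentsIn θ B) where
  le_isotypic _ _ hf := hf.1
  one_mem := ⟨one_mem_isotypic, by rw [quantize_zero_one]; exact one_mem B⟩
  mul_mem {n m f g} hf hg := ⟨mul_mem_isotypic hf.1 hg.1, by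
    have h := B.smul_mem (mul_mem hf.2 hg.2) (chi θ n m)⁻¹
    rwa [quantize_mul θ f hg.1, smul_smul, inv_mul_cancel₀ (chi_ne_zero θ n m), one_smul] at h⟩
  star_mem hf := ⟨star_mem_isotypic hf.1, by
    rw [← star_quantize θ hf.1]; exact star_mem hf.2⟩
  coord_mem i j := ⟨coord_mem i j, hB (StarAlgebra.subset_adjoin ℂ _ ⟨i, j, rfl⟩)⟩

lemma quantize_mem_CSU3 (θ : ℝ) {n : Fin 4 → ℤ} {f : C(SU3, ℂ)} (hf : f ∈ isotypic n) :
    quantize θ n f ∈ CSU3 θ := (elt θ ⟨f, hf⟩).2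

lemma isClosed_CSU3 (θ : ℝ) : IsClosed (CSU3 θ : Set (L2SU3 →L[ℂ] L2SU3)) :=
  StarSubalgebra.isClosed_topologicalClosure _

lemma coordOps_le (θ : ℝ) : coordOps θ ≤ CSU3 θ := by
  refine StarAlgebra.adjoin_le ?_
  rintro _ ⟨i, j, rfl⟩
  exact quantize_mem_CSU3 θ (coord_mem i j)

/-- The coordinate functions generate the C*-algebra `C(SU(3)_θ)`. -/
theorem CSU3_eq (θ : ℝ) : CSU3 θ = (coordOps θ).topologicalClosure := by
  refine le_antisymm (closure_adjoin_le (StarSubalgebra.isClosed_topologicalClosure _) ?_)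
    (StarSubalgebra.topologicalClosure_minimal (coordOps_le θ) (isClosed_CSU3 θ))
  rintro _ ⟨n, f, hf, rfl⟩
  refine Metric.mem_closure_iff.mpr fun δ hδ => ?_
  -- The approximant has the same degree as `f`, so both operators carry the same translation and
  -- their distance is at most ‖f - g‖.
  obtain ⟨g, hg, hfg⟩ := (isGradedAlgebra_componentsIn θ le_rfl).exists_approx hf hδ
  refine ⟨quantize θ n g, hg.2, ?_⟩
  have h : quantize θ n f - quantize θ n g = quantize θ n (f - g) := by
    rw [sub_eq_add_neg, ← neg_one_smul ℂ, ← quantize_smul, ← quantize_add, neg_one_smul,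
      sub_eq_add_neg]
  rw [dist_eq_norm, h]
  exact (norm_quantize_le θ n _).trans_lt hfg

end Density

/-! ### The deformed fundamental matrix is unitary -/

section Coproduct

open Filter Topology

/-- `quantize` as a linear map. -/
def quantizeL (θ : ℝ) (n : Fin 4 → ℤ) : C(SU3, ℂ) →ₗ[ℂ] (L2SU3 →L[ℂ] L2SU3) where
  toFun := quantize θ n
  map_add' := quantize_add θ n
  map_smul' := quantize_smul θ n

lemma quantizeL_apply (θ : ℝ) (n : Fin 4 → ℤ) (f : C(SU3, ℂ)) :
    quantizeL θ n f = quantize θ n f := rfl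

/-! ### Unitarity of the fundamental matrix -/

lemma sum_star_coord_mul_coord (i l : Fin 3) :
    ∑ k, star (coord k l) * coord k i = if l = i then 1 else 0 := by
  ext x
  have h := (Matrix.mem_unitaryGroup_iff'.mp x.2.1)
  have h1 := congrFun (congrFun h l) i
  rw [Matrix.mul_apply, Matrix.one_apply] at h1
  rw [ContinuousMap.sum_apply]
  refine Eq.trans h1 ?_
  split_ifs <;> rfl

lemma sum_coord_mul_star_coord (i l : Fin 3) :
    ∑ k, coord l k * star (coord i k) = if l = i then 1 else 0 := by
  ext x
  have h := (Matrix.mem_unitaryGroup_iff.mp x.2.1)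
  have h1 := congrFun (congrFun h l) i
  rw [Matrix.mul_apply, Matrix.one_apply] at h1
  rw [ContinuousMap.sum_apply]
  refine Eq.trans h1 ?_
  split_ifs <;> rfl

/-- If the degrees of the factors differ by cancelling amounts, then a sum of products of deformed
multiplication operators is computed by the sum of the products of functions. -/
lemma sum_quantize_mul (θ : ℝ) (n m : Fin 3 → Fin 4 → ℤ) (f g : Fin 3 → C(SU3, ℂ))
    (hg : ∀ k, g k ∈ isotypic (m k)) (h0 : ∀ k, n k + m k = n 0 + m 0)
    (h1 : ∀ k, -n k 0 * m k 1 + n k 1 * m k 0 + n k 2 * m k 3 - n k 3 * m k 2 =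
      -n 0 0 * m 0 1 + n 0 1 * m 0 0 + n 0 2 * m 0 3 - n 0 3 * m 0 2) :
    ∑ k, quantize θ (n k) (f k) * quantize θ (m k) (g k) =
      chi θ (n 0) (m 0) • quantize θ (n 0 + m 0) (∑ k, f k * g k) := by
  rw [← quantizeL_apply, map_sum, Finset.smul_sum]
  refine Finset.sum_congr rfl fun k _ => ?_
  rw [quantize_mul θ _ (hg k), h0 k, chi_eq, h1 k, ← chi_eq, quantizeL_apply]

/-- Within one unitarity relation neither the total degree nor the phase depends on the summation
index, so a single phase factors out and the classical relation remains. The eight lemmas that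
follow this pattern cover rows and columns with the adjoint in either position. -/
lemma deg_col (k i l : Fin 3) : deg k l + -deg k i = deg 0 l + -deg 0 i := by
  revert k i l; decide

lemma deg_col_chi (k i l : Fin 3) :
    -(deg k l) 0 * (-deg k i) 1 + (deg k l) 1 * (-deg k i) 0 + (deg k l) 2 * (-deg k i) 3 -
      (deg k l) 3 * (-deg k i) 2 =
    -(deg 0 l) 0 * (-deg 0 i) 1 + (deg 0 l) 1 * (-deg 0 i) 0 + (deg 0 l) 2 * (-deg 0 i) 3 -
      (deg 0 l) 3 * (-deg 0 i) 2 := by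
  revert k i l; decide

lemma deg_row (k i l : Fin 3) : deg l k + -deg i k = deg l 0 + -deg i 0 := by
  revert k i l; decide

lemma deg_row_chi (k i l : Fin 3) :
    -(deg l k) 0 * (-deg i k) 1 + (deg l k) 1 * (-deg i k) 0 + (deg l k) 2 * (-deg i k) 3 -
      (deg l k) 3 * (-deg i k) 2 =
    -(deg l 0) 0 * (-deg i 0) 1 + (deg l 0) 1 * (-deg i 0) 0 + (deg l 0) 2 * (-deg i 0) 3 -
      (deg l 0) 3 * (-deg i 0) 2 := by
  revert k i l; decide

lemma deg_col' (k i l : Fin 3) : -deg k l + deg k i = -deg 0 l + deg 0 i := by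
  revert k i l; decide

lemma deg_col'_chi (k i l : Fin 3) :
    -(-deg k l) 0 * (deg k i) 1 + (-deg k l) 1 * (deg k i) 0 + (-deg k l) 2 * (deg k i) 3 -
      (-deg k l) 3 * (deg k i) 2 =
    -(-deg 0 l) 0 * (deg 0 i) 1 + (-deg 0 l) 1 * (deg 0 i) 0 + (-deg 0 l) 2 * (deg 0 i) 3 -
      (-deg 0 l) 3 * (deg 0 i) 2 := by
  revert k i l; decide

lemma deg_row' (k i l : Fin 3) : -deg l k + deg i k = -deg l 0 + deg i 0 := by
  revert k i l; decide

lemma deg_row'_chi (k i l : Fin 3) :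
    -(-deg l k) 0 * (deg i k) 1 + (-deg l k) 1 * (deg i k) 0 + (-deg l k) 2 * (deg i k) 3 -
      (-deg l k) 3 * (deg i k) 2 =
    -(-deg l 0) 0 * (deg i 0) 1 + (-deg l 0) 1 * (deg i 0) 0 + (-deg l 0) 2 * (deg i 0) 3 -
      (-deg l 0) 3 * (deg i 0) 2 := by
  revert k i l; decide

lemma chi_neg_right_self (θ : ℝ) (n : Fin 4 → ℤ) : chi θ n (-n) = 1 := by
  rw [chi_eq]
  simp only [Pi.neg_apply]
  rw [show (-n 0 * -n 1 + n 1 * -n 0 + n 2 * -n 3 - n 3 * -n 2 : ℤ) = 0 by ring]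
  simp

lemma chi_neg_left_self (θ : ℝ) (n : Fin 4 → ℤ) : chi θ (-n) n = 1 := by
  have h := chi_neg_right_self θ (-n)
  rwa [neg_neg] at h

/-- On the diagonal the degrees are opposite, where χ is 1 and the total degree is 0; off the
diagonal both sides vanish. -/
lemma smul_quantize_ite (θ : ℝ) (n m : Fin 4 → ℤ) (P : Prop) [Decidable P]
    (hP : P → m = -n ∨ n = -m) :
    chi θ n m • quantize θ (n + m) (if P then 1 else 0) = if P then 1 else 0 := by
  split_ifs with h
  · have h1 : chi θ n m = 1 ∧ n + m = 0 := by
      rcases hP h with h | h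
      · rw [h, chi_neg_right_self]; simp
      · rw [h, chi_neg_left_self]; simp
    rw [h1.1, h1.2, quantize_zero_one, one_smul]
  · rw [← quantizeL_apply, map_zero, smul_zero]

/-- The operator of deformed multiplication by `u_{ij}`. -/
def U (θ : ℝ) (i j : Fin 3) : L2SU3 →L[ℂ] L2SU3 := quantize θ (deg i j) (coord i j)

lemma star_U (θ : ℝ) (i j : Fin 3) : star (U θ i j) = quantize θ (-deg i j) (star (coord i j)) :=
  star_quantize θ (coord_mem i j)

/-- The deformed entries do not commute with the adjoints, so rows and columns with the adjoint on
either side are four separate relations. Columns serve to solve for 1 ⊗ u, rows for u ⊗ 1. -/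
lemma sum_U_mul_star_U_col (θ : ℝ) (i l : Fin 3) :
    ∑ k, U θ k l * star (U θ k i) = if l = i then 1 else 0 := by
  simp only [star_U]
  simp only [U]
  rw [sum_quantize_mul θ (fun k => deg k l) (fun k => -deg k i) (fun k => coord k l)
    (fun k => star (coord k i)) (fun k => star_mem_isotypic (coord_mem k i))
    (fun k => deg_col k i l) (fun k => deg_col_chi k i l)]
  have h := sum_star_coord_mul_coord l i
  simp only [mul_comm (star _)] at h
  rw [h]
  simp only [eq_comm (a := i)]
  exact smul_quantize_ite θ _ _ _ fun h => by rw [h]; simp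

lemma sum_U_mul_star_U_row (θ : ℝ) (i l : Fin 3) :
    ∑ k, U θ l k * star (U θ i k) = if l = i then 1 else 0 := by
  simp only [star_U]
  simp only [U]
  rw [sum_quantize_mul θ (fun k => deg l k) (fun k => -deg i k) (fun k => coord l k)
    (fun k => star (coord i k)) (fun k => star_mem_isotypic (coord_mem i k))
    (fun k => deg_row k i l) (fun k => deg_row_chi k i l)]
  rw [sum_coord_mul_star_coord]
  exact smul_quantize_ite θ _ _ _ fun h => by rw [h]; simp

lemma sum_star_U_mul_U_col (θ : ℝ) (i l : Fin 3) :
    ∑ k, star (U θ k l) * U θ k i = if l = i then 1 else 0 := by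
  simp only [star_U]
  simp only [U]
  rw [sum_quantize_mul θ (fun k => -deg k l) (fun k => deg k i) (fun k => star (coord k l))
    (fun k => coord k i) (fun k => coord_mem k i)
    (fun k => deg_col' k i l) (fun k => deg_col'_chi k i l)]
  rw [sum_star_coord_mul_coord]
  exact smul_quantize_ite θ _ _ _ fun h => by rw [h]; simp

lemma sum_star_U_mul_U_row (θ : ℝ) (i l : Fin 3) :
    ∑ k, star (U θ l k) * U θ i k = if l = i then 1 else 0 := by
  simp only [star_U]
  simp only [U]
  rw [sum_quantize_mul θ (fun k => -deg l k) (fun k => deg i k) (fun k => star (coord l k))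
    (fun k => coord i k) (fun k => coord_mem i k)
    (fun k => deg_row' k i l) (fun k => deg_row'_chi k i l)]
  have h := sum_coord_mul_star_coord l i
  simp only [mul_comm _ (star _)] at h
  rw [h]
  simp only [eq_comm (a := i)]
  exact smul_quantize_ite θ _ _ _ fun h => by rw [h]; simp

end Coproduct

/-! ### The coproduct on homogeneous functions -/

section CoproductRelation

open Filter Topology

/-- The degrees `p` and `r` of the two legs of a term of the coproduct of a function of degree
`n`. -/
def Matched (n p r : Fin 4 → ℤ) : Prop :=
  p 0 = n 0 ∧ p 1 = n 1 ∧ p 2 + r 0 = 0 ∧ p 3 + r 1 = 0 ∧ r 2 = n 2 ∧ r 3 = n 3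

instance (n p r : Fin 4 → ℤ) : Decidable (Matched n p r) := by unfold Matched; infer_instance

lemma Matched.add {n p r n' p' r' : Fin 4 → ℤ} (h : Matched n p r) (h' : Matched n' p' r') :
    Matched (n + n') (p + p') (r + r') := by
  unfold Matched at *
  simp only [Pi.add_apply]
  omega

lemma Matched.neg {n p r : Fin 4 → ℤ} (h : Matched n p r) : Matched (-n) (-p) (-r) := by
  unfold Matched at *
  simp only [Pi.neg_apply]
  omega

/-- The right block of p and the left block of r are negatives of each other, and likewise for p'
and r'. J has opposite signs on the two blocks, so their contributions cancel and only the outer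
blocks, those of n and n', survive. -/
lemma Matched.chi_mul_chi (θ : ℝ) {n p r n' p' r' : Fin 4 → ℤ} (h : Matched n p r)
    (h' : Matched n' p' r') : chi θ p p' * chi θ r r' = chi θ n n' := by
  obtain ⟨h1, h2, h3, h4, h5, h6⟩ := h
  obtain ⟨h1', h2', h3', h4', h5', h6'⟩ := h'
  rw [chi_eq, chi_eq, chi_eq, ← Complex.exp_add, ← mul_add, ← Int.cast_add, h1, h2, h5, h6,
    h1', h2', h5', h6', eq_neg_of_add_eq_zero_right h3, eq_neg_of_add_eq_zero_right h4,
    eq_neg_of_add_eq_zero_right h3', eq_neg_of_add_eq_zero_right h4']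
  congr 3
  ring

/-- `D = ∑ L_{a_i} ⊗ L_{b_i}` for functions `a_i`, `b_i` of compatible degrees such that
`f(xy) = ∑ a_i(x) b_i(y)`, where `f` is of degree `n`. -/
def IsCoproduct (θ : ℝ) (n : Fin 4 → ℤ) (f : C(SU3, ℂ))
    (D : HilbertTensor L2SU3 L2SU3 →L[ℂ] HilbertTensor L2SU3 L2SU3) : Prop :=
  f ∈ isotypic n ∧ ∃ (ι : Type) (_ : Fintype ι) (p r : ι → Fin 4 → ℤ) (a b : ι → C(SU3, ℂ)),
    (∀ i, a i ∈ isotypic (p i)) ∧ (∀ i, b i ∈ isotypic (r i)) ∧ (∀ i, Matched n (p i) (r i)) ∧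
    (∀ x y, f (x * y) = ∑ i, a i x * b i y) ∧
    D = ∑ i, opTensor (quantize θ (p i) (a i)) (quantize θ (r i) (b i))

namespace IsCoproduct

variable {θ : ℝ} {n m : Fin 4 → ℤ} {f g : C(SU3, ℂ)}
  {D D' : HilbertTensor L2SU3 L2SU3 →L[ℂ] HilbertTensor L2SU3 L2SU3}

lemma add (h : IsCoproduct θ n f D) (h' : IsCoproduct θ n g D') :
    IsCoproduct θ n (f + g) (D + D') := by
  obtain ⟨hf, ι, _, p, r, a, b, ha, hb, hpr, hab, rfl⟩ := h
  obtain ⟨hg, ι', _, p', r', a', b', ha', hb', hpr', hab', rfl⟩ := h'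
  refine ⟨add_mem hf hg, ι ⊕ ι', inferInstance, Sum.elim p p', Sum.elim r r', Sum.elim a a',
    Sum.elim b b', ?_, ?_, ?_, ?_, ?_⟩
  · rintro (i | i) <;> simp [ha, ha']
  · rintro (i | i) <;> simp [hb, hb']
  · rintro (i | i) <;> simp [hpr, hpr']
  · intro x y
    simp [hab, hab']
  · simp

lemma smul (h : IsCoproduct θ n f D) (c : ℂ) : IsCoproduct θ n (c • f) (c • D) := by
  obtain ⟨hf, ι, _, p, r, a, b, ha, hb, hpr, hab, rfl⟩ := h
  refine ⟨Submodule.smul_mem _ c hf, ι, inferInstance, p, r, fun i => c • a i, b,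
    fun i => Submodule.smul_mem _ c (ha i), hb, hpr, fun x y => ?_, ?_⟩
  · simp [hab, Finset.mul_sum, mul_assoc]
  · simp [Finset.smul_sum, quantize_smul, opTensor_smul_left]

/-- Every term of the product acquires the same phase χ(n,m), the one in the deformed product, so Δ
is multiplicative for the deformed structure. -/
lemma mul (h : IsCoproduct θ n f D) (h' : IsCoproduct θ m g D') :
    ∃ D'', IsCoproduct θ (n + m) (f * g) D'' ∧ D * D' = chi θ n m • D'' := by
  obtain ⟨hf, ι, _, p, r, a, b, ha, hb, hpr, hab, rfl⟩ := h
  obtain ⟨hg, ι', _, p', r', a', b', ha', hb', hpr', hab', rfl⟩ := h'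
  refine ⟨_, ⟨mul_mem_isotypic hf hg, ι × ι', inferInstance, fun i => p i.1 + p' i.2,
    fun i => r i.1 + r' i.2, fun i => a i.1 * a' i.2, fun i => b i.1 * b' i.2,
    fun i => mul_mem_isotypic (ha _) (ha' _), fun i => mul_mem_isotypic (hb _) (hb' _),
    fun i => (hpr _).add (hpr' _), fun x y => ?_, rfl⟩, ?_⟩
  · rw [ContinuousMap.mul_apply, hab, hab', Finset.sum_mul_sum, ← Finset.sum_product']
    exact Finset.sum_congr rfl fun i _ => by simp only [ContinuousMap.mul_apply]; ring
  · rw [Finset.sum_mul_sum, ← Finset.sum_product', Finset.smul_sum]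
    refine Finset.sum_congr rfl fun i _ => ?_
    rw [← opTensor_mul, quantize_mul θ _ (ha' _), quantize_mul θ _ (hb' _), opTensor_smul_left,
      opTensor_smul_right, smul_smul, (hpr _).chi_mul_chi θ (hpr' _)]

lemma star (h : IsCoproduct θ n f D) : IsCoproduct θ (-n) (star f) (star D) := by
  obtain ⟨hf, ι, _, p, r, a, b, ha, hb, hpr, hab, rfl⟩ := h
  refine ⟨star_mem_isotypic hf, ι, inferInstance, fun i => -p i, fun i => -r i,
    fun i => Star.star (a i), fun i => Star.star (b i), fun i => star_mem_isotypic (ha i),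
    fun i => star_mem_isotypic (hb i), fun i => (hpr i).neg, fun x y => ?_, ?_⟩
  · simp [hab]
  · rw [star_sum]
    exact Finset.sum_congr rfl fun i _ => by
      rw [star_opTensor, star_quantize θ (ha i), star_quantize θ (hb i)]

lemma one : IsCoproduct θ 0 1 1 :=
  ⟨one_mem_isotypic, Unit, inferInstance, fun _ => 0, fun _ => 0, fun _ => 1, fun _ => 1,
    fun _ => one_mem_isotypic, fun _ => one_mem_isotypic, fun _ => by simp [Matched],
    fun x y => by simp, by simp [quantize_zero_one]⟩

lemma coord (i j : Fin 3) : IsCoproduct θ (deg i j) (coord i j)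
    (∑ k, opTensor (U θ i k) (U θ k j)) :=
  ⟨coord_mem i j, Fin 3, inferInstance, fun k => deg i k, fun k => deg k j,
    fun k => QSU3.coord i k, fun k => QSU3.coord k j, fun k => coord_mem i k,
    fun k => coord_mem k j, fun k => by revert i j k; decide,
    fun x y => by
      change ((x : Matrix (Fin 3) (Fin 3) ℂ) * (y : Matrix (Fin 3) (Fin 3) ℂ)) i j =
        ∑ k, (x : Matrix (Fin 3) (Fin 3) ℂ) i k * (y : Matrix (Fin 3) (Fin 3) ℂ) k j
      rw [Matrix.mul_apply], rfl⟩

/-- Invariance of the Haar state. -/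
lemma invariance (h : IsCoproduct θ n f D) (ξ η : L2SU3) :
    inner ℂ (pt ξ (vec 1)) (D (pt η (vec 1))) = inner ℂ ξ η * ∫ x, f x ∂haar := by
  obtain ⟨hf, ι, _, p, r, a, b, ha, hb, hpr, hab, rfl⟩ := h
  -- The Haar integral is invariant under the torus action, so it annihilates every nonzero degree.
  have hint : ∀ {d : Fin 4 → ℤ} {e : C(SU3, ℂ)}, e ∈ isotypic d → ∫ x, e x ∂haar ≠ 0 → d = 0 := by
    intro d e he h0
    have h1 : ∀ v, char d v = 1 := by
      intro v
      have h2 := integral_comp_act v e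
      simp only [mem_isotypic.mp he v, integral_const_mul] at h2
      exact mul_right_cancel₀ h0 (h2.trans (one_mul _).symm)
    by_contra hd
    have h3 := coeff_eq {d} id (fun _ => 1) (n := 0) (C := 1) (fun v => by simp [h1])
    rw [Finset.sum_filter] at h3
    simp only [id, Finset.sum_singleton, if_neg hd] at h3
    exact zero_ne_one h3
  have hvec : ∀ e : C(SU3, ℂ), inner ℂ (vec 1) (vec e) = ∫ x, e x ∂haar := by
    intro e
    rw [inner_vec]
    simp
  -- If bᵢ has nonzero integral then its degree is 0, and matching forces aᵢ to have degree `P`, the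
  -- same for all i. The surviving terms can therefore be summed inside one `quantize`.
  set P : Fin 4 → ℤ := ![n 0, n 1, 0, 0] with hP
  have hterm : ∀ i, inner ℂ ξ (quantize θ (p i) (a i) η) * ∫ x, b i x ∂haar =
      inner ℂ ξ (quantize θ P ((∫ x, b i x ∂haar) • a i) η) := by
    intro i
    rw [quantize_smul, _root_.smul_apply, inner_smul_right, mul_comm]
    by_cases h0 : ∫ x, b i x ∂haar = 0
    · rw [h0, zero_mul, zero_mul]
    · have hr := hint (hb i) h0
      obtain ⟨h1, h2, h3, h4, -, -⟩ := hpr i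
      rw [hr] at h3 h4
      have hp : p i = P := by
        funext j
        fin_cases j
        · exact h1
        · exact h2
        · exact (add_zero _).symm.trans h3
        · exact (add_zero _).symm.trans h4
      rw [hp]
  -- Integrating f(xy) = ∑ aᵢ(x) bᵢ(y) over y and using left invariance.
  have hconst : ∑ i, (∫ x, b i x ∂haar) • a i = (∫ x, f x ∂haar) • (1 : C(SU3, ℂ)) := by
    ext x
    simp only [ContinuousMap.sum_apply, ContinuousMap.smul_apply, smul_eq_mul,
      ContinuousMap.one_apply, mul_one]
    have h1 : ∫ y, f (x * y) ∂haar = ∫ y, f y ∂haar :=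
      integral_mul_left_eq_self (μ := haar) (fun y => f y) x
    rw [← h1]
    simp only [hab]
    rw [integral_finsetSum]
    · simp only [integral_const_mul, mul_comm]
    · intro i _
      exact ((b i).continuous.integrable_of_hasCompactSupport
        (HasCompactSupport.of_compactSpace _)).const_mul _
  have hsum : inner ℂ (pt ξ (vec 1)) ((∑ i, opTensor (quantize θ (p i) (a i))
      (quantize θ (r i) (b i))) (pt η (vec 1))) =
      inner ℂ ξ (quantize θ P ((∫ x, f x ∂haar) • (1 : C(SU3, ℂ))) η) := by
    rw [← hconst, _root_.sum_apply, inner_sum, ← quantizeL_apply, map_sum, _root_.sum_apply,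
      inner_sum]
    refine Finset.sum_congr rfl fun i _ => ?_
    rw [opTensor_pt, inner_pt, quantize_vec_one, hvec, hterm, quantizeL_apply]
  rw [hsum, quantize_smul, _root_.smul_apply, inner_smul_right, mul_comm]
  by_cases h0 : ∫ x, f x ∂haar = 0
  · rw [h0, mul_zero, mul_zero]
  · have hn := hint hf h0
    have hP0 : P = 0 := by
      rw [hP, hn]
      funext j
      fin_cases j <;> rfl
    rw [hP0, quantize_zero_one, one_apply_eq_self]

/-- The Gram matrix of the vectors `D (ξ ⊗ 1)`. -/
lemma inner_apply (h : IsCoproduct θ n f D) (h' : IsCoproduct θ m g D') (ξ η : L2SU3) :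
    inner ℂ (D (pt ξ (vec 1))) (D' (pt η (vec 1))) = inner ℂ (pt ξ (vec f)) (pt η (vec g)) := by
  -- D*D' is χ(-n,m) times the coproduct of the conjugate of `f` times `g`, which invariance
  -- evaluates; ⟨f, g⟩, written through L_f* L_g, carries the same phase.
  obtain ⟨D'', h'', hD⟩ := h.star.mul h'
  rw [← ContinuousLinearMap.adjoint_inner_right, ← ContinuousLinearMap.star_eq_adjoint,
    ← mul_apply_eq_comp, hD, _root_.smul_apply, inner_smul_right, h''.invariance, inner_pt,
    ← quantize_vec_one θ n f, ← quantize_vec_one θ m g,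
    ← ContinuousLinearMap.adjoint_inner_right, ← ContinuousLinearMap.star_eq_adjoint,
    ← mul_apply_eq_comp, star_quantize θ h.1, quantize_mul θ _ h'.1, _root_.smul_apply,
    inner_smul_right, quantize_vec_one, inner_vec]
  simp only [ContinuousMap.one_apply, star_one, one_mul]
  ring

end IsCoproduct

/-- The functions of degree `n` that have a coproduct. -/
def coproductDomain (θ : ℝ) (n : Fin 4 → ℤ) : Submodule ℂ C(SU3, ℂ) where
  carrier := {f | ∃ D, IsCoproduct θ n f D}
  add_mem' := fun ⟨_, h⟩ ⟨_, h'⟩ => ⟨_, h.add h'⟩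
  zero_mem' := ⟨0, zero_mem _, Empty, inferInstance, fun _ => 0, fun _ => 0, fun _ => 0,
    fun _ => 0, fun i => i.elim, fun i => i.elim, fun i => i.elim, fun x y => by simp, by simp⟩
  smul_mem' c _ := fun ⟨_, h⟩ => ⟨_, h.smul c⟩

lemma isGradedAlgebra_coproductDomain (θ : ℝ) : IsGradedAlgebra (coproductDomain θ) where
  le_isotypic _ _ := fun ⟨_, h⟩ => h.1
  one_mem := ⟨_, IsCoproduct.one⟩
  mul_mem := fun ⟨_, h⟩ ⟨_, h'⟩ => let ⟨D, hD, _⟩ := h.mul h'; ⟨D, hD⟩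
  star_mem := fun ⟨_, h⟩ => ⟨_, h.star⟩
  coord_mem i j := ⟨_, IsCoproduct.coord i j⟩

/-- The coproduct of `u_{ij}` as an operator. -/
def DU (θ : ℝ) (i j : Fin 3) : HilbertTensor L2SU3 L2SU3 →L[ℂ] HilbertTensor L2SU3 L2SU3 :=
  ∑ k, opTensor (U θ i k) (U θ k j)

lemma star_DU (θ : ℝ) (i j : Fin 3) :
    star (DU θ i j) = ∑ k, opTensor (star (U θ i k)) (star (U θ k j)) := by
  rw [DU, star_sum]
  exact Finset.sum_congr rfl fun k _ => star_opTensor _ _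

section Sums

variable {H K : Type*} [NormedAddCommGroup H] [InnerProductSpace ℂ H] [CompleteSpace H]
  [NormedAddCommGroup K] [InnerProductSpace ℂ K] [CompleteSpace K]

lemma opTensor_sum_left {ι : Type*} (s : Finset ι) (f : ι → H →L[ℂ] H)
    (T : K →L[ℂ] K) : opTensor (∑ i ∈ s, f i) T = ∑ i ∈ s, opTensor (f i) T :=
  ext_pt' fun x y => by simp

lemma opTensor_sum_right {ι : Type*} (s : Finset ι) (f : ι → K →L[ℂ] K)
    (T : H →L[ℂ] H) : opTensor T (∑ i ∈ s, f i) = ∑ i ∈ s, opTensor T (f i) :=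
  ext_pt' fun x y => by simp

end Sums

lemma opTensor_zero_left (T : L2SU3 →L[ℂ] L2SU3) : opTensor (0 : L2SU3 →L[ℂ] L2SU3) T = 0 :=
  ext_pt' fun x y => by simp

lemma opTensor_zero_right (T : L2SU3 →L[ℂ] L2SU3) : opTensor T (0 : L2SU3 →L[ℂ] L2SU3) = 0 :=
  ext_pt' fun x y => by simp

/-- Unitarity in the first leg collapses the double sum. This solves Δ(u_kj) = ∑ u_kl ⊗ u_lj for 1 ⊗
u_ij. -/
lemma cancel_left (V W : Fin 3 → Fin 3 → L2SU3 →L[ℂ] L2SU3) (Y : Fin 3 → L2SU3 →L[ℂ] L2SU3)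
    (i : Fin 3) (h : ∀ l, ∑ k, V k l * W k i = if l = i then 1 else 0) :
    ∑ k, (∑ l, opTensor (V k l) (Y l)) * opTensor (W k i) 1 = opTensor 1 (Y i) := by
  simp only [Finset.sum_mul, ← opTensor_mul, mul_one]
  rw [Finset.sum_comm]
  simp only [← opTensor_sum_left, h]
  rw [Finset.sum_eq_single i (fun l _ hl => by rw [if_neg hl, opTensor_zero_left]) (by simp)]
  simp

lemma cancel_right (V W : Fin 3 → Fin 3 → L2SU3 →L[ℂ] L2SU3)
    (Y : Fin 3 → L2SU3 →L[ℂ] L2SU3)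
    (i : Fin 3) (h : ∀ l, ∑ k, V l k * W i k = if l = i then 1 else 0) :
    ∑ k, (∑ l, opTensor (Y l) (V l k)) * opTensor 1 (W i k) = opTensor (Y i) 1 := by
  simp only [Finset.sum_mul, ← opTensor_mul, mul_one]
  rw [Finset.sum_comm]
  simp only [← opTensor_sum_right, h]
  rw [Finset.sum_eq_single i (fun l _ hl => by rw [if_neg hl, opTensor_zero_right]) (by simp)]
  simp

lemma opTensor_one_U (θ : ℝ) (i j : Fin 3) :
    opTensor 1 (U θ i j) = ∑ k, DU θ k j * opTensor (star (U θ k i)) 1 :=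
  (cancel_left (U θ) (fun k i => star (U θ k i)) (fun l => U θ l j) i
    (fun l => sum_U_mul_star_U_col θ i l)).symm

lemma opTensor_one_star_U (θ : ℝ) (i j : Fin 3) :
    opTensor 1 (star (U θ i j)) = ∑ k, star (DU θ k j) * opTensor (U θ k i) 1 := by
  simp only [star_DU]
  exact (cancel_left (fun k l => star (U θ k l)) (U θ) (fun l => star (U θ l j)) i
    (fun l => sum_star_U_mul_U_col θ i l)).symm

lemma opTensor_U_one (θ : ℝ) (i j : Fin 3) :
    opTensor (U θ j i) 1 = ∑ k, DU θ j k * opTensor 1 (star (U θ i k)) :=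
  (cancel_right (U θ) (fun k i => star (U θ k i)) (fun l => U θ j l) i
    (fun l => sum_U_mul_star_U_row θ i l)).symm

lemma opTensor_star_U_one (θ : ℝ) (i j : Fin 3) :
    opTensor (star (U θ j i)) 1 = ∑ k, star (DU θ j k) * opTensor 1 (U θ i k) := by
  simp only [star_DU]
  exact (cancel_right (fun k l => star (U θ k l)) (U θ) (fun l => star (U θ j l)) i
    (fun l => sum_star_U_mul_U_row θ i l)).symm

/-- The *-algebra generated by the coproducts of the coordinate functions. -/
def coproductOps (θ : ℝ) :
    StarSubalgebra ℂ (HilbertTensor L2SU3 L2SU3 →L[ℂ] HilbertTensor L2SU3 L2SU3) :=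
  StarAlgebra.adjoin ℂ {T | ∃ i j, T = DU θ i j}

lemma DU_mem (θ : ℝ) (i j : Fin 3) : DU θ i j ∈ coproductOps θ :=
  StarAlgebra.subset_adjoin ℂ _ ⟨i, j, rfl⟩

lemma U_mem (θ : ℝ) (i j : Fin 3) : U θ i j ∈ coordOps θ :=
  StarAlgebra.subset_adjoin ℂ _ ⟨i, j, rfl⟩

lemma star_DU_mem (θ : ℝ) (i j : Fin 3) : star (DU θ i j) ∈ coproductOps θ :=
  star_mem (DU_mem θ i j)

lemma star_U_mem (θ : ℝ) (i j : Fin 3) : star (U θ i j) ∈ coordOps θ :=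
  star_mem (U_mem θ i j)

lemma comm_amp (S T : L2SU3 →L[ℂ] L2SU3) :
    opTensor S 1 * opTensor 1 T = opTensor 1 T * opTensor S 1 := by
  rw [← opTensor_mul, ← opTensor_mul, one_mul, mul_one, one_mul, mul_one]

/-- `1 ⊗ O` is contained in the span of `Δ(O) (O ⊗ 1)`. -/
theorem ampRight_mem (θ : ℝ) {T : L2SU3 →L[ℂ] L2SU3} (hT : T ∈ coordOps θ) :
    opTensor 1 T ∈ (Subalgebra.toSubmodule (coproductOps θ).toSubalgebra *
      Subalgebra.toSubmodule ((coordOps θ).map (ampLeft (K := L2SU3))).toSubalgebra :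
      Submodule ℂ (HilbertTensor L2SU3 L2SU3 →L[ℂ] HilbertTensor L2SU3 L2SU3)) := by
  have h1 : opTensor 1 T ∈ (coordOps θ).map (ampRight (H := L2SU3)) := ⟨T, hT, rfl⟩
  rw [coordOps, StarAlgHom.map_adjoin, ← StarSubalgebra.mem_toSubalgebra,
    StarAlgebra.adjoin_toSubalgebra] at h1
  -- Here D = Δ(O) and X = O ⊗ 1, which commutes with 1 ⊗ O; only the generators 1 ⊗ u and their
  -- adjoints have to be expanded.
  refine adjoin_le_mul _ _ ?_ ?_ h1
  · rintro _ ⟨S, -, rfl⟩ y (⟨R, -, rfl⟩ | ⟨R, -, hR⟩)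
    · exact comm_amp S R
    · rw [← star_star y, ← hR, ← map_star]
      exact comm_amp S _
  · rintro y (⟨_, ⟨i, j, rfl⟩, rfl⟩ | ⟨_, ⟨i, j, rfl⟩, hR⟩)
    · change opTensor 1 (U θ i j) ∈ _
      rw [opTensor_one_U]
      exact sum_mem fun k _ => Submodule.mul_mem_mul (DU_mem θ k j)
        ⟨_, star_U_mem θ k i, rfl⟩
    · rw [← star_star y, ← hR, ← map_star]
      change opTensor 1 (star (U θ i j)) ∈ _
      rw [opTensor_one_star_U]
      exact sum_mem fun k _ => Submodule.mul_mem_mul (star_DU_mem θ k j)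
        ⟨_, U_mem θ k i, rfl⟩

/-- `O ⊗ 1` is contained in the span of `Δ(O) (1 ⊗ O)`. -/
theorem ampLeft_mem (θ : ℝ) {T : L2SU3 →L[ℂ] L2SU3} (hT : T ∈ coordOps θ) :
    opTensor T 1 ∈ (Subalgebra.toSubmodule (coproductOps θ).toSubalgebra *
      Subalgebra.toSubmodule ((coordOps θ).map (ampRight (H := L2SU3))).toSubalgebra :
      Submodule ℂ (HilbertTensor L2SU3 L2SU3 →L[ℂ] HilbertTensor L2SU3 L2SU3)) := by
  have h1 : opTensor T 1 ∈ (coordOps θ).map (ampLeft (K := L2SU3)) := ⟨T, hT, rfl⟩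
  rw [coordOps, StarAlgHom.map_adjoin, ← StarSubalgebra.mem_toSubalgebra,
    StarAlgebra.adjoin_toSubalgebra] at h1
  refine adjoin_le_mul _ _ ?_ ?_ h1
  · rintro _ ⟨S, -, rfl⟩ y (⟨R, -, rfl⟩ | ⟨R, -, hR⟩)
    · exact (comm_amp R S).symm
    · rw [← star_star y, ← hR, ← map_star]
      exact (comm_amp _ S).symm
  · rintro y (⟨_, ⟨i, j, rfl⟩, rfl⟩ | ⟨_, ⟨i, j, rfl⟩, hR⟩)
    · change opTensor (U θ i j) 1 ∈ _
      rw [opTensor_U_one]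
      exact sum_mem fun k _ => Submodule.mul_mem_mul (DU_mem θ i k)
        ⟨_, star_U_mem θ j k, rfl⟩
    · rw [← star_star y, ← hR, ← map_star]
      change opTensor (star (U θ i j)) 1 ∈ _
      rw [opTensor_star_U_one]
      exact sum_mem fun k _ => Submodule.mul_mem_mul (star_DU_mem θ i k)
        ⟨_, U_mem θ j k, rfl⟩

end CoproductRelation

/-! ### The multiplicative unitary and general expansions -/

section MultiplicativeUnitary

open Filter Topology

lemma star_mem_span_isCoproduct {θ : ℝ}
    {d : HilbertTensor L2SU3 L2SU3 →L[ℂ] HilbertTensor L2SU3 L2SU3}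
    (hd : d ∈ Submodule.span ℂ {D | ∃ n f, IsCoproduct θ n f D}) :
    star d ∈ Submodule.span ℂ {D | ∃ n f, IsCoproduct θ n f D} := by
  induction hd using Submodule.span_induction with
  | mem D hD =>
    obtain ⟨n, f, hD⟩ := hD
    exact Submodule.subset_span ⟨_, _, hD.star⟩
  | zero => rw [star_zero]; exact zero_mem _
  | add a b _ _ ha hb => rw [star_add]; exact add_mem ha hb
  | smul c a _ ha => rw [star_smul]; exact Submodule.smul_mem _ _ ha

/-- A product of two homogeneous coproducts is a phase times another one, so the *-algebra generated
by the Δ(u_ij) is spanned by coproducts of homogeneous functions. -/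
lemma coproductOps_le_span (θ : ℝ) {d : HilbertTensor L2SU3 L2SU3 →L[ℂ] HilbertTensor L2SU3 L2SU3}
    (hd : d ∈ coproductOps θ) : d ∈ Submodule.span ℂ {D | ∃ n f, IsCoproduct θ n f D} := by
  induction hd using StarAlgebra.adjoin_induction with
  | mem d hd =>
    obtain ⟨i, j, rfl⟩ := hd
    exact Submodule.subset_span ⟨_, _, IsCoproduct.coord i j⟩
  | algebraMap c =>
    rw [Algebra.algebraMap_eq_smul_one]
    exact Submodule.smul_mem _ c (Submodule.subset_span ⟨_, _, IsCoproduct.one⟩)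
  | add a b _ _ ha hb => exact add_mem ha hb
  | mul a b _ _ ha hb =>
    have h := Submodule.mul_mem_mul ha hb
    rw [Submodule.span_mul_span] at h
    refine Submodule.span_le.mpr ?_ h
    rintro _ ⟨D, ⟨n, f, hD⟩, D', ⟨m, g, hD'⟩, rfl⟩
    obtain ⟨D'', h1, h2⟩ := hD.mul hD'
    change D * D' ∈ _
    rw [h2]
    exact Submodule.smul_mem _ _ (Submodule.subset_span ⟨_, _, h1⟩)
  | star a _ ha =>
    exact star_mem_span_isCoproduct ha

/-- The multiplicative unitary. -/
theorem exists_multUnitary (θ : ℝ) :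
    ∃ W : HilbertTensor L2SU3 L2SU3 ≃ₗᵢ[ℂ] HilbertTensor L2SU3 L2SU3,
      ∀ n f D, IsCoproduct θ n f D → ∀ ξ, W (pt ξ (vec f)) = D (pt ξ (vec 1)) := by
  let J := {t : (Fin 4 → ℤ) × C(SU3, ℂ) ×
    (HilbertTensor L2SU3 L2SU3 →L[ℂ] HilbertTensor L2SU3 L2SU3) //
      IsCoproduct θ t.1 t.2.1 t.2.2} × L2SU3
  have hx : Dense (Submodule.span ℂ (Set.range fun j : J => pt j.2 (vec j.1.1.2.1)) :
      Set (HilbertTensor L2SU3 L2SU3)) := by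
    refine (dense_span_pt (dense_span_univ (H := L2SU3))
      (isGradedAlgebra_coproductDomain θ).dense_span_vec).mono (Submodule.span_mono ?_)
    rintro _ ⟨ξ, -, _, ⟨n, f, ⟨D, hD⟩, rfl⟩, rfl⟩
    exact ⟨(⟨(n, f, D), hD⟩, ξ), rfl⟩
  have hy : Dense (Submodule.span ℂ (Set.range fun j : J => j.1.1.2.2 (pt j.2 (vec 1))) :
      Set (HilbertTensor L2SU3 L2SU3)) := by
    set Y := Submodule.span ℂ (Set.range fun j : J => j.1.1.2.2 (pt j.2 (vec 1))) with hY
    refine (dense_span_pt (dense_span_univ (H := L2SU3))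
      (isGradedAlgebra_componentsIn θ le_rfl).dense_span_vec).mono (?_ : Submodule.span ℂ _ ≤ Y)
    rw [Submodule.span_le]
    rintro _ ⟨ξ, -, _, ⟨n, f, hf, rfl⟩, rfl⟩
    -- Surjectivity: ξ ⊗ f = (1 ⊗ L_f)(ξ ⊗ 1), and 1 ⊗ L_f lies in Δ(O)(O ⊗ 1), whose right factor
    -- merely changes ξ.
    have h1 : pt ξ (vec f) = opTensor 1 (quantize θ n f) (pt ξ (vec 1)) := by
      rw [opTensor_pt, quantize_vec_one, one_apply_eq_self]
    change pt ξ (vec f) ∈ Y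
    rw [h1]
    refine Submodule.mul_induction_on (ampRight_mem θ hf.2) (fun d hd S hS => ?_)
      fun a b ha hb => ?_
    · obtain ⟨S, -, rfl⟩ := hS
      rw [mul_apply_eq_comp]
      change d (opTensor S 1 (pt ξ (vec 1))) ∈ Y
      rw [opTensor_pt, one_apply_eq_self]
      have h2 := coproductOps_le_span θ hd
      clear hd
      induction h2 using Submodule.span_induction with
      | mem D hD =>
        obtain ⟨n, f, hD⟩ := hD
        exact Submodule.subset_span ⟨(⟨(n, f, D), hD⟩, S ξ), rfl⟩
      | zero => exact zero_mem Y
      | add a b _ _ ha hb => exact add_mem ha hb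
      | smul c a _ ha => exact Submodule.smul_mem _ c ha
    · exact add_mem ha hb
  obtain ⟨W, hW⟩ := exists_unitary_of_gram _ _ hx hy fun i j =>
    (IsCoproduct.inner_apply i.1.2 j.1.2 i.2 j.2).symm
  exact ⟨W, fun n f D hD ξ => hW (⟨(n, f, D), hD⟩, ξ)⟩

/-- Conjugation by a unitary. -/
def conjHom {H K : Type*} [NormedAddCommGroup H] [InnerProductSpace ℂ H] [CompleteSpace H]
    [NormedAddCommGroup K] [InnerProductSpace ℂ K] [CompleteSpace K] (V : H ≃ₗᵢ[ℂ] K) :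
    (H →L[ℂ] H) →⋆ₐ[ℂ] (K →L[ℂ] K) :=
  StarAlgHomClass.toStarAlgHom V.conjStarAlgEquiv

lemma conjHom_apply {H K : Type*} [NormedAddCommGroup H] [InnerProductSpace ℂ H] [CompleteSpace H]
    [NormedAddCommGroup K] [InnerProductSpace ℂ K] [CompleteSpace K] (V : H ≃ₗᵢ[ℂ] K)
    (T : H →L[ℂ] H) (z : K) : conjHom V T z = V (T (V.symm z)) := rfl

/-- A choice of the multiplicative unitary. -/
def multUnitary (θ : ℝ) : HilbertTensor L2SU3 L2SU3 ≃ₗᵢ[ℂ] HilbertTensor L2SU3 L2SU3 :=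
  (exists_multUnitary θ).choose

/-- The coproduct `T ↦ W (1 ⊗ T) W*` on bounded operators. -/
def coprodHom (θ : ℝ) : (L2SU3 →L[ℂ] L2SU3) →⋆ₐ[ℂ]
    (HilbertTensor L2SU3 L2SU3 →L[ℂ] HilbertTensor L2SU3 L2SU3) :=
  (conjHom (multUnitary θ)).comp ampRight

lemma coprodHom_apply (θ : ℝ) (T : L2SU3 →L[ℂ] L2SU3) (z : HilbertTensor L2SU3 L2SU3) :
    coprodHom θ T z = multUnitary θ (opTensor 1 T ((multUnitary θ).symm z)) := rfl

/-- On the total vectors ξ ⊗ g the unitary intertwines 1 ⊗ L_f with D: both orders give χ(n,m) times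
the coproduct of f g applied to ξ ⊗ 1. -/
lemma IsCoproduct.coprodHom_eq {θ : ℝ} {n : Fin 4 → ℤ} {f : C(SU3, ℂ)}
    {D : HilbertTensor L2SU3 L2SU3 →L[ℂ] HilbertTensor L2SU3 L2SU3} (h : IsCoproduct θ n f D) :
    coprodHom θ (quantize θ n f) = D := by
  have hW := (exists_multUnitary θ).choose_spec
  change ∀ n f D, IsCoproduct θ n f D → ∀ ξ, multUnitary θ (pt ξ (vec f)) = D (pt ξ (vec 1)) at hW
  have h1 : (multUnitary θ).toContinuousLinearEquiv.toContinuousLinearMap ∘L opTensor 1 (quantize θ n f) =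
      D ∘L (multUnitary θ).toContinuousLinearEquiv.toContinuousLinearMap := by
    refine ext_pt (dense_span_univ (H := L2SU3))
      (isGradedAlgebra_coproductDomain θ).dense_span_vec ?_
    rintro ξ - _ ⟨m, g, ⟨D', h'⟩, rfl⟩
    obtain ⟨D'', h'', hD⟩ := h.mul h'
    change multUnitary θ (opTensor 1 (quantize θ n f) (pt ξ (vec g))) =
      D (multUnitary θ (pt ξ (vec g)))
    rw [opTensor_pt, one_apply_eq_self, ← quantize_vec_one θ m g, ← mul_apply_eq_comp,
      quantize_mul θ _ h'.1, quantize_vec_one, _root_.smul_apply, quantize_vec_one, map_smul,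
      map_smul, hW _ _ _ h'', hW _ _ _ h', ← mul_apply_eq_comp, hD, _root_.smul_apply]
  ext1 z
  rw [coprodHom_apply]
  have h2 := DFunLike.congr_fun h1 ((multUnitary θ).symm z)
  refine h2.trans ?_
  change D (multUnitary θ ((multUnitary θ).symm z)) = D z
  rw [LinearIsometryEquiv.apply_symm_apply]

/-! ### General expansions -/

lemma ext_inner_pt {z w : HilbertTensor L2SU3 L2SU3}
    (h : ∀ x y, inner ℂ (pt x y) z = inner ℂ (pt x y) w) : z = w := by
  refine (dense_span_pt (dense_span_univ (H := L2SU3))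
    (dense_span_univ (H := L2SU3))).eq_of_inner_right ℂ fun v hv => ?_
  induction hv using Submodule.span_induction with
  | mem v hv => obtain ⟨x, -, y, -, rfl⟩ := hv; exact h x y
  | zero => simp
  | add a b _ _ ha hb => rw [inner_add_left, inner_add_left, ha, hb]
  | smul c a _ ha => rw [inner_smul_left, inner_smul_left, ha]

/-- One variable at a time: for fixed x the combination of the bᵢ vanishes, so a matrix coefficient
may be taken in the second leg; the resulting combination of the aᵢ vanishes for every x. -/
lemma sum_opTensor_mulOp_eq_zero {ι : Type*} (s : Finset ι) (a b : ι → C(SU3, ℂ))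
    (h : ∀ x y, ∑ i ∈ s, a i x * b i y = 0) :
    ∑ i ∈ s, opTensor (mulOp (a i)) (mulOp (b i)) = 0 := by
  have hlin : ∀ (c : ι → ℂ) (e : ι → C(SU3, ℂ)) (ξ : L2SU3),
      mulOp (∑ i ∈ s, c i • e i) ξ = ∑ i ∈ s, c i • mulOp (e i) ξ := by
    intro c e ξ
    let M : C(SU3, ℂ) →ₗ[ℂ] (L2SU3 →L[ℂ] L2SU3) :=
      { toFun := mulOp, map_add' := mulOp_add, map_smul' := mulOp_smul }
    change M (∑ i ∈ s, c i • e i) ξ = _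
    rw [map_sum, _root_.sum_apply]
    refine Finset.sum_congr rfl fun i _ => ?_
    rw [map_smul]
    rfl
  have hM0 : mulOp 0 = 0 := by simpa using mulOp_smul 0 0
  refine ext_pt' fun ξ η => ext_inner_pt fun ξ' η' => ?_
  simp only [_root_.sum_apply, opTensor_pt, inner_sum, inner_pt, _root_.zero_apply,
    inner_zero_right]
  have h1 : ∀ x, ∑ i ∈ s, a i x * inner ℂ η' (mulOp (b i) η) = 0 := by
    intro x
    have h2 : ∑ i ∈ s, a i x • b i = 0 := by
      ext y
      simpa using h x y
    have h3 := hlin (fun i => a i x) b η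
    rw [h2, hM0] at h3
    have h4 := congrArg (inner ℂ η') h3
    simp only [_root_.zero_apply, inner_zero_right, inner_sum, inner_smul_right] at h4
    exact h4.symm
  have h5 : ∑ i ∈ s, inner ℂ η' (mulOp (b i) η) • a i = 0 := by
    ext x
    have := h1 x
    simp only [mul_comm (a _ x)] at this
    simpa using this
  have h6 := hlin (fun i => inner ℂ η' (mulOp (b i) η)) a ξ
  rw [h5, hM0] at h6
  have h7 := congrArg (inner ℂ ξ') h6
  simp only [_root_.zero_apply, inner_zero_right, inner_sum, inner_smul_right] at h7
  simp only [mul_comm (inner ℂ ξ' _)]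
  exact h7.symm

/-- The deformed operator on the tensor square only depends on the function on `SU(3) × SU(3)`. -/
lemma sum_opTensor_eq_zero (θ : ℝ) {ι : Type*} (s : Finset ι) (p r : ι → Fin 4 → ℤ)
    (a b : ι → C(SU3, ℂ)) (ha : ∀ i, a i ∈ isotypic (p i)) (hb : ∀ i, b i ∈ isotypic (r i))
    (h : ∀ x y, ∑ i ∈ s, a i x * b i y = 0) :
    ∑ i ∈ s, opTensor (quantize θ (p i) (a i)) (quantize θ (r i) (b i)) = 0 := by
  classical
  -- Group the terms by the degrees (P, R) of the two legs. Independence of characters makes the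
  -- function of each group vanish, and within a group the translations form a common right factor.
  rw [← Finset.sum_fiberwise_of_maps_to (g := p) (t := s.image p)
    (fun i hi => Finset.mem_image_of_mem p hi)]
  refine Finset.sum_eq_zero fun P _ => ?_
  rw [← Finset.sum_fiberwise_of_maps_to (g := r) (t := s.image r)
    (fun i hi => Finset.mem_image_of_mem r (Finset.filter_subset _ _ hi))]
  refine Finset.sum_eq_zero fun R _ => ?_
  have h1 : ∀ x y, ∑ i ∈ s with p i = P, a i x * b i y = 0 := by
    intro x y
    refine coeff_eq s p (fun i => a i x * b i y) (fun v => ?_)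
    rw [zero_mul, ← h (act v x) y]
    refine Finset.sum_congr rfl fun i _ => ?_
    rw [mem_isotypic.mp (ha i)]
    ring
  have h2 : ∀ x y, ∑ i ∈ {i ∈ s | p i = P} with r i = R, a i x * b i y = 0 := by
    intro x y
    refine coeff_eq _ r (fun i => a i x * b i y) (fun v => ?_)
    rw [zero_mul, ← h1 x (act v y)]
    refine Finset.sum_congr rfl fun i _ => ?_
    rw [mem_isotypic.mp (hb i)]
    ring
  have h3 := sum_opTensor_mulOp_eq_zero _ a b h2
  have h4 : ∀ i ∈ {i ∈ {i ∈ s | p i = P} | r i = R},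
      opTensor (quantize θ (p i) (a i)) (quantize θ (r i) (b i)) =
      opTensor (mulOp (a i)) (mulOp (b i)) *
        opTensor (translation (shift θ P)) (translation (shift θ R)) := by
    intro i hi
    simp only [Finset.mem_filter] at hi
    rw [← opTensor_mul, ← hi.1.2, ← hi.2]
    rfl
  rw [Finset.sum_congr rfl h4, ← Finset.sum_mul, h3, zero_mul]

lemma act_mul_act (v : Fin 4 → ℝ) (x y : SU3) :
    act ![v 0, v 1, 0, 0] x * act ![0, 0, v 2, v 3] y = act v (x * y) := by
  change (torusElt (v 0) (v 1))⁻¹ * x * torusElt 0 0 * ((torusElt 0 0)⁻¹ * y *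
    torusElt (v 2) (v 3)) = (torusElt (v 0) (v 1))⁻¹ * (x * y) * torusElt (v 2) (v 3)
  rw [torusElt_zero]
  generalize torusElt (v 0) (v 1) = s
  generalize torusElt (v 2) (v 3) = t
  simp only [inv_one, one_mul, mul_one, mul_assoc]

/-- A torus element inserted between x and y cancels. Invariance under this forces the inner degrees
of the two legs to be opposite. -/
lemma act_mul_act_middle (s t : ℝ) (x y : SU3) :
    act ![0, 0, s, t] x * act ![s, t, 0, 0] y = x * y := by
  change (torusElt 0 0)⁻¹ * x * torusElt s t * ((torusElt s t)⁻¹ * y * torusElt 0 0) = x * y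
  rw [torusElt_zero]
  generalize torusElt s t = s
  simp only [inv_one, one_mul, mul_one, mul_assoc, mul_inv_cancel_left]

/-- In an expansion of `f(xy)` only the terms of compatible degrees matter. -/
lemma sum_matched {n : Fin 4 → ℤ} {f : C(SU3, ℂ)} (hf : f ∈ isotypic n) {ι : Type*} [Fintype ι]
    (p r : ι → Fin 4 → ℤ) (a b : ι → C(SU3, ℂ)) (ha : ∀ i, a i ∈ isotypic (p i))
    (hb : ∀ i, b i ∈ isotypic (r i)) (h : ∀ x y, f (x * y) = ∑ i, a i x * b i y) (x y : SU3) :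
    ∑ i with Matched n (p i) (r i), a i x * b i y = f (x * y) := by
  -- Translating x on the left and y on the right isolates the terms with the correct outer degrees.
  have h1 : ∀ x y, ∑ i with ![p i 0, p i 1, r i 2, r i 3] = n, a i x * b i y = f (x * y) := by
    intro x y
    refine coeff_eq _ (fun i => ![p i 0, p i 1, r i 2, r i 3]) (fun i => a i x * b i y)
      (fun v => ?_)
    have h2 := h (act ![v 0, v 1, 0, 0] x) (act ![0, 0, v 2, v 3] y)
    rw [act_mul_act, mem_isotypic.mp hf, mul_comm] at h2
    rw [h2]
    refine Finset.sum_congr rfl fun i _ => ?_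
    rw [mem_isotypic.mp (ha i), mem_isotypic.mp (hb i)]
    have h3 : char ![p i 0, p i 1, r i 2, r i 3] v =
        char (p i) ![v 0, v 1, 0, 0] * char (r i) ![0, 0, v 2, v 3] := by
      simp only [char, ← Complex.exp_add, Fin.sum_univ_four]
      congr 1
      simp
      ring
    rw [h3]
    ring
  -- Among these, the middle translation isolates the terms of inner degree zero. The last two
  -- entries are padding, since only two torus coordinates are involved.
  have h2 := coeff_eq {i | ![p i 0, p i 1, r i 2, r i 3] = n}
    (fun i => ![p i 2 + r i 0, p i 3 + r i 1, 0, 0]) (fun i => a i x * b i y) (n := 0)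
    (C := f (x * y)) (fun v => ?_)
  · rw [← h2, Finset.filter_filter]
    refine Finset.sum_congr (Finset.filter_congr fun i _ => ?_) fun _ _ => rfl
    simp only [Matched, funext_iff, Fin.forall_fin_succ]
    simp
    tauto
  · rw [char_zero_left, mul_one, ← act_mul_act_middle (v 0) (v 1) x y, ← h1]
    refine Finset.sum_congr rfl fun i _ => ?_
    rw [mem_isotypic.mp (ha i), mem_isotypic.mp (hb i)]
    have h3 : char ![p i 2 + r i 0, p i 3 + r i 1, 0, 0] v =
        char (p i) ![0, 0, v 0, v 1] * char (r i) ![v 0, v 1, 0, 0] := by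
      simp only [char, ← Complex.exp_add, Fin.sum_univ_four]
      congr 1
      simp
      ring
    rw [h3]
    ring

/-- Every finite expansion of `f(xy)` into functions in isotypic components computes the
coproduct. -/
theorem coprodHom_quantize (θ : ℝ) {n : Fin 4 → ℤ} {f : C(SU3, ℂ)} (hf : f ∈ isotypic n) {k : ℕ}
    (p r : Fin k → Fin 4 → ℤ) (a b : Fin k → C(SU3, ℂ)) (ha : ∀ i, a i ∈ isotypic (p i))
    (hb : ∀ i, b i ∈ isotypic (r i)) (h : ∀ x y, f (x * y) = ∑ i, a i x * b i y) :
    coprodHom θ (quantize θ n f) =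
      ∑ i, opTensor (quantize θ (p i) (a i)) (quantize θ (r i) (b i)) := by
  have h1 := sum_matched hf p r a b ha hb h
  -- The unmatched terms sum to zero as a function on the product group, hence also as operators.
  have h2 : ∑ i with ¬ Matched n (p i) (r i),
      opTensor (quantize θ (p i) (a i)) (quantize θ (r i) (b i)) = 0 := by
    refine sum_opTensor_eq_zero θ _ p r a b ha hb fun x y => ?_
    have h3 := Finset.sum_filter_add_sum_filter_not Finset.univ
      (fun i => Matched n (p i) (r i)) (fun i => a i x * b i y)
    rw [h1, h, add_eq_left] at h3
    exact h3
  rw [← Finset.sum_filter_add_sum_filter_not Finset.univ (fun i => Matched n (p i) (r i)), h2,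
    add_zero]
  refine IsCoproduct.coprodHom_eq ⟨hf, {i // Matched n (p i) (r i)}, inferInstance,
    fun i => p i, fun i => r i, fun i => a i, fun i => b i, fun i => ha i, fun i => hb i,
    fun i => i.2, fun x y => ?_, ?_⟩
  · rw [← h1]
    exact (Finset.sum_subtype _ (by simp) _)
  · exact (Finset.sum_subtype _ (by simp) _)

end MultiplicativeUnitary

/-! ### Graphs with a prescribed target algebra -/

section GraphTarget

variable {E F : Type*} [CStarAlgebra E] [CStarAlgebra F]

lemma graph_unique {G : StarSubalgebra ℂ (E × F)} (hG : ∀ p ∈ G, ‖p.2‖ ≤ ‖p.1‖)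
    {x : E} {y y' : F} (h : (x, y) ∈ G) (h' : (x, y') ∈ G) : y = y' := by
  have h1 := hG _ (sub_mem h h')
  simp only [Prod.mk_sub_mk, sub_self, norm_zero] at h1
  exact sub_eq_zero.mp (norm_le_zero_iff.mp h1)

theorem exists_starHom_of_graph_into (G : StarSubalgebra ℂ (E × F))
    (hGc : IsClosed (G : Set (E × F))) (hG : ∀ p ∈ G, ‖p.2‖ ≤ ‖p.1‖) (A : StarSubalgebra ℂ E)
    {s : Set E} (hA : A = (StarAlgebra.adjoin ℂ s).topologicalClosure) (B : StarSubalgebra ℂ F)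
    (hB : IsClosed (B : Set F)) (hs : ∀ x ∈ s, ∃ y ∈ B, (x, y) ∈ G) :
    ∃ φ : A →⋆ₐ[ℂ] B, ∀ x : A, ((x : E), (φ x : F)) ∈ G := by
  let sndHom : (E × F) →⋆ₐ[ℂ] F := StarAlgHom.snd ℂ E F
  obtain ⟨φ, hφ⟩ := exists_starHom_of_graph (G ⊓ B.comap sndHom)
    (hGc.inter (hB.preimage continuous_snd)) (fun p hp => hG p hp.1) A hA fun x hx => by
      obtain ⟨y, hy, h⟩ := hs x hx
      exact ⟨y, h, hy⟩
  exact ⟨φ.codRestrict B fun x => (hφ x).2, fun x => (hφ x).1⟩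

lemma continuous_starHom_of_isClosed {A : StarSubalgebra ℂ E} (hA : IsClosed (A : Set E))
    (φ : A →⋆ₐ[ℂ] F) : Continuous φ := by
  let _ : CStarAlgebra A := StarSubalgebra.cstarAlgebra A (h_closed := hA)
  exact continuous_starHom φ

end GraphTarget

/-! ### Reduction to the coordinate functions -/

section Generators

lemma map_coordAlgebra (θ : ℝ) : (coordAlgebra θ).map (CSU3 θ).subtype = coordOps θ := by
  rw [coordAlgebra, StarAlgHom.map_adjoin, coordOps]
  congr 1
  ext T
  constructor
  · rintro ⟨_, ⟨i, j, rfl⟩, rfl⟩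
    exact ⟨i, j, rfl⟩
  · rintro ⟨i, j, rfl⟩
    exact ⟨_, ⟨i, j, rfl⟩, rfl⟩

lemma mem_coordAlgebra_iff (θ : ℝ) (a : CSU3 θ) :
    a ∈ coordAlgebra θ ↔ (a : L2SU3 →L[ℂ] L2SU3) ∈ coordOps θ := by
  rw [← map_coordAlgebra]
  constructor
  · intro h
    exact ⟨a, h, rfl⟩
  · rintro ⟨b, hb, h⟩
    exact (Subtype.ext h : b = a) ▸ hb

lemma dense_coordAlgebra (θ : ℝ) : Dense (coordAlgebra θ : Set (CSU3 θ)) := by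
  intro a
  rw [closure_subtype]
  have h1 : (a : L2SU3 →L[ℂ] L2SU3) ∈ (coordOps θ).topologicalClosure := CSU3_eq θ ▸ a.2
  have h2 : (a : L2SU3 →L[ℂ] L2SU3) ∈ closure (coordOps θ : Set (L2SU3 →L[ℂ] L2SU3)) := h1
  rw [← map_coordAlgebra] at h2
  exact h2

/-- *-homomorphisms on `C(SU(3)_θ)` are determined by their values on the coordinate functions. -/
lemma starHom_ext (θ : ℝ) {F : Type*} [CStarAlgebra F] {φ ψ : CSU3 θ →⋆ₐ[ℂ] F}
    (h : ∀ i j, φ (u θ i j) = ψ (u θ i j)) : φ = ψ := by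
  have h1 : coordAlgebra θ ≤ StarAlgHom.equalizer φ ψ := by
    refine StarAlgebra.adjoin_le ?_
    rintro _ ⟨i, j, rfl⟩
    exact h i j
  refine DFunLike.coe_injective (Continuous.ext_on (dense_coordAlgebra θ) ?_ ?_ fun a ha => h1 ha)
  · exact continuous_starHom_of_isClosed (isClosed_CSU3 θ) φ
  · exact continuous_starHom_of_isClosed (isClosed_CSU3 θ) ψ

end Generators

/-! ### Unit vectors concentrating at the identity -/

section Concentration

open Filter Topology

/-- The distance of the trace of a matrix in `SU(3)` to `3`. -/
def traceDefect (g : SU3) : ℝ := ‖(g : Matrix (Fin 3) (Fin 3) ℂ).trace - 3‖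

lemma continuous_traceDefect : Continuous traceDefect :=
  ((continuous_subtype_val (p := fun A => A ∈ Matrix.specialUnitaryGroup (Fin 3) ℂ)).matrix_trace.sub
    continuous_const).norm

lemma traceDefect_one : traceDefect 1 = 0 := by
  simp [traceDefect, Matrix.trace_one]

-- For unitary g the trace of (g - 1)*(g - 1) equals 6 - 2 Re tr g, which vanishes when tr g = 3.
open scoped ComplexOrder in
lemma eq_one_of_traceDefect {g : SU3} (h : traceDefect g = 0) : g = 1 := by
  have h1 : (g : Matrix (Fin 3) (Fin 3) ℂ).trace = 3 := sub_eq_zero.mp (norm_eq_zero.mp h)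
  have h2 : (g : Matrix (Fin 3) (Fin 3) ℂ).conjTranspose * g = 1 :=
    Matrix.mem_unitaryGroup_iff'.mp g.2.1
  have h3 : (((g : Matrix (Fin 3) (Fin 3) ℂ) - 1).conjTranspose *
      ((g : Matrix (Fin 3) (Fin 3) ℂ) - 1)).trace = 0 := by
    rw [Matrix.conjTranspose_sub, Matrix.conjTranspose_one, sub_mul, mul_sub, mul_sub, h2, one_mul,
      mul_one, one_mul, Matrix.trace_sub, Matrix.trace_sub, Matrix.trace_sub, Matrix.trace_one,
      Matrix.trace_conjTranspose, h1]
    simp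
  have h4 := Matrix.trace_conjTranspose_mul_self_eq_zero_iff.mp h3
  exact Subtype.ext (sub_eq_zero.mp h4)

/-- These v act by conjugation with a torus element, and the trace is a class function. -/
lemma traceDefect_act {v : Fin 4 → ℝ} (h0 : v 2 = v 0) (h1 : v 3 = v 1) (g : SU3) :
    traceDefect (act v g) = traceDefect g := by
  have h2 : act v g = (torusElt (v 0) (v 1))⁻¹ * g * torusElt (v 0) (v 1) := by
    rw [act, h0, h1]
  rw [h2, traceDefect, traceDefect]
  generalize torusElt (v 0) (v 1) = t
  have h3 : ((t⁻¹ * g * t : SU3) : Matrix (Fin 3) (Fin 3) ℂ) =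
      (t⁻¹ : SU3) * (g : Matrix (Fin 3) (Fin 3) ℂ) * t := rfl
  have h4 : (t : Matrix (Fin 3) (Fin 3) ℂ) * (t⁻¹ : SU3) = 1 :=
    congrArg Subtype.val (mul_inv_cancel t)
  rw [h3, Matrix.trace_mul_comm, ← mul_assoc, h4, one_mul]

/-- A neighbourhood of the identity that is invariant under conjugation. -/
def nbhd (k : ℕ) : Set SU3 := {g | traceDefect g < 1 / (k + 1 : ℝ)}

lemma isOpen_nbhd (k : ℕ) : IsOpen (nbhd k) := isOpen_lt continuous_traceDefect continuous_const

/-- On the compact set where ‖φ‖ ≥ δ the identity is excluded, so the trace defect has a positive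
lower bound there and small neighbourhoods miss that set. -/
lemma eventually_norm_le {φ : C(SU3, ℂ)} (hφ : φ 1 = 0) {δ : ℝ} (hδ : 0 < δ) :
    ∀ᶠ k in atTop, ∀ g ∈ nbhd k, ‖φ g‖ ≤ δ := by
  have hc : IsCompact {g : SU3 | δ ≤ ‖φ g‖} :=
    (isClosed_le continuous_const φ.continuous.norm).isCompact
  have hpos : ∀ g ∈ {g : SU3 | δ ≤ ‖φ g‖}, 0 < traceDefect g := by
    intro g hg
    refine lt_of_le_of_ne (norm_nonneg _) fun h => ?_
    have h1 : δ ≤ ‖φ g‖ := hg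
    rw [eq_one_of_traceDefect h.symm, hφ, norm_zero] at h1
    exact absurd hδ (not_lt.mpr h1)
  obtain ⟨c, hc0, hc1⟩ := hc.exists_forall_le' continuous_traceDefect.continuousOn hpos
  obtain ⟨N, hN⟩ := exists_nat_one_div_lt hc0
  filter_upwards [eventually_ge_atTop N] with k hk g hg
  by_contra! h
  have h1 : c ≤ traceDefect g := hc1 g h.le
  have h2 : traceDefect g < 1 / (k + 1 : ℝ) := hg
  have h3 : (1 : ℝ) / (k + 1) ≤ 1 / (N + 1) := by
    apply one_div_le_one_div_of_le (by positivity)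
    exact_mod_cast Nat.succ_le_succ hk
  linarith

/-- The indicator function of `nbhd k` as a vector. -/
def bumpAux (k : ℕ) : L2SU3 :=
  indicatorConstLp 2 (isOpen_nbhd k).measurableSet (measure_ne_top haar _) (1 : ℂ)

lemma norm_bumpAux_pos (k : ℕ) : 0 < ‖bumpAux k‖ := by
  have h1 : 0 < haar (nbhd k) := (isOpen_nbhd k).measure_pos haar
    ⟨1, show traceDefect 1 < 1 / (k + 1 : ℝ) by rw [traceDefect_one]; positivity⟩
  rw [bumpAux, norm_indicatorConstLp (by simp) (by simp), norm_one, one_mul]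
  exact Real.rpow_pos_of_pos (ENNReal.toReal_pos h1.ne' (measure_ne_top haar _)) _

/-- Unit vectors that concentrate at the identity. -/
def bump (k : ℕ) : L2SU3 := ((‖bumpAux k‖⁻¹ : ℝ) : ℂ) • bumpAux k

lemma norm_bump (k : ℕ) : ‖bump k‖ = 1 := by
  rw [bump, norm_smul, Complex.norm_real, norm_inv, norm_norm,
    inv_mul_cancel₀ (norm_bumpAux_pos k).ne']

lemma norm_mulOp_bumpAux_le {φ : C(SU3, ℂ)} {k : ℕ} {δ : ℝ} (h : ∀ g ∈ nbhd k, ‖φ g‖ ≤ δ) :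
    ‖mulOp φ (bumpAux k)‖ ≤ δ * ‖bumpAux k‖ := by
  refine norm_mulOp_apply_le φ _ ?_
  filter_upwards [indicatorConstLp_coeFn_notMem (p := 2) (hs := (isOpen_nbhd k).measurableSet)
    (hμs := measure_ne_top haar _) (c := (1 : ℂ))] with x hx
  by_cases hxk : x ∈ nbhd k
  · rw [norm_mul]
    exact mul_le_mul_of_nonneg_right (h x hxk) (norm_nonneg _)
  · rw [bumpAux, hx hxk]
    simp

lemma tendsto_mulOp_bump {φ : C(SU3, ℂ)} (hφ : φ 1 = 0) :
    Tendsto (fun k => mulOp φ (bump k)) atTop (𝓝 0) := by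
  rw [Metric.tendsto_nhds]
  intro δ hδ
  filter_upwards [eventually_norm_le hφ (half_pos hδ)] with k hk
  rw [dist_zero_right, bump, map_smul, norm_smul, Complex.norm_real, norm_inv, norm_norm]
  have h1 := norm_mulOp_bumpAux_le hk
  have h2 := norm_bumpAux_pos k
  calc ‖bumpAux k‖⁻¹ * ‖mulOp φ (bumpAux k)‖ ≤ ‖bumpAux k‖⁻¹ * (δ / 2 * ‖bumpAux k‖) :=
        mul_le_mul_of_nonneg_left h1 (inv_nonneg.mpr h2.le)
    _ = δ / 2 := by field_simp
    _ < δ := half_lt_self hδ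

lemma translation_bump {v : Fin 4 → ℝ} (h0 : v 2 = v 0) (h1 : v 3 = v 1) (k : ℕ) :
    translation v (bump k) = bump k := by
  have h2 : translation v (bumpAux k) = bumpAux k := by
    apply Lp.ext
    refine (coeFn_translation v _).trans ?_
    have h3 : bumpAux k =ᵐ[haar] (nbhd k).indicator fun _ => (1 : ℂ) := indicatorConstLp_coeFn
    refine ((measurePreserving_act v).quasiMeasurePreserving.ae_eq_comp h3).trans
      (EventuallyEq.trans (Eventually.of_forall fun x => ?_) h3.symm)
    have h4 : act v x ∈ nbhd k ↔ x ∈ nbhd k := by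
      change traceDefect (act v x) < _ ↔ _
      rw [traceDefect_act h0 h1]
      rfl
    rw [Function.comp_apply]
    by_cases hx : x ∈ nbhd k
    · rw [Set.indicator_of_mem (h4.mpr hx), Set.indicator_of_mem hx]
    · rw [Set.indicator_of_notMem (mt h4.mp hx), Set.indicator_of_notMem hx]
  rw [bump, map_smul, h2]

/-- The identity is fixed by the diagonal torus, which acts on `f` through the character of degree
(n₀ + n₂, n₁ + n₃); if that is nontrivial, the value at the identity must vanish. -/
lemma apply_one_eq_zero {n : Fin 4 → ℤ} {f : C(SU3, ℂ)} (hf : f ∈ isotypic n)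
    (h : ¬ (n 0 + n 2 = 0 ∧ n 1 + n 3 = 0)) : f 1 = 0 := by
  have h1 : ∀ v : Fin 4 → ℝ, f 1 * char ![n 0 + n 2, n 1 + n 3, 0, 0] v = f 1 * char 0 v := by
    intro v
    have h2 := mem_isotypic.mp hf ![v 0, v 1, v 0, v 1] 1
    have h3 : act ![v 0, v 1, v 0, v 1] 1 = 1 := by
      change (torusElt (v 0) (v 1))⁻¹ * 1 * torusElt (v 0) (v 1) = 1
      rw [mul_one, inv_mul_cancel]
    have h4 : char n ![v 0, v 1, v 0, v 1] = char ![n 0 + n 2, n 1 + n 3, 0, 0] v := by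
      simp only [char, Fin.sum_univ_four]
      congr 1
      simp
      ring
    rw [h3, h4] at h2
    rw [char_zero_left, mul_one, mul_comm]
    exact h2.symm
  have h5 := coeff_eq {()} (fun _ => ![n 0 + n 2, n 1 + n 3, 0, 0]) (fun _ => f 1) (n := 0)
    (C := f 1) (fun v => by simpa using h1 v)
  have h6 : ![n 0 + n 2, n 1 + n 3, 0, 0] ≠ 0 := by
    intro h7
    exact h ⟨congrFun h7 0, congrFun h7 1⟩
  rw [Finset.sum_filter, Finset.sum_singleton, if_neg h6] at h5
  exact h5.symm

/-- `f` is invariant under its own shift. With the translation on the left, norms depend on the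
multiplication alone. -/
lemma quantize_eq_translation_comp (θ : ℝ) {n : Fin 4 → ℤ} {f : C(SU3, ℂ)} (hf : f ∈ isotypic n) :
    quantize θ n f = translation (shift θ n) ∘L mulOp f := by
  refine ext_vec fun g => ?_
  rw [quantize_vec, ContinuousLinearMap.comp_apply, mulOp_vec, translation_vec]
  congr 1
  ext x
  have h := mem_isotypic.mp hf (shift θ n) x
  rw [char_shift_self, one_mul] at h
  simp [h]

lemma norm_translation_apply (v : Fin 4 → ℝ) (ξ : L2SU3) : ‖translation v ξ‖ = ‖ξ‖ :=
  LinearIsometry.norm_map (Lp.compMeasurePreservingₗᵢ ℂ (act v) (measurePreserving_act v)) ξ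

/-- The unit vectors concentrating at the identity are approximate eigenvectors. -/
theorem tendsto_quantize_bump (θ : ℝ) {n : Fin 4 → ℤ} {f : C(SU3, ℂ)} (hf : f ∈ isotypic n) :
    Tendsto (fun k => quantize θ n f (bump k) - f 1 • bump k) atTop (𝓝 0) := by
  -- In the first case the shift of n is diagonal, so it fixes the conjugation-invariant vectors; in
  -- the second f(e) = 0 and the translation is irrelevant for the norm.
  by_cases h : n 0 + n 2 = 0 ∧ n 1 + n 3 = 0
  · have h1 : Tendsto (fun k => mulOp (f - f 1 • (1 : C(SU3, ℂ))) (bump k)) atTop (𝓝 0) :=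
      tendsto_mulOp_bump (by simp)
    refine h1.congr fun k => ?_
    have h2 : translation (shift θ n) (bump k) = bump k := by
      refine translation_bump ?_ ?_ k
      · rw [shift_eq]
        simp [show n 3 = - n 1 by omega]
      · rw [shift_eq]
        simp [show n 2 = - n 0 by omega]
    have h3 : mulOp (1 : C(SU3, ℂ)) = 1 := ext_vec fun g => by
      rw [mulOp_vec, one_mul, one_apply_eq_self]
    change _ = mulOp f (translation (shift θ n) (bump k)) - _
    rw [h2, sub_eq_add_neg, ← neg_smul, mulOp_add, mulOp_smul, h3, _root_.add_apply,
      _root_.smul_apply, one_apply_eq_self, neg_smul, sub_eq_add_neg]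
  · have h1 := apply_one_eq_zero hf h
    rw [h1]
    have h2 := (tendsto_zero_iff_norm_tendsto_zero.mp (tendsto_mulOp_bump h1))
    rw [tendsto_zero_iff_norm_tendsto_zero]
    refine h2.congr fun k => ?_
    rw [zero_smul, sub_zero, quantize_eq_translation_comp θ hf, ContinuousLinearMap.comp_apply,
      norm_translation_apply]

end Concentration

/-! ### The counit and its slice maps -/

section Counit

open Filter Topology

/-- Evaluation at `1` of operators on `ℂ`. -/
def evalOne : (ℂ →L[ℂ] ℂ) →⋆ₐ[ℂ] ℂ where
  toFun T := T 1
  map_one' := rfl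
  map_mul' S T := by
    have h : T 1 = T 1 • (1 : ℂ) := by simp
    rw [mul_apply_eq_comp, h, map_smul, smul_eq_mul, mul_comm]
    simp
  map_zero' := rfl
  map_add' S T := rfl
  commutes' c := by simp [Algebra.algebraMap_eq_smul_one]
  map_star' T := by
    have h := ContinuousLinearMap.adjoint_inner_right T (1 : ℂ) (1 : ℂ)
    simpa [ContinuousLinearMap.star_eq_adjoint] using h

/-- The counit, as a limit of vector states. -/
theorem exists_counit (θ : ℝ) : ∃ ε : CSU3 θ →⋆ₐ[ℂ] ℂ,
    (∀ a : CSU3 θ, Tendsto (fun k => (a : L2SU3 →L[ℂ] L2SU3) (bump k) - ε a • bump k) atTop (𝓝 0)) ∧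
    ∀ (n : Fin 4 → ℤ) (f : isotypic n), ε (elt θ f) = (f : C(SU3, ℂ)) 1 := by
  -- Being an approximate eigenvector with eigenvalue f(e) means exactly that the isometries z ↦ z ·
  -- bump_k asymptotically intertwine L_f with the scalar f(e).
  let V : ℕ → ℂ →L[ℂ] L2SU3 := fun k => ContinuousLinearMap.toSpanSingleton ℂ (bump k)
  have hV : ∀ k x, ‖V k x‖ = ‖x‖ := fun k x => by
    simp [V, norm_smul, norm_bump]
  have hG : ∀ p ∈ asympGraph V, ‖p.2‖ ≤ ‖p.1‖ := fun p hp => norm_le_of_mem_asympSet hV hp.1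
  have hmem : ∀ (n : Fin 4 → ℤ), ∀ f ∈ isotypic n,
      (quantize θ n f, f 1 • (1 : ℂ →L[ℂ] ℂ)) ∈ asympSet V := by
    intro n f hf
    have h1 := tendsto_quantize_bump θ hf
    have h2 := ((ContinuousLinearMap.toSpanSingletonCLE (𝕜 := ℂ) (E := L2SU3)).continuous.tendsto
      0).comp h1
    rw [map_zero] at h2
    refine h2.congr fun k => ?_
    ext
    simp [V]
  have hmem' : ∀ (n : Fin 4 → ℤ), ∀ f ∈ isotypic n,
      (quantize θ n f, f 1 • (1 : ℂ →L[ℂ] ℂ)) ∈ asympGraph V := by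
    intro n f hf
    refine mem_asympGraph.mpr ⟨hmem n f hf, ?_⟩
    have h1 := hmem _ _ (star_mem_isotypic hf)
    have h2 : star (quantize θ n f, f 1 • (1 : ℂ →L[ℂ] ℂ)) =
        (quantize θ (-n) (star f), (star f) 1 • (1 : ℂ →L[ℂ] ℂ)) := by
      refine Prod.ext (star_quantize θ hf) ?_
      simp [star_smul]
    rw [h2]
    exact h1
  obtain ⟨φ, hφ⟩ := exists_starHom_of_graph (asympGraph V) (isClosed_asympGraph hV) hG (CSU3 θ) rfl
    (by rintro _ ⟨n, f, hf, rfl⟩; exact ⟨_, hmem' n f hf⟩)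
  refine ⟨evalOne.comp φ, fun a => ?_, fun n f => ?_⟩
  · have h1 : Tendsto (fun k => (a : L2SU3 →L[ℂ] L2SU3) ∘L V k - V k ∘L φ a) atTop (𝓝 0) :=
      (hφ a).1
    have h2 := ((ContinuousLinearMap.apply ℂ L2SU3 (1 : ℂ)).continuous.tendsto 0).comp h1
    rw [map_zero] at h2
    refine h2.congr fun k => ?_
    simp only [V, Function.comp_apply, ContinuousLinearMap.apply_apply, _root_.sub_apply,
      ContinuousLinearMap.comp_apply, ContinuousLinearMap.toSpanSingleton_apply, one_smul]
    rfl
  · have h1 := graph_unique hG (hφ (elt θ f)) (hmem' n f f.2)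
    change φ (elt θ f) 1 = _
    rw [h1]
    simp

/-- The counit. -/
def counit (θ : ℝ) : CSU3 θ →⋆ₐ[ℂ] ℂ := (exists_counit θ).choose

lemma tendsto_counit (θ : ℝ) (a : CSU3 θ) :
    Tendsto (fun k => (a : L2SU3 →L[ℂ] L2SU3) (bump k) - counit θ a • bump k) atTop (𝓝 0) :=
  (exists_counit θ).choose_spec.1 a

lemma counit_elt (θ : ℝ) (n : Fin 4 → ℤ) (f : isotypic n) :
    counit θ (elt θ f) = (f : C(SU3, ℂ)) 1 :=
  (exists_counit θ).choose_spec.2 n f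

lemma counit_u (θ : ℝ) (i j : Fin 3) : counit θ (u θ i j) = if i = j then 1 else 0 := by
  rw [u, counit_elt]
  exact Matrix.one_apply

/-- The slice map `ε ⊗ id`. -/
theorem exists_sliceLeft (θ : ℝ) : ∃ E : spatialTensor (CSU3 θ) (CSU3 θ) →⋆ₐ[ℂ] CSU3 θ,
    ∀ a b : CSU3 θ, E (tmulSpatial a b) = counit θ a • b := by
  -- Fixing the first leg at the concentrating vectors replaces a ⊗ b by ε(a) b in the limit.
  let V : ℕ → L2SU3 →L[ℂ] HilbertTensor L2SU3 L2SU3 := fun k => pt (bump k)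
  have hV : ∀ k x, ‖V k x‖ = ‖x‖ := fun k x => by simp [V, norm_bump]
  have hG : ∀ p ∈ asympGraph V, ‖p.2‖ ≤ ‖p.1‖ := fun p hp => norm_le_of_mem_asympSet hV hp.1
  have hmem : ∀ a b : CSU3 θ, (opTensor (a : L2SU3 →L[ℂ] L2SU3) (b : L2SU3 →L[ℂ] L2SU3),
      counit θ a • (b : L2SU3 →L[ℂ] L2SU3)) ∈ asympSet V := by
    intro a b
    have h1 := ((pt (H := L2SU3) (K := L2SU3)).continuous.tendsto 0).comp (tendsto_counit θ a)
    have h2 := (((ContinuousLinearMap.compL ℂ L2SU3 L2SU3 (HilbertTensor L2SU3 L2SU3)).flip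
      (b : L2SU3 →L[ℂ] L2SU3)).continuous.tendsto _).comp h1
    rw [map_zero, map_zero] at h2
    refine h2.congr fun k => ?_
    ext1 η
    simp [V]
  have hmem' : ∀ a b : CSU3 θ, (opTensor (a : L2SU3 →L[ℂ] L2SU3) (b : L2SU3 →L[ℂ] L2SU3),
      counit θ a • (b : L2SU3 →L[ℂ] L2SU3)) ∈ asympGraph V := by
    intro a b
    refine mem_asympGraph.mpr ⟨hmem a b, ?_⟩
    convert! hmem (star a) (star b) using 1
    refine Prod.ext (star_opTensor _ _) ?_
    rw [map_star]
    exact star_smul _ _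
  obtain ⟨φ, hφ⟩ := exists_starHom_of_graph_into (asympGraph V) (isClosed_asympGraph hV) hG
    (spatialTensor (CSU3 θ) (CSU3 θ)) rfl (CSU3 θ) (isClosed_CSU3 θ)
    (by
      rintro _ ⟨a, ha, b, hb, rfl⟩
      exact ⟨_, (CSU3 θ).smul_mem hb _, hmem' ⟨a, ha⟩ ⟨b, hb⟩⟩)
  exact ⟨φ, fun a b => Subtype.ext (graph_unique hG (hφ (tmulSpatial a b)) (hmem' a b))⟩

/-- The slice map `id ⊗ ε`. -/
theorem exists_sliceRight (θ : ℝ) : ∃ E : spatialTensor (CSU3 θ) (CSU3 θ) →⋆ₐ[ℂ] CSU3 θ,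
    ∀ a b : CSU3 θ, E (tmulSpatial a b) = counit θ b • a := by
  let V : ℕ → L2SU3 →L[ℂ] HilbertTensor L2SU3 L2SU3 := fun k => pt.flip (bump k)
  have hV : ∀ k x, ‖V k x‖ = ‖x‖ := fun k x => by simp [V, norm_bump]
  have hG : ∀ p ∈ asympGraph V, ‖p.2‖ ≤ ‖p.1‖ := fun p hp => norm_le_of_mem_asympSet hV hp.1
  have hmem : ∀ a b : CSU3 θ, (opTensor (a : L2SU3 →L[ℂ] L2SU3) (b : L2SU3 →L[ℂ] L2SU3),
      counit θ b • (a : L2SU3 →L[ℂ] L2SU3)) ∈ asympSet V := by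
    intro a b
    have h1 := ((pt (H := L2SU3) (K := L2SU3)).flip.continuous.tendsto 0).comp (tendsto_counit θ b)
    have h2 := (((ContinuousLinearMap.compL ℂ L2SU3 L2SU3 (HilbertTensor L2SU3 L2SU3)).flip
      (a : L2SU3 →L[ℂ] L2SU3)).continuous.tendsto _).comp h1
    rw [map_zero, map_zero] at h2
    refine h2.congr fun k => ?_
    ext1 η
    simp [V]
  have hmem' : ∀ a b : CSU3 θ, (opTensor (a : L2SU3 →L[ℂ] L2SU3) (b : L2SU3 →L[ℂ] L2SU3),
      counit θ b • (a : L2SU3 →L[ℂ] L2SU3)) ∈ asympGraph V := by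
    intro a b
    refine mem_asympGraph.mpr ⟨hmem a b, ?_⟩
    convert! hmem (star a) (star b) using 1
    refine Prod.ext (star_opTensor _ _) ?_
    rw [map_star]
    exact star_smul _ _
  obtain ⟨φ, hφ⟩ := exists_starHom_of_graph_into (asympGraph V) (isClosed_asympGraph hV) hG
    (spatialTensor (CSU3 θ) (CSU3 θ)) rfl (CSU3 θ) (isClosed_CSU3 θ)
    (by
      rintro _ ⟨a, ha, b, hb, rfl⟩
      exact ⟨_, (CSU3 θ).smul_mem ha _, hmem' ⟨a, ha⟩ ⟨b, hb⟩⟩)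
  exact ⟨φ, fun a b => Subtype.ext (graph_unique hG (hφ (tmulSpatial a b)) (hmem' a b))⟩

end Counit

/-! ### The antiunitary involution given by inversion -/

section Conjugation

/-- Uniqueness of the Haar probability measure: its right translates are again left-invariant
probability measures. -/
instance : haar.IsMulRightInvariant where
  map_mul_right_eq_self g := by
    have : IsProbabilityMeasure (Measure.map (fun x => x * g) haar) :=
      Measure.isProbabilityMeasure_map (continuous_mul_const g).measurable.aemeasurable
    exact Measure.isHaarMeasure_eq_of_isProbabilityMeasure _ _

instance : haar.IsInvInvariant where
  inv_eq_self := by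
    have : IsProbabilityMeasure haar.inv :=
      Measure.isProbabilityMeasure_map continuous_inv.measurable.aemeasurable
    have : haar.inv.IsHaarMeasure := {}
    exact Measure.isHaarMeasure_eq_of_isProbabilityMeasure _ _

lemma integral_comp_inv (f : SU3 → ℂ) : ∫ x, f x⁻¹ ∂haar = ∫ x, f x ∂haar :=
  integral_inv_eq_self f haar

/-- The function `x ↦ conj (f (x⁻¹))`. -/
def sharp (f : C(SU3, ℂ)) : C(SU3, ℂ) := star (f.comp ⟨fun g => g⁻¹, continuous_inv⟩)

@[simp] lemma sharp_apply (f : C(SU3, ℂ)) (x : SU3) : sharp f x = star (f x⁻¹) := rfl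

lemma sharp_sharp (f : C(SU3, ℂ)) : sharp (sharp f) = f := by
  ext x
  rw [sharp_apply, sharp_apply, inv_inv, star_star]

/-- Invariance of Haar measure under inversion. This symmetry is what makes `conjInv` antiunitary.
-/
lemma inner_vec_sharp (f g : C(SU3, ℂ)) :
    inner ℂ (vec (sharp f)) (vec g) = inner ℂ (vec (sharp g)) (vec f) := by
  rw [inner_vec, inner_vec, ← integral_comp_inv]
  congr 1
  ext x
  simp only [sharp_apply, star_star, inv_inv]
  exact mul_comm _ _

lemma norm_vec_sharp (f : C(SU3, ℂ)) : ‖vec (sharp f)‖ = ‖vec f‖ := by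
  have h : inner ℂ (vec (sharp f)) (vec (sharp f)) = inner ℂ (vec f) (vec f) := by
    rw [inner_vec_sharp, sharp_sharp]
  rw [inner_self_eq_norm_sq_to_K, inner_self_eq_norm_sq_to_K] at h
  have h1 : ‖vec (sharp f)‖ ^ 2 = ‖vec f‖ ^ 2 := by exact_mod_cast h
  exact (sq_eq_sq₀ (norm_nonneg _) (norm_nonneg _)).mp h1

/-- The map `f ↦ conj (f (·⁻¹))` into `L²(SU(3))`. -/
def vecSharp : C(SU3, ℂ) →ₛₗ[starRingEnd ℂ] L2SU3 where
  toFun f := vec (sharp f)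
  map_add' f g := by
    rw [← map_add]
    congr 1
    ext x
    simp
  map_smul' c f := by
    rw [← map_smul]
    congr 1
    ext x
    simp

/-- The antiunitary involution `ξ ↦ conj (ξ (·⁻¹))` of `L²(SU(3))`. -/
def conjInv : L2SU3 →SL[starRingEnd ℂ] L2SU3 := vecSharp.extendOfNorm vec.toLinearMap

@[simp] lemma conjInv_vec (f : C(SU3, ℂ)) : conjInv (vec f) = vec (sharp f) :=
  LinearMap.extendOfNorm_eq (f := vecSharp) (e := vec.toLinearMap) denseRange_vec
    ⟨1, fun f => by rw [one_mul]; exact (norm_vec_sharp f).le⟩ f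

@[simp] lemma conjInv_conjInv (ξ : L2SU3) : conjInv (conjInv ξ) = ξ := by
  refine denseRange_vec.induction_on ξ (isClosed_eq ?_ continuous_id) fun f => ?_
  · exact conjInv.continuous.comp conjInv.continuous
  · rw [conjInv_vec, conjInv_vec, sharp_sharp]

lemma inner_conjInv_left (ξ η : L2SU3) : inner ℂ (conjInv ξ) η = inner ℂ (conjInv η) ξ := by
  refine denseRange_vec.induction_on₂ (p := fun ξ η => inner ℂ (conjInv ξ) η = inner ℂ (conjInv η) ξ)
    (isClosed_eq ?_ ?_) (fun f g => ?_) ξ η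
  · exact (conjInv.continuous.comp continuous_fst).inner continuous_snd
  · exact (conjInv.continuous.comp continuous_snd).inner continuous_fst
  · rw [conjInv_vec, conjInv_vec, inner_vec_sharp]

lemma inner_conjInv_right (ξ η : L2SU3) : inner ℂ ξ (conjInv η) = inner ℂ η (conjInv ξ) := by
  rw [← inner_conj_symm, inner_conjInv_left, inner_conj_symm]

lemma norm_conjInv (ξ : L2SU3) : ‖conjInv ξ‖ = ‖ξ‖ := by
  have h : inner ℂ (conjInv ξ) (conjInv ξ) = inner ℂ ξ ξ := by
    rw [inner_conjInv_left, conjInv_conjInv]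
  rw [inner_self_eq_norm_sq_to_K, inner_self_eq_norm_sq_to_K] at h
  have h1 : ‖conjInv ξ‖ ^ 2 = ‖ξ‖ ^ 2 := by exact_mod_cast h
  exact (sq_eq_sq₀ (norm_nonneg _) (norm_nonneg _)).mp h1

end Conjugation

/-! ### The antipode as an antiautomorphism of bounded operators -/

section Antipode

/-- The antiautomorphism `T ↦ Ĵ T* Ĵ` of the bounded operators, where `Ĵ` is `conjInv`. -/
def antipodeOp : (L2SU3 →L[ℂ] L2SU3) →L[ℂ] (L2SU3 →L[ℂ] L2SU3) :=
  LinearMap.mkContinuous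
    { toFun := fun T => conjInv.comp ((star T).comp conjInv)
      map_add' := fun S T => by
        ext1 ξ
        simp only [star_add, ContinuousLinearMap.comp_apply, _root_.add_apply, map_add]
      map_smul' := fun c T => by
        ext1 ξ
        simp only [star_smul, ContinuousLinearMap.comp_apply, _root_.smul_apply,
          ContinuousLinearMap.map_smulₛₗ, RingHom.id_apply, starRingEnd_apply, star_star] }
    1 fun T => by
      refine ContinuousLinearMap.opNorm_le_bound _ (by positivity) fun ξ => ?_
      change ‖conjInv (star T (conjInv ξ))‖ ≤ _
      rw [norm_conjInv, one_mul, ← norm_star T, ← norm_conjInv ξ]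
      exact ContinuousLinearMap.le_opNorm _ _

lemma antipodeOp_apply (T : L2SU3 →L[ℂ] L2SU3) (ξ : L2SU3) :
    antipodeOp T ξ = conjInv (star T (conjInv ξ)) := rfl

lemma antipodeOp_one : antipodeOp 1 = 1 := by
  ext1 ξ
  rw [antipodeOp_apply, star_one, one_apply_eq_self, one_apply_eq_self, conjInv_conjInv]

lemma antipodeOp_mul (S T : L2SU3 →L[ℂ] L2SU3) :
    antipodeOp (S * T) = antipodeOp T * antipodeOp S := by
  ext1 ξ
  rw [mul_apply_eq_comp, antipodeOp_apply, antipodeOp_apply, antipodeOp_apply, star_mul,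
    mul_apply_eq_comp, conjInv_conjInv]

lemma star_antipodeOp (T : L2SU3 →L[ℂ] L2SU3) : star (antipodeOp T) = antipodeOp (star T) := by
  ext1 η
  refine ext_inner_left ℂ fun ξ => ?_
  rw [ContinuousLinearMap.star_eq_adjoint, ContinuousLinearMap.adjoint_inner_right,
    antipodeOp_apply, antipodeOp_apply, star_star, inner_conjInv_left,
    ContinuousLinearMap.star_eq_adjoint, ContinuousLinearMap.adjoint_inner_right,
    inner_conjInv_right]

lemma antipodeOp_antipodeOp (T : L2SU3 →L[ℂ] L2SU3) : antipodeOp (antipodeOp T) = T := by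
  ext1 ξ
  rw [antipodeOp_apply, star_antipodeOp, antipodeOp_apply, star_star, conjInv_conjInv,
    conjInv_conjInv]

/-- The exchange of the two factors of `𝕋² × 𝕋²`. -/
def swapDeg {R : Type*} (n : Fin 4 → R) : Fin 4 → R := ![n 2, n 3, n 0, n 1]

lemma inv_act (v : Fin 4 → ℝ) (g : SU3) : (act v g)⁻¹ = act (swapDeg v) g⁻¹ := by
  change ((torusElt (v 0) (v 1))⁻¹ * g * torusElt (v 2) (v 3))⁻¹ =
    (torusElt (v 2) (v 3))⁻¹ * g⁻¹ * torusElt (v 0) (v 1)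
  generalize torusElt (v 0) (v 1) = s
  generalize torusElt (v 2) (v 3) = t
  rw [mul_inv_rev, mul_inv_rev, inv_inv, mul_assoc]

/-- The two blocks of J are negatives of each other, so exchanging them changes the sign of J and
compensates the sign of the degree. -/
lemma swapDeg_shift_neg (θ : ℝ) (n : Fin 4 → ℤ) : swapDeg (shift θ (-n)) = shift θ (swapDeg n) := by
  rw [shift_eq, shift_eq]
  ext k
  fin_cases k <;> simp [swapDeg]

lemma comp_inv_mem_isotypic {n : Fin 4 → ℤ} {f : C(SU3, ℂ)} (hf : f ∈ isotypic n) :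
    f.comp ⟨fun g => g⁻¹, continuous_inv⟩ ∈ isotypic (swapDeg n) := by
  rw [mem_isotypic]
  intro v g
  change f (act v g)⁻¹ = _ * f g⁻¹
  rw [inv_act, mem_isotypic.mp hf]
  congr 1
  simp only [char, swapDeg, Fin.sum_univ_four]
  congr 1
  simp
  ring

/-- The adjoint conjugates `f` and negates its degree; the involution undoes the conjugation,
inverts the argument and swaps the blocks, which turns the shift of -n into that of the swapped
degree. -/
lemma antipodeOp_quantize (θ : ℝ) {n : Fin 4 → ℤ} {f : C(SU3, ℂ)} (hf : f ∈ isotypic n) :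
    antipodeOp (quantize θ n f) =
      quantize θ (swapDeg n) (f.comp ⟨fun g => g⁻¹, continuous_inv⟩) := by
  refine ext_vec fun g => ?_
  rw [antipodeOp_apply, star_quantize θ hf, conjInv_vec, quantize_vec, conjInv_vec, quantize_vec]
  congr 1
  ext x
  simp only [sharp_apply, ContinuousMap.mul_apply, ContinuousMap.comp_apply, ContinuousMap.coe_mk,
    ContinuousMap.star_apply, star_mul', star_star]
  rw [inv_act, inv_inv, swapDeg_shift_neg]

/-- In a unitary matrix the (i,j) entry of the inverse is the conjugate of the (j,i) entry, and the
degrees agree as well. -/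
lemma antipodeOp_U (θ : ℝ) (i j : Fin 3) : antipodeOp (U θ i j) = star (U θ j i) := by
  have h1 : swapDeg (deg i j) = - deg j i := by
    revert i j
    decide
  change antipodeOp (quantize θ (deg i j) (coord i j)) = star (quantize θ (deg j i) (coord j i))
  rw [antipodeOp_quantize θ (coord_mem i j), star_quantize θ (coord_mem j i), h1]
  rfl

/-- The operators that `antipodeOp` maps into a given *-subalgebra. -/
def antipodeComap (B : StarSubalgebra ℂ (L2SU3 →L[ℂ] L2SU3)) :
    StarSubalgebra ℂ (L2SU3 →L[ℂ] L2SU3) where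
  carrier := {T | antipodeOp T ∈ B}
  mul_mem' {S T} hS hT := by
    change antipodeOp (S * T) ∈ B
    rw [antipodeOp_mul]
    exact mul_mem hT hS
  add_mem' {S T} hS hT := by
    change antipodeOp (S + T) ∈ B
    rw [map_add]
    exact add_mem hS hT
  algebraMap_mem' c := by
    change antipodeOp (algebraMap ℂ (L2SU3 →L[ℂ] L2SU3) c) ∈ B
    rw [Algebra.algebraMap_eq_smul_one, map_smul, antipodeOp_one]
    exact B.smul_mem (one_mem B) c
  star_mem' {T} hT := by
    change antipodeOp (star T) ∈ B
    rw [← star_antipodeOp]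
    exact star_mem hT

lemma antipodeOp_mem (θ : ℝ) {T : L2SU3 →L[ℂ] L2SU3} (hT : T ∈ CSU3 θ) : antipodeOp T ∈ CSU3 θ := by
  have h : CSU3 θ ≤ antipodeComap (CSU3 θ) := by
    refine closure_adjoin_le ((isClosed_CSU3 θ).preimage antipodeOp.continuous) ?_
    rintro _ ⟨n, f, hf, rfl⟩
    change antipodeOp _ ∈ CSU3 θ
    rw [antipodeOp_quantize θ hf]
    exact quantize_mem_CSU3 θ (comp_inv_mem_isotypic hf)
  exact h hT

lemma antipodeOp_mem_coordOps (θ : ℝ) {T : L2SU3 →L[ℂ] L2SU3} (hT : T ∈ coordOps θ) :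
    antipodeOp T ∈ coordOps θ := by
  have h : coordOps θ ≤ antipodeComap (coordOps θ) := by
    refine StarAlgebra.adjoin_le ?_
    rintro _ ⟨i, j, rfl⟩
    change antipodeOp (U θ i j) ∈ coordOps θ
    rw [antipodeOp_U]
    exact star_U_mem θ j i
  exact h hT

/-- The antipode of `C(SU(3)_θ)`. -/
def antipode (θ : ℝ) : CSU3 θ →L[ℂ] CSU3 θ where
  toFun a := ⟨antipodeOp a, antipodeOp_mem θ a.2⟩
  map_add' _ _ := Subtype.ext (map_add antipodeOp _ _)
  map_smul' _ _ := Subtype.ext (map_smul antipodeOp _ _)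
  cont := (antipodeOp.continuous.comp continuous_subtype_val).subtype_mk _

lemma antipode_u (θ : ℝ) (i j : Fin 3) : antipode θ (u θ i j) = star (u θ j i) :=
  Subtype.ext (antipodeOp_U θ i j)

end Antipode

/-! ### Amplified unitaries and rebracketing -/

section Amplification

variable {H K L : Type*}
  [NormedAddCommGroup H] [InnerProductSpace ℂ H] [CompleteSpace H]
  [NormedAddCommGroup K] [InnerProductSpace ℂ K] [CompleteSpace K]
  [NormedAddCommGroup L] [InnerProductSpace ℂ L] [CompleteSpace L]

/-- Conjugation by a unitary operator. -/
def conjUnitary (w : unitary (H →L[ℂ] H)) : (H →L[ℂ] H) →⋆ₐ[ℂ] (H →L[ℂ] H) :=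
  StarAlgHomClass.toStarAlgHom (Unitary.conjStarAlgAut ℂ (H →L[ℂ] H) w)

lemma conjUnitary_symm (V : H ≃ₗᵢ[ℂ] H) :
    conjUnitary (Unitary.linearIsometryEquiv.symm V) = conjHom V :=
  StarAlgHom.ext fun T =>
    DFunLike.congr_fun (Unitary.conjStarAlgAut_symm_unitaryLinearIsometryEquiv V) T

/-- The unitary `w ⊗ 1`. -/
def unitaryLeft (w : unitary (H →L[ℂ] H)) :
    unitary (HilbertTensor H K →L[ℂ] HilbertTensor H K) :=
  ⟨ampLeft (w : H →L[ℂ] H), Unitary.map_mem ampLeft w.2⟩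

/-- The unitary `1 ⊗ w`. -/
def unitaryRight (w : unitary (K →L[ℂ] K)) :
    unitary (HilbertTensor H K →L[ℂ] HilbertTensor H K) :=
  ⟨ampRight (w : K →L[ℂ] K), Unitary.map_mem ampRight w.2⟩

lemma conjUnitary_unitaryLeft (w : unitary (H →L[ℂ] H)) (S : H →L[ℂ] H) (T : K →L[ℂ] K) :
    conjUnitary (unitaryLeft w) (opTensor S T) = opTensor (conjUnitary w S) T := by
  change opTensor (w : H →L[ℂ] H) 1 * opTensor S T * star (opTensor (w : H →L[ℂ] H) 1) = _
  rw [star_opTensor, ← opTensor_mul, ← opTensor_mul, star_one, one_mul, mul_one]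
  rfl

lemma conjUnitary_unitaryRight (w : unitary (K →L[ℂ] K)) (S : H →L[ℂ] H) (T : K →L[ℂ] K) :
    conjUnitary (unitaryRight w) (opTensor S T) = opTensor S (conjUnitary w T) := by
  change opTensor 1 (w : K →L[ℂ] K) * opTensor S T * star (opTensor 1 (w : K →L[ℂ] K)) = _
  rw [star_opTensor, ← opTensor_mul, ← opTensor_mul, star_one, one_mul, mul_one]
  rfl

/-- The rebracketing unitary. -/
def assocEquiv : HilbertTensor (HilbertTensor H K) L ≃ₗᵢ[ℂ] HilbertTensor H (HilbertTensor K L) :=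
  exists_assoc.choose

@[simp] lemma assocEquiv_pt (x : H) (y : K) (z : L) :
    assocEquiv (pt (pt x y) z) = pt x (pt y z) := exists_assoc.choose_spec x y z

@[simp] lemma assocEquiv_symm_pt (x : H) (y : K) (z : L) :
    assocEquiv.symm (pt x (pt y z)) = pt (pt x y) z := by
  rw [← assocEquiv_pt, LinearIsometryEquiv.symm_apply_apply]

/-- The flip unitary. -/
def flipEquiv : HilbertTensor H K ≃ₗᵢ[ℂ] HilbertTensor K H := exists_flip.choose

@[simp] lemma flipEquiv_pt (x : H) (y : K) : flipEquiv (pt x y) = pt y x :=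
  exists_flip.choose_spec x y

@[simp] lemma flipEquiv_symm_pt (x : H) (y : K) : flipEquiv.symm (pt y x) = pt x y := by
  rw [← flipEquiv_pt, LinearIsometryEquiv.symm_apply_apply]

lemma conjHom_assocEquiv (R : H →L[ℂ] H) (S : K →L[ℂ] K) (T : L →L[ℂ] L) :
    conjHom assocEquiv (opTensor (opTensor R S) T) = opTensor R (opTensor S T) :=
  ext_pt_right fun x y z => by simp [conjHom_apply]

lemma conjHom_assocEquiv_symm (R : H →L[ℂ] H) (S : K →L[ℂ] K) (T : L →L[ℂ] L) :
    conjHom assocEquiv.symm (opTensor R (opTensor S T)) = opTensor (opTensor R S) T :=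
  ext_pt_left fun x y z => by simp [conjHom_apply]

lemma conjHom_flipEquiv (S : H →L[ℂ] H) (T : K →L[ℂ] K) :
    conjHom flipEquiv (opTensor S T) = opTensor T S :=
  ext_pt' fun x y => by simp [conjHom_apply]

/-- Rebracketing of spatial tensor products. -/
lemma conjHom_assocEquiv_mem {A : StarSubalgebra ℂ (H →L[ℂ] H)} {B : StarSubalgebra ℂ (K →L[ℂ] K)}
    {C : StarSubalgebra ℂ (L →L[ℂ] L)}
    {X : HilbertTensor (HilbertTensor H K) L →L[ℂ] HilbertTensor (HilbertTensor H K) L}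
    (hX : X ∈ spatialTensor (spatialTensor A B) C) :
    conjHom assocEquiv X ∈ spatialTensor A (spatialTensor B C) := by
  have h1 : spatialTensor A B ≤ (spatialTensor A (spatialTensor B C)).comap
      ((conjHom (assocEquiv (H := H) (K := K) (L := L))).comp (ampLeft (K := L))) := by
    refine spatialTensor_le (isClosed_comap _ (isClosed_spatialTensor _ _)) fun a ha b hb => ?_
    change conjHom assocEquiv (opTensor (opTensor a b) 1) ∈ spatialTensor A (spatialTensor B C)
    rw [conjHom_assocEquiv]
    exact opTensor_mem_spatialTensor ha (opTensor_mem_spatialTensor hb (one_mem C))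
  have h2 : spatialTensor (spatialTensor A B) C ≤ (spatialTensor A (spatialTensor B C)).comap
      (conjHom assocEquiv) := by
    refine spatialTensor_le (isClosed_comap _ (isClosed_spatialTensor _ _)) fun Y hY c hc => ?_
    change conjHom assocEquiv (opTensor Y c) ∈ spatialTensor A (spatialTensor B C)
    -- Splitting off 1 ⊗ c leaves `Y` ⊗ 1, for which the elementary tensors in the first bracket
    -- suffice.
    have h3 : opTensor Y c = opTensor Y 1 * opTensor (opTensor 1 1) c := by
      rw [← opTensor_mul, opTensor_one, mul_one, one_mul]
    rw [h3, map_mul, conjHom_assocEquiv]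
    exact mul_mem (h1 hY) (opTensor_mem_spatialTensor (one_mem A)
      (opTensor_mem_spatialTensor (one_mem B) hc))
  exact h2 hX

lemma tmulSpatial_mul {A : StarSubalgebra ℂ (H →L[ℂ] H)} {B : StarSubalgebra ℂ (K →L[ℂ] K)}
    (a a' : A) (b b' : B) :
    tmulSpatial (a * a') (b * b') = tmulSpatial a b * tmulSpatial a' b' :=
  Subtype.ext (opTensor_mul _ _ _ _)

lemma star_tmulSpatial {A : StarSubalgebra ℂ (H →L[ℂ] H)} {B : StarSubalgebra ℂ (K →L[ℂ] K)}
    (a : A) (b : B) : star (tmulSpatial a b) = tmulSpatial (star a) (star b) :=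
  Subtype.ext (star_opTensor _ _)

lemma continuous_opTensor_left (T : K →L[ℂ] K) :
    Continuous fun S : H →L[ℂ] H => opTensor S T := by
  have h : ∀ S : H →L[ℂ] H, opTensor S T = ampLeft S * opTensor 1 T := fun S => by
    rw [ampLeft_apply, ← opTensor_mul, mul_one, one_mul]
  exact ((continuous_starHom (ampLeft (H := H) (K := K))).mul continuous_const).congr fun S => (h S).symm

lemma continuous_opTensor_right (S : H →L[ℂ] H) :
    Continuous fun T : K →L[ℂ] K => opTensor S T := by
  have h : ∀ T : K →L[ℂ] K, opTensor S T = opTensor S 1 * ampRight T := fun T => by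
    rw [ampRight_apply, ← opTensor_mul, mul_one, one_mul]
  exact (continuous_const.mul (continuous_starHom (ampRight (H := H) (K := K)))).congr fun T => (h T).symm

end Amplification

/-! ### The coproduct on the C*-algebra, coassociativity and density -/

section Coproduct

lemma coprodHom_U (θ : ℝ) (i j : Fin 3) : coprodHom θ (U θ i j) = DU θ i j :=
  (IsCoproduct.coord i j).coprodHom_eq

/-- A general continuous function of given degree need not have a finite expansion, so membership is
checked on the coordinate functions and passes to the closure. -/
lemma coprodHom_mem (θ : ℝ) {T : L2SU3 →L[ℂ] L2SU3} (hT : T ∈ CSU3 θ) :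
    coprodHom θ T ∈ spatialTensor (CSU3 θ) (CSU3 θ) := by
  have h : CSU3 θ ≤ (spatialTensor (CSU3 θ) (CSU3 θ)).comap (coprodHom θ) := by
    refine (CSU3_eq θ).le.trans
      (closure_adjoin_le (isClosed_comap _ (isClosed_spatialTensor _ _)) ?_)
    rintro _ ⟨i, j, rfl⟩
    change coprodHom θ (U θ i j) ∈ spatialTensor (CSU3 θ) (CSU3 θ)
    rw [coprodHom_U]
    exact sum_mem fun k _ => opTensor_mem_spatialTensor (coordOps_le θ (U_mem θ i k))
      (coordOps_le θ (U_mem θ k j))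
  exact h hT

/-- The coproduct of `C(SU(3)_θ)`. -/
def comul (θ : ℝ) : CSU3 θ →⋆ₐ[ℂ] spatialTensor (CSU3 θ) (CSU3 θ) :=
  restrictHom (coprodHom θ) _ _ fun _ h => coprodHom_mem θ h

lemma coe_comul (θ : ℝ) (a : CSU3 θ) :
    (comul θ a : HilbertTensor L2SU3 L2SU3 →L[ℂ] HilbertTensor L2SU3 L2SU3) = coprodHom θ a := rfl

lemma coe_sum_tmulSpatial (θ : ℝ) {ι : Type*} (s : Finset ι) (a b : ι → CSU3 θ) :
    ((∑ i ∈ s, tmulSpatial (a i) (b i) : spatialTensor (CSU3 θ) (CSU3 θ)) :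
      HilbertTensor L2SU3 L2SU3 →L[ℂ] HilbertTensor L2SU3 L2SU3) =
      ∑ i ∈ s, opTensor (a i : L2SU3 →L[ℂ] L2SU3) (b i : L2SU3 →L[ℂ] L2SU3) :=
  map_sum (spatialTensor (CSU3 θ) (CSU3 θ)).subtype _ _

lemma comul_elt (θ : ℝ) {n : Fin 4 → ℤ} (f : isotypic n) {k : ℕ} {p r : Fin k → Fin 4 → ℤ}
    (a : ∀ i, isotypic (p i)) (b : ∀ i, isotypic (r i))
    (h : ∀ x y : SU3, (f : C(SU3, ℂ)) (x * y) =
      ∑ i, (a i : C(SU3, ℂ)) x * (b i : C(SU3, ℂ)) y) :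
    comul θ (elt θ f) = ∑ i, tmulSpatial (elt θ (a i)) (elt θ (b i)) := by
  refine Subtype.ext ?_
  rw [coe_comul, coe_sum_tmulSpatial]
  exact coprodHom_quantize θ f.2 p r (fun i => a i) (fun i => b i) (fun i => (a i).2)
    (fun i => (b i).2) h

lemma comul_u (θ : ℝ) (i j : Fin 3) :
    comul θ (u θ i j) = ∑ k, tmulSpatial (u θ i k) (u θ k j) := by
  refine Subtype.ext ?_
  rw [coe_comul, coe_sum_tmulSpatial]
  exact coprodHom_U θ i j

/-- The unitary implementing the coproduct. -/
def multUnitaryOp (θ : ℝ) :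
    unitary (HilbertTensor L2SU3 L2SU3 →L[ℂ] HilbertTensor L2SU3 L2SU3) :=
  Unitary.linearIsometryEquiv.symm (multUnitary θ)

/-- The extension of `Δ ⊗ id` to bounded operators. -/
def coprodLeft (θ : ℝ) :
    (HilbertTensor L2SU3 L2SU3 →L[ℂ] HilbertTensor L2SU3 L2SU3) →⋆ₐ[ℂ]
      (HilbertTensor (HilbertTensor L2SU3 L2SU3) L2SU3 →L[ℂ]
        HilbertTensor (HilbertTensor L2SU3 L2SU3) L2SU3) :=
  (conjUnitary (unitaryLeft (multUnitaryOp θ))).comp ((conjHom assocEquiv.symm).comp ampRight)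

/-- Since Δ(S) = W(1 ⊗ S)W*, conjugating (1 ⊗ S) ⊗ T by W ⊗ 1 gives Δ(S) ⊗ T. Implementation by a
unitary extends Δ ⊗ id to the completed tensor product. -/
lemma coprodLeft_opTensor (θ : ℝ) (S T : L2SU3 →L[ℂ] L2SU3) :
    coprodLeft θ (opTensor S T) = opTensor (coprodHom θ S) T := by
  change conjUnitary (unitaryLeft (multUnitaryOp θ))
    (conjHom assocEquiv.symm (opTensor 1 (opTensor S T))) = _
  rw [conjHom_assocEquiv_symm, conjUnitary_unitaryLeft, multUnitaryOp, conjUnitary_symm]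
  rfl

/-- The extension of `id ⊗ Δ` to bounded operators. -/
def coprodRight (θ : ℝ) :
    (HilbertTensor L2SU3 L2SU3 →L[ℂ] HilbertTensor L2SU3 L2SU3) →⋆ₐ[ℂ]
      (HilbertTensor L2SU3 (HilbertTensor L2SU3 L2SU3) →L[ℂ]
        HilbertTensor L2SU3 (HilbertTensor L2SU3 L2SU3)) :=
  (conjUnitary (unitaryRight (multUnitaryOp θ))).comp
    ((conjUnitary (unitaryRight (Unitary.linearIsometryEquiv.symm flipEquiv))).comp
      ((conjHom assocEquiv).comp ampLeft))

/-- The rebracketing produces S ⊗ (T ⊗ 1); the flip brings the last two legs to 1 ⊗ T, the form that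
W expects. -/
lemma coprodRight_opTensor (θ : ℝ) (S T : L2SU3 →L[ℂ] L2SU3) :
    coprodRight θ (opTensor S T) = opTensor S (coprodHom θ T) := by
  change conjUnitary (unitaryRight (multUnitaryOp θ))
    (conjUnitary (unitaryRight (Unitary.linearIsometryEquiv.symm flipEquiv))
      (conjHom assocEquiv (opTensor (opTensor S T) 1))) = _
  rw [conjHom_assocEquiv, conjUnitary_unitaryRight, conjUnitary_symm, conjHom_flipEquiv,
    conjUnitary_unitaryRight, multUnitaryOp, conjUnitary_symm]
  rfl

/-- Both sides are *-homomorphisms, and on u_ij both are ∑ u_ik ⊗ u_kl ⊗ u_lj. -/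
lemma coassoc_coprodHom (θ : ℝ) {T : L2SU3 →L[ℂ] L2SU3} (hT : T ∈ CSU3 θ) :
    conjHom assocEquiv (coprodLeft θ (coprodHom θ T)) = coprodRight θ (coprodHom θ T) := by
  have h : (((conjHom assocEquiv).comp ((coprodLeft θ).comp (coprodHom θ))).comp
      (CSU3 θ).subtype) = (((coprodRight θ).comp (coprodHom θ)).comp (CSU3 θ).subtype) := by
    refine starHom_ext θ fun i j => ?_
    change conjHom assocEquiv (coprodLeft θ (coprodHom θ (U θ i j))) =
      coprodRight θ (coprodHom θ (U θ i j))
    rw [coprodHom_U, DU, map_sum, map_sum, map_sum]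
    simp only [coprodLeft_opTensor, coprodRight_opTensor, coprodHom_U, DU, opTensor_sum_left,
      opTensor_sum_right, map_sum, conjHom_assocEquiv]
    exact Finset.sum_comm
  have h2 := DFunLike.congr_fun h ⟨T, hT⟩
  simpa only [StarAlgHom.comp_apply, StarSubalgebra.subtype_apply] using h2

theorem isCoassociative_comul (θ : ℝ) : IsCoassociative (comul θ) := by
  have h1 : spatialTensor (CSU3 θ) (CSU3 θ) ≤
      (spatialTensor (spatialTensor (CSU3 θ) (CSU3 θ)) (CSU3 θ)).comap (coprodLeft θ) := by
    refine spatialTensor_le (isClosed_comap _ (isClosed_spatialTensor _ _)) fun a ha b hb => ?_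
    change coprodLeft θ (opTensor a b) ∈ spatialTensor (spatialTensor (CSU3 θ) (CSU3 θ)) (CSU3 θ)
    rw [coprodLeft_opTensor]
    exact opTensor_mem_spatialTensor (coprodHom_mem θ ha) hb
  have h2 : spatialTensor (CSU3 θ) (CSU3 θ) ≤
      (spatialTensor (CSU3 θ) (spatialTensor (CSU3 θ) (CSU3 θ))).comap (coprodRight θ) := by
    refine spatialTensor_le (isClosed_comap _ (isClosed_spatialTensor _ _)) fun a ha b hb => ?_
    change coprodRight θ (opTensor a b) ∈ spatialTensor (CSU3 θ) (spatialTensor (CSU3 θ) (CSU3 θ))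
    rw [coprodRight_opTensor]
    exact opTensor_mem_spatialTensor ha (coprodHom_mem θ hb)
  refine ⟨restrictHom (coprodLeft θ) _ _ fun _ h => h1 h,
    restrictHom (coprodRight θ) _ _ fun _ h => h2 h,
    restrictHom (conjHom assocEquiv) _ _ fun _ h => conjHom_assocEquiv_mem h,
    fun a b => Subtype.ext (coprodLeft_opTensor θ _ _),
    fun a b => Subtype.ext (coprodRight_opTensor θ _ _),
    fun a b c => Subtype.ext (conjHom_assocEquiv _ _ _),
    fun a => Subtype.ext (coassoc_coprodHom θ a.2)⟩

lemma mem_coproductOps {θ : ℝ}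
    {D : HilbertTensor L2SU3 L2SU3 →L[ℂ] HilbertTensor L2SU3 L2SU3} (hD : D ∈ coproductOps θ) :
    ∃ a : CSU3 θ, D = comul θ a := by
  have h1 : coproductOps θ ≤ (coordOps θ).map (coprodHom θ) := by
    refine StarAlgebra.adjoin_le ?_
    rintro _ ⟨i, j, rfl⟩
    exact ⟨U θ i j, U_mem θ i j, coprodHom_U θ i j⟩
  obtain ⟨T, hT, rfl⟩ := h1 hD
  exact ⟨⟨T, coordOps_le θ hT⟩, rfl⟩

/-- `Δ(A)(1 ⊗ A)` is total in `A ⊗ A`. -/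
theorem dense_comul_right (θ : ℝ) : Dense (Submodule.span ℂ
    {T | ∃ a b : CSU3 θ, T = comul θ a * tmulSpatial 1 b} :
      Set (spatialTensor (CSU3 θ) (CSU3 θ))) := by
  set P := Submodule.span ℂ {T | ∃ a b : CSU3 θ, T = comul θ a * tmulSpatial 1 b} with hP
  refine dense_of_tmulSpatial_mem P fun a b => ?_
  have hc : Continuous fun a : CSU3 θ => (tmulSpatial a b : spatialTensor (CSU3 θ) (CSU3 θ)) :=
    ((continuous_opTensor_left _).comp continuous_subtype_val).subtype_mk _
  -- By continuity in `a` it suffices to treat `a` in O. There a ⊗ 1 lies in Δ(O)(1 ⊗ O), and right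
  -- multiplication by 1 ⊗ b only alters the last factor.
  refine map_mem_closure (f := fun a => tmulSpatial a b) hc (dense_coordAlgebra θ a) fun a ha => ?_
  let ι := (spatialTensor (CSU3 θ) (CSU3 θ)).subtype.toAlgHom.toLinearMap
  have h1 : ∀ M ∈ (Subalgebra.toSubmodule (coproductOps θ).toSubalgebra *
      Subalgebra.toSubmodule ((coordOps θ).map (ampRight (H := L2SU3))).toSubalgebra :
      Submodule ℂ (HilbertTensor L2SU3 L2SU3 →L[ℂ] HilbertTensor L2SU3 L2SU3)),
      M * opTensor 1 (b : L2SU3 →L[ℂ] L2SU3) ∈ P.map ι := by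
    intro M hM
    refine Submodule.mul_induction_on hM (fun d hd m hm => ?_) fun M N hM hN => ?_
    · obtain ⟨x, rfl⟩ := mem_coproductOps hd
      obtain ⟨c, hc, rfl⟩ := hm
      refine ⟨comul θ x * tmulSpatial 1 (⟨c, coordOps_le θ hc⟩ * b),
        Submodule.subset_span ⟨_, _, rfl⟩, ?_⟩
      change (comul θ x : HilbertTensor L2SU3 L2SU3 →L[ℂ] HilbertTensor L2SU3 L2SU3) *
        opTensor 1 (c * (b : L2SU3 →L[ℂ] L2SU3)) = _ * opTensor 1 c * opTensor 1 _
      rw [mul_assoc, ← opTensor_mul, one_mul]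
    · rw [add_mul]
      exact add_mem hM hN
  obtain ⟨X, hX, h2⟩ := h1 _ (ampLeft_mem θ ((mem_coordAlgebra_iff θ a).mp ha))
  rw [← opTensor_mul, mul_one, one_mul] at h2
  have h3 : X = tmulSpatial a b := Subtype.ext h2
  rw [h3] at hX
  exact hX

/-- `Δ(A)(A ⊗ 1)` is total in `A ⊗ A`. -/
theorem dense_comul_left (θ : ℝ) : Dense (Submodule.span ℂ
    {T | ∃ a b : CSU3 θ, T = comul θ a * tmulSpatial b 1} :
      Set (spatialTensor (CSU3 θ) (CSU3 θ))) := by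
  set P := Submodule.span ℂ {T | ∃ a b : CSU3 θ, T = comul θ a * tmulSpatial b 1} with hP
  refine dense_of_tmulSpatial_mem P fun b a => ?_
  have hc : Continuous fun a : CSU3 θ => (tmulSpatial b a : spatialTensor (CSU3 θ) (CSU3 θ)) :=
    ((continuous_opTensor_right _).comp continuous_subtype_val).subtype_mk _
  refine map_mem_closure (f := fun a => tmulSpatial b a) hc (dense_coordAlgebra θ a) fun a ha => ?_
  let ι := (spatialTensor (CSU3 θ) (CSU3 θ)).subtype.toAlgHom.toLinearMap
  have h1 : ∀ M ∈ (Subalgebra.toSubmodule (coproductOps θ).toSubalgebra *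
      Subalgebra.toSubmodule ((coordOps θ).map (ampLeft (K := L2SU3))).toSubalgebra :
      Submodule ℂ (HilbertTensor L2SU3 L2SU3 →L[ℂ] HilbertTensor L2SU3 L2SU3)),
      M * opTensor (b : L2SU3 →L[ℂ] L2SU3) 1 ∈ P.map ι := by
    intro M hM
    refine Submodule.mul_induction_on hM (fun d hd m hm => ?_) fun M N hM hN => ?_
    · obtain ⟨x, rfl⟩ := mem_coproductOps hd
      obtain ⟨c, hc, rfl⟩ := hm
      refine ⟨comul θ x * tmulSpatial (⟨c, coordOps_le θ hc⟩ * b) 1,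
        Submodule.subset_span ⟨_, _, rfl⟩, ?_⟩
      change (comul θ x : HilbertTensor L2SU3 L2SU3 →L[ℂ] HilbertTensor L2SU3 L2SU3) *
        opTensor (c * (b : L2SU3 →L[ℂ] L2SU3)) 1 = _ * opTensor c 1 * opTensor _ 1
      rw [mul_assoc, ← opTensor_mul, one_mul]
    · rw [add_mul]
      exact add_mem hM hN
  obtain ⟨X, hX, h2⟩ := h1 _ (ampRight_mem θ ((mem_coordAlgebra_iff θ a).mp ha))
  rw [← opTensor_mul, mul_one, one_mul] at h2
  have h3 : X = tmulSpatial b a := Subtype.ext h2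
  rw [h3] at hX
  exact hX

theorem isCompactQuantumGroup_CSU3 (θ : ℝ) : IsCompactQuantumGroup (CSU3 θ) (comul θ) where
  isClosed := isClosed_CSU3 θ
  coassoc := isCoassociative_comul θ
  dense_right := dense_comul_right θ
  dense_left := dense_comul_left θ

theorem isCounit_counit (θ : ℝ) : IsCounit (comul θ) (counit θ) := by
  obtain ⟨E₁, h₁⟩ := exists_sliceLeft θ
  obtain ⟨E₂, h₂⟩ := exists_sliceRight θ
  have h3 : (CSU3 θ).subtype.comp (E₁.comp (comul θ)) = (CSU3 θ).subtype := by
    refine starHom_ext θ fun i j => congrArg Subtype.val (?_ : E₁ (comul θ (u θ i j)) = u θ i j)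
    rw [comul_u, map_sum]
    simp [h₁, counit_u]
  have h4 : (CSU3 θ).subtype.comp (E₂.comp (comul θ)) = (CSU3 θ).subtype := by
    refine starHom_ext θ fun i j => congrArg Subtype.val (?_ : E₂ (comul θ (u θ i j)) = u θ i j)
    rw [comul_u, map_sum]
    simp [h₂, counit_u]
  exact ⟨E₁, E₂, h₁, h₂, fun a => ⟨Subtype.ext (DFunLike.congr_fun h3 a),
    Subtype.ext (DFunLike.congr_fun h4 a)⟩⟩

end Coproduct

/-! ### The antipode law on the coordinate algebra -/

section AntipodeLaw

lemma antipode_one (θ : ℝ) : antipode θ 1 = 1 := Subtype.ext antipodeOp_one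

lemma antipode_mul (θ : ℝ) (a b : CSU3 θ) : antipode θ (a * b) = antipode θ b * antipode θ a :=
  Subtype.ext (antipodeOp_mul _ _)

lemma star_antipode (θ : ℝ) (a : CSU3 θ) : star (antipode θ a) = antipode θ (star a) :=
  Subtype.ext (star_antipodeOp _)

lemma antipode_antipode (θ : ℝ) (a : CSU3 θ) : antipode θ (antipode θ a) = a :=
  Subtype.ext (antipodeOp_antipodeOp _)

/-- The antipode law for an element of `C(SU(3)_θ)`. -/
def AntipodeLaw (θ : ℝ) (a : CSU3 θ) : Prop :=
  ∃ (ι : Type) (_ : Fintype ι) (b c : ι → CSU3 θ),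
    (∀ i, b i ∈ coordAlgebra θ ∧ c i ∈ coordAlgebra θ) ∧
    comul θ a = ∑ i, tmulSpatial (b i) (c i) ∧
    ∑ i, antipode θ (b i) * c i = counit θ a • (1 : CSU3 θ) ∧
    ∑ i, b i * antipode θ (c i) = counit θ a • (1 : CSU3 θ)

lemma coe_sum_CSU3 (θ : ℝ) {ι : Type*} (s : Finset ι) (a : ι → CSU3 θ) :
    ((∑ i ∈ s, a i : CSU3 θ) : L2SU3 →L[ℂ] L2SU3) = ∑ i ∈ s, (a i : L2SU3 →L[ℂ] L2SU3) :=
  map_sum (CSU3 θ).subtype _ _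

lemma u_mem_coordAlgebra (θ : ℝ) (i j : Fin 3) : u θ i j ∈ coordAlgebra θ :=
  StarAlgebra.subset_adjoin ℂ _ ⟨i, j, rfl⟩

namespace AntipodeLaw

variable {θ : ℝ} {a a' : CSU3 θ}

lemma coordinate (i j : Fin 3) : AntipodeLaw θ (u θ i j) := by
  refine ⟨Fin 3, inferInstance, fun k => u θ i k, fun k => u θ k j,
    fun k => ⟨u_mem_coordAlgebra θ i k, u_mem_coordAlgebra θ k j⟩, comul_u θ i j, ?_, ?_⟩
  · refine Subtype.ext ((coe_sum_CSU3 θ _ _).trans ?_)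
    have h := sum_star_U_mul_U_col θ j i
    simp only [antipode_u, counit_u]
    refine Eq.trans h ?_
    split_ifs <;> simp
  · refine Subtype.ext ((coe_sum_CSU3 θ _ _).trans ?_)
    have h := sum_U_mul_star_U_row θ j i
    simp only [antipode_u, counit_u]
    refine Eq.trans h ?_
    split_ifs <;> simp

lemma scalar (c : ℂ) : AntipodeLaw θ (algebraMap ℂ (CSU3 θ) c) := by
  refine ⟨Unit, inferInstance, fun _ => algebraMap ℂ (CSU3 θ) c, fun _ => 1,
    fun _ => ⟨algebraMap_mem _ c, one_mem _⟩, ?_, ?_, ?_⟩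
  · rw [AlgHomClass.commutes, Finset.univ_unique, Finset.sum_singleton]
    refine Subtype.ext (ext_pt' fun x y => ?_)
    change _ = opTensor (c • (1 : L2SU3 →L[ℂ] L2SU3)) 1 (pt x y)
    simp [Algebra.algebraMap_eq_smul_one]
  · rw [AlgHomClass.commutes, Finset.univ_unique, Finset.sum_singleton,
      Algebra.algebraMap_eq_smul_one, map_smul, antipode_one, mul_one]
    rfl
  · rw [AlgHomClass.commutes, Finset.univ_unique, Finset.sum_singleton,
      Algebra.algebraMap_eq_smul_one, antipode_one, mul_one]
    rfl

lemma add (h : AntipodeLaw θ a) (h' : AntipodeLaw θ a') : AntipodeLaw θ (a + a') := by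
  obtain ⟨ι, _, b, c, hm, h1, h2, h3⟩ := h
  obtain ⟨ι', _, b', c', hm', h1', h2', h3'⟩ := h'
  refine ⟨ι ⊕ ι', inferInstance, Sum.elim b b', Sum.elim c c', ?_, ?_, ?_, ?_⟩
  · rintro (i | i)
    exacts [hm i, hm' i]
  · rw [map_add, h1, h1', Fintype.sum_sum_type]
    rfl
  · rw [map_add, add_smul, ← h2, ← h2', Fintype.sum_sum_type]
    rfl
  · rw [map_add, add_smul, ← h3, ← h3', Fintype.sum_sum_type]
    rfl

/-- As S reverses products, the sum for one factor is nested inside that for the other; it collapses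
to a scalar, which can be pulled out. -/
lemma mul (h : AntipodeLaw θ a) (h' : AntipodeLaw θ a') : AntipodeLaw θ (a * a') := by
  obtain ⟨ι, _, b, c, hm, h1, h2, h3⟩ := h
  obtain ⟨ι', _, b', c', hm', h1', h2', h3'⟩ := h'
  refine ⟨ι × ι', inferInstance, fun i => b i.1 * b' i.2, fun i => c i.1 * c' i.2,
    fun i => ⟨mul_mem (hm _).1 (hm' _).1, mul_mem (hm _).2 (hm' _).2⟩, ?_, ?_, ?_⟩
  · rw [map_mul, h1, h1', Finset.sum_mul_sum, Fintype.sum_prod_type]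
    simp only [tmulSpatial_mul]
  · calc ∑ i : ι × ι', antipode θ (b i.1 * b' i.2) * (c i.1 * c' i.2)
        = ∑ j, antipode θ (b' j) * (∑ i, antipode θ (b i) * c i) * c' j := by
          rw [Fintype.sum_prod_type_right]
          simp only [antipode_mul, Finset.mul_sum, Finset.sum_mul, mul_assoc]
      _ = counit θ (a * a') • (1 : CSU3 θ) := by
          simp only [h2, mul_smul_comm, smul_mul_assoc, mul_one, ← Finset.smul_sum, h2', smul_smul,
            map_mul]
  · calc ∑ i : ι × ι', (b i.1 * b' i.2) * antipode θ (c i.1 * c' i.2)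
        = ∑ i, b i * (∑ j, b' j * antipode θ (c' j)) * antipode θ (c i) := by
          rw [Fintype.sum_prod_type]
          simp only [antipode_mul, Finset.mul_sum, Finset.sum_mul, mul_assoc]
      _ = counit θ (a * a') • (1 : CSU3 θ) := by
          simp only [h3', mul_smul_comm, smul_mul_assoc, mul_one, ← Finset.smul_sum, h3, smul_smul,
            map_mul, mul_comm]

/-- Here S² = id: applying S to the two laws for `a` yields them with the factors in the opposite
order, and taking adjoints restores the order for a*. -/
lemma adjoint (h : AntipodeLaw θ a) : AntipodeLaw θ (star a) := by
  obtain ⟨ι, _, b, c, hm, h1, h2, h3⟩ := h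
  have h2' : ∑ i, c i * antipode θ (b i) = counit θ a • (1 : CSU3 θ) := by
    have h4 := congrArg (antipode θ) h3
    simp only [map_sum, antipode_mul, antipode_antipode, map_smul, antipode_one] at h4
    exact h4
  have h3' : ∑ i, antipode θ (c i) * b i = counit θ a • (1 : CSU3 θ) := by
    have h4 := congrArg (antipode θ) h2
    simp only [map_sum, antipode_mul, antipode_antipode, map_smul, antipode_one] at h4
    exact h4
  refine ⟨ι, inferInstance, fun i => star (b i), fun i => star (c i),
    fun i => ⟨star_mem (hm i).1, star_mem (hm i).2⟩, ?_, ?_, ?_⟩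
  · rw [map_star, h1, star_sum]
    simp only [star_tmulSpatial]
  · have h4 := congrArg star h2'
    simp only [star_sum, star_mul, star_antipode, star_smul, star_one] at h4
    rw [h4, map_star]
  · have h4 := congrArg star h3'
    simp only [star_sum, star_mul, star_antipode, star_smul, star_one] at h4
    rw [h4, map_star]

end AntipodeLaw

lemma antipodeLaw_of_mem {θ : ℝ} {a : CSU3 θ} (ha : a ∈ coordAlgebra θ) : AntipodeLaw θ a := by
  induction ha using StarAlgebra.adjoin_induction with
  | mem a ha => obtain ⟨i, j, rfl⟩ := ha; exact .coordinate i j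
  | algebraMap c => exact .scalar c
  | add a b _ _ ha hb => exact ha.add hb
  | mul a b _ _ ha hb => exact ha.mul hb
  | star a _ ha => exact ha.adjoint

theorem isCoinverse_antipode (θ : ℝ) :
    IsCoinverse (comul θ) (counit θ) (coordAlgebra θ) (antipode θ) where
  dense := dense_coordAlgebra θ
  map_one := antipode_one θ
  map_mul := antipode_mul θ
  map_star a := by rw [← star_antipode, antipode_antipode, star_star]
  map_mem a ha := (mem_coordAlgebra_iff θ _).mpr
    (antipodeOp_mem_coordOps θ ((mem_coordAlgebra_iff θ a).mp ha))
  antipode a ha := by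
    obtain ⟨ι, _, b, c, hm, h1, h2, h3⟩ := antipodeLaw_of_mem ha
    let e := (Fintype.equivFin ι).symm
    exact ⟨Fintype.card ι, b ∘ e, c ∘ e, fun i => hm (e i),
      h1.trans (e.sum_comp fun i => tmulSpatial (b i) (c i)).symm,
      (e.sum_comp fun i => antipode θ (b i) * c i).trans h2,
      (e.sum_comp fun i => b i * antipode θ (c i)).trans h3⟩

end AntipodeLaw

end

end QSU3

/-! ### Assembly of the theorem -/

theorem mainTheorem8 (θ : ℝ) :
    -- the deformed product, involution and linear embedding of the isotypic components
    (∀ (n m : Fin 4 → ℤ), ∀ f ∈ isotypic n, ∀ g ∈ isotypic m,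
      quantize θ n f * quantize θ m g = chi θ n m • quantize θ (n + m) (f * g)) ∧
    (∀ (n : Fin 4 → ℤ), ∀ f ∈ isotypic n, star (quantize θ n f) = quantize θ (-n) (star f)) ∧
    (∀ (s : Finset (Fin 4 → ℤ)) (f : ∀ n, isotypic n),
      ∑ n ∈ s, elt θ (f n) = 0 → ∀ n ∈ s, f n = 0) ∧
    -- the commutation relations; the indices 0, 1, 2 stand for 1, 2, 3
    (u θ 0 0 * u θ 0 1 = q θ • (u θ 0 1 * u θ 0 0)) ∧
    (u θ 0 2 * u θ 0 0 = q θ • (u θ 0 0 * u θ 0 2)) ∧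
    (u θ 1 0 * u θ 0 0 = q θ • (u θ 0 0 * u θ 1 0)) ∧
    (u θ 0 0 * u θ 1 1 = u θ 1 1 * u θ 0 0) ∧
    (u θ 1 2 * u θ 0 0 = q₂ θ • (u θ 0 0 * u θ 1 2)) ∧
    (u θ 0 0 * u θ 2 0 = q θ • (u θ 2 0 * u θ 0 0)) ∧
    (u θ 0 0 * u θ 2 1 = q₂ θ • (u θ 2 1 * u θ 0 0)) ∧
    (u θ 0 0 * u θ 2 2 = u θ 2 2 * u θ 0 0) ∧
    (u θ 0 1 * u θ 0 2 = q θ • (u θ 0 2 * u θ 0 1)) ∧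
    (u θ 1 0 * u θ 0 1 = q₂ θ • (u θ 0 1 * u θ 1 0)) ∧
    (u θ 1 1 * u θ 0 1 = q θ • (u θ 0 1 * u θ 1 1)) ∧
    (u θ 0 1 * u θ 1 2 = u θ 1 2 * u θ 0 1) ∧
    (u θ 0 1 * u θ 2 0 = u θ 2 0 * u θ 0 1) ∧
    (u θ 0 1 * u θ 2 1 = q θ • (u θ 2 1 * u θ 0 1)) ∧
    (u θ 0 1 * u θ 2 2 = q₂ θ • (u θ 2 2 * u θ 0 1)) ∧
    (u θ 0 2 * u θ 1 0 = u θ 1 0 * u θ 0 2) ∧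
    (u θ 1 1 * u θ 0 2 = q₂ θ • (u θ 0 2 * u θ 1 1)) ∧
    (u θ 1 2 * u θ 0 2 = q θ • (u θ 0 2 * u θ 1 2)) ∧
    (u θ 0 2 * u θ 2 0 = q₂ θ • (u θ 2 0 * u θ 0 2)) ∧
    (u θ 0 2 * u θ 2 1 = u θ 2 1 * u θ 0 2) ∧
    (u θ 0 2 * u θ 2 2 = q θ • (u θ 2 2 * u θ 0 2)) ∧
    (u θ 1 0 * u θ 1 1 = q θ • (u θ 1 1 * u θ 1 0)) ∧
    (u θ 1 2 * u θ 1 0 = q θ • (u θ 1 0 * u θ 1 2)) ∧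
    (u θ 2 0 * u θ 1 0 = q θ • (u θ 1 0 * u θ 2 0)) ∧
    (u θ 1 0 * u θ 2 1 = u θ 2 1 * u θ 1 0) ∧
    (u θ 2 2 * u θ 1 0 = q₂ θ • (u θ 1 0 * u θ 2 2)) ∧
    (u θ 1 1 * u θ 1 2 = q θ • (u θ 1 2 * u θ 1 1)) ∧
    (u θ 2 0 * u θ 1 1 = q₂ θ • (u θ 1 1 * u θ 2 0)) ∧
    (u θ 2 1 * u θ 1 1 = q θ • (u θ 1 1 * u θ 2 1)) ∧
    (u θ 1 1 * u θ 2 2 = u θ 2 2 * u θ 1 1) ∧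
    (u θ 1 2 * u θ 2 0 = u θ 2 0 * u θ 1 2) ∧
    (u θ 2 1 * u θ 1 2 = q₂ θ • (u θ 1 2 * u θ 2 1)) ∧
    (u θ 2 2 * u θ 1 2 = q θ • (u θ 1 2 * u θ 2 2)) ∧
    (u θ 2 0 * u θ 2 1 = q θ • (u θ 2 1 * u θ 2 0)) ∧
    (u θ 2 2 * u θ 2 0 = q θ • (u θ 2 0 * u θ 2 2)) ∧
    (u θ 2 1 * u θ 2 2 = q θ • (u θ 2 2 * u θ 2 1)) ∧
    -- the quantum group structure
    ∃ (Δ : CSU3 θ →⋆ₐ[ℂ] spatialTensor (CSU3 θ) (CSU3 θ)) (ε : CSU3 θ →⋆ₐ[ℂ] ℂ)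
      (S : CSU3 θ →L[ℂ] CSU3 θ),
      IsCompactQuantumGroup (CSU3 θ) Δ ∧
      IsCounit Δ ε ∧
      IsCoinverse Δ ε (coordAlgebra θ) S ∧
      -- coproduct, counit and antipode are those of the functions on `SU(3)`
      (∀ (n : Fin 4 → ℤ) (f : isotypic n) (k : ℕ) (p r : Fin k → Fin 4 → ℤ)
        (a : ∀ i, isotypic (p i)) (b : ∀ i, isotypic (r i)),
        (∀ x y : SU3, (f : C(SU3, ℂ)) (x * y) =
          ∑ i, (a i : C(SU3, ℂ)) x * (b i : C(SU3, ℂ)) y) →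
        Δ (elt θ f) = ∑ i, tmulSpatial (elt θ (a i)) (elt θ (b i))) ∧
      (∀ (n : Fin 4 → ℤ) (f : isotypic n), ε (elt θ f) = (f : C(SU3, ℂ)) 1) ∧
      (∀ (n : Fin 4 → ℤ) (f : isotypic n),
        (S (elt θ f) : L2SU3 →L[ℂ] L2SU3) = quantize θ ![n 2, n 3, n 0, n 1]
          ((f : C(SU3, ℂ)).comp ⟨fun g => g⁻¹, continuous_inv⟩)) ∧
      (∀ i j, Δ (u θ i j) = ∑ k, tmulSpatial (u θ i k) (u θ k j)) ∧
      (∀ i j, ε (u θ i j) = if i = j then 1 else 0) ∧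
      (∀ i j, S (u θ i j) = star (u θ j i)) := by
  refine ⟨fun n m f _ g hg => quantize_mul θ f hg, fun n f hf => star_quantize θ hf,
    fun s f h => elt_sum_eq_zero θ s f h,
    -- Each relation reduces to evaluating the integer pairing of two degrees; the factors are
    -- ordered so that it is 0, 1 or 2.
    u_comm_one θ 0 0 0 1 (by decide),
    u_comm_one θ 0 2 0 0 (by decide),
    u_comm_one θ 1 0 0 0 (by decide),
    u_comm_zero θ 0 0 1 1 (by decide),
    u_comm_two θ 1 2 0 0 (by decide),
    u_comm_one θ 0 0 2 0 (by decide),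
    u_comm_two θ 0 0 2 1 (by decide),
    u_comm_zero θ 0 0 2 2 (by decide),
    u_comm_one θ 0 1 0 2 (by decide),
    u_comm_two θ 1 0 0 1 (by decide),
    u_comm_one θ 1 1 0 1 (by decide),
    u_comm_zero θ 0 1 1 2 (by decide),
    u_comm_zero θ 0 1 2 0 (by decide),
    u_comm_one θ 0 1 2 1 (by decide),
    u_comm_two θ 0 1 2 2 (by decide),
    u_comm_zero θ 0 2 1 0 (by decide),
    u_comm_two θ 1 1 0 2 (by decide),
    u_comm_one θ 1 2 0 2 (by decide),
    u_comm_two θ 0 2 2 0 (by decide),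
    u_comm_zero θ 0 2 2 1 (by decide),
    u_comm_one θ 0 2 2 2 (by decide),
    u_comm_one θ 1 0 1 1 (by decide),
    u_comm_one θ 1 2 1 0 (by decide),
    u_comm_one θ 2 0 1 0 (by decide),
    u_comm_zero θ 1 0 2 1 (by decide),
    u_comm_two θ 2 2 1 0 (by decide),
    u_comm_one θ 1 1 1 2 (by decide),
    u_comm_two θ 2 0 1 1 (by decide),
    u_comm_one θ 2 1 1 1 (by decide),
    u_comm_zero θ 1 1 2 2 (by decide),
    u_comm_zero θ 1 2 2 0 (by decide),
    u_comm_two θ 2 1 1 2 (by decide),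
    u_comm_one θ 2 2 1 2 (by decide),
    u_comm_one θ 2 0 2 1 (by decide),
    u_comm_one θ 2 2 2 0 (by decide),
    u_comm_one θ 2 1 2 2 (by decide),
    comul θ, counit θ, antipode θ, isCompactQuantumGroup_CSU3 θ, isCounit_counit θ,
    isCoinverse_antipode θ, fun n f k p r a b h => comul_elt θ f a b h, counit_elt θ,
    fun n f => antipodeOp_quantize θ f.2, comul_u θ, counit_u θ, antipode_u θ⟩
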